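/- Let $\nu\ge 1$. Write $\mathcal H^s=\mathcal H^s(\mathbb R^\nu)$ for the usual complex Sobolev spaces, $\mathcal H^0=L^2(\mathbb R^\nu)$, $\|f\|_{\mathcal H^1}^2=\int(|f|^2+|\nabla f|^2)\,dx$, and let $\mathcal H^{-1}$ be the adjoint space of $\mathcal H^1$ (bounded antilinear functionals). Let $q$ be multiplication by $x$ and $p=-i\nabla$. For a real $C^\infty$ vector field $u$ on $\mathbb R^\nu$ whose derivatives of order $\ge 1$ are all bounded, let $A_u$ be the self-adjoint operator in $L^2(\mathbb R^\nu)$ obtained as the closure of $\frac12\bigl(u(p)\cdot q+q\cdot u(p)\bigr)$ on $C_c^\infty(\mathbb R^\nu)$. For $u(x)=x$ write $A_D$ (the generator of dilations). Let $\mathcal U$ be the set of $C^\infty$ vector fields $u:\mathbb R^\nu\to\mathbb R^\nu$ that are bounded together with all their derivatives and satisfy $x\cdot u(x)>0$ for all $x\neq 0$. For $u\in\mathcal U$ and for $u(x)=x$ the unitary group $e^{itA_u}$ leaves $\mathcal H^1$ invariant and extends to $\mathcal H^{-1}$ by duality; a bounded operator $T:\mathcal H^1\to\mathcal H^{-1}$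 is of class $C^k(A_u,\mathcal H^1,\mathcal H^{-1})$ if for every $f\in\mathcal H^1$ the map $\mathbb R\ni t\mapsto e^{itA_u}Te^{-itA_u}f\in\mathcal H^{-1}$ is of class $C^k$, and of class $C^\infty(A_u,\mathcal H^1,\mathcal H^{-1})$ if this holds for all $k\in\mathbb N$. Let $\kappa\in C_c^\infty(\mathbb R,\mathbb R)$ with $\kappa=1$ on $[-1,1]$ and $0\le\kappa\le 1$, and let $$V(x)=(1-\kappa(|x|))\,e^{3|x|/4}\sin\bigl(e^{|x|}\bigr),\qquad x\in\mathbb R^\nu.$$ Then: (1) multiplication by $V$ on $C_c^\infty(\mathbb R^\nu)$, that is, the form $(\varphi,\psi)\mapsto\int V\varphi\overline{\psi}\,dx$, extends to a unique bounded operator $V:\mathcal H^1\to\mathcal H^{-1}$, and this operator is compact; (2) for every $u\in\mathcal U$, $V$ is of class $C^\infty(A_u,\mathcal H^1,\mathcal H^{-1})$; (3) $V$ is not $\Delta$-bounded, i.e. it is not true that multiplication by $V$ maps $\mathcal H^2$ into $L^2$ with $\|Vf\|\le a\|\Delta f\|+b\|f\|$ for all $f\in\mathcal H^2$ and some constants $a,b$;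 (4) $V$ is not of class $C^1(A_D,\mathcal H^1,\mathcal H^{-1})$. -/

import Mathlib

open scoped ContDiff

noncomputable section

open MeasureTheory SchwartzMap LineDeriv Laplacian

namespace Oscillating

/-- Configuration space `ℝ^ν`. -/
abbrev X (ν : ℕ) : Type := EuclideanSpace ℝ (Fin ν)

/-- The Hilbert space `L²(ℝ^ν)` of complex functions, with Lebesgue measure. -/
abbrev L2 (ν : ℕ) : Type := Lp ℂ 2 (volume : Measure (X ν))

/-- The Sobolev space `H¹`, realised as the space of all pairs `(f, (∂₁f, …, ∂_νf))` with `f` and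
all its distributional derivatives in `L²`.  The norm is `(‖f‖² + ∑ ‖∂_j f‖²)^(1/2)`. -/
def H1 (ν : ℕ) : Submodule ℂ (WithLp 2 (L2 ν × PiLp 2 (fun _ : Fin ν => L2 ν))) where
  carrier := {p | ∀ j : Fin ν,
    ∂_{EuclideanSpace.single j (1 : ℝ)} (p.fst : 𝓢'(X ν, ℂ)) = (p.snd j : 𝓢'(X ν, ℂ))}
  zero_mem' := by
    intro j
    simp only [← Lp.toTemperedDistributionCLM_apply, WithLp.zero_fst, WithLp.zero_snd,
      PiLp.zero_apply, map_zero, lineDerivOp_zero]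
  add_mem' := by
    intro p q hp hq j
    have h1 := hp j
    have h2 := hq j
    simp only [← Lp.toTemperedDistributionCLM_apply] at h1 h2
    simp only [← Lp.toTemperedDistributionCLM_apply, WithLp.add_fst, WithLp.add_snd,
      PiLp.add_apply, map_add, lineDerivOp_add, h1, h2]
  smul_mem' := by
    intro c p hp j
    have h1 := hp j
    simp only [← Lp.toTemperedDistributionCLM_apply] at h1
    simp only [← Lp.toTemperedDistributionCLM_apply, WithLp.smul_fst, WithLp.smul_snd,
      PiLp.smul_apply, map_smul, lineDerivOp_smul, h1]

/-- The inclusion `H¹ ⊂ L²`. -/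
def H1.toL2 {ν : ℕ} (f : H1 ν) : L2 ν := (f : WithLp 2 (L2 ν × PiLp 2 (fun _ : Fin ν => L2 ν))).fst

/-- `H⁻¹`, the adjoint space of `H¹`: bounded antilinear functionals on `H¹`, with the dual norm. -/
abbrev Hneg1 (ν : ℕ) : Type := H1 ν →L⋆[ℂ] ℂ

/-- For Schwartz functions the classical and the distributional derivatives agree. -/
theorem lineDeriv_toLp {ν : ℕ} (φ : 𝓢(X ν, ℂ)) (m : X ν) :
    ∂_{m} ((φ.toLp 2 : L2 ν) : 𝓢'(X ν, ℂ)) =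
      (((∂_{m} φ : 𝓢(X ν, ℂ)).toLp 2 : L2 ν) : 𝓢'(X ν, ℂ)) := by
  have h1 := Lp.toTemperedDistribution_toLp_eq (μ := (volume : Measure (X ν))) (p := 2) φ
  have h2 := Lp.toTemperedDistribution_toLp_eq (μ := (volume : Measure (X ν))) (p := 2)
    (∂_{m} φ : 𝓢(X ν, ℂ))
  exact (congrArg (fun T : 𝓢'(X ν, ℂ) => ∂_{m} T) h1).trans
    ((TemperedDistribution.lineDerivOp_toTemperedDistributionCLM_eq φ m).trans h2.symm)

/-- A Schwartz function as an element of `H¹`. -/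
def H1.ofSchwartz {ν : ℕ} (φ : 𝓢(X ν, ℂ)) : H1 ν :=
  ⟨WithLp.toLp 2 (φ.toLp 2, WithLp.toLp 2 fun j =>
      (∂_{EuclideanSpace.single j (1 : ℝ)} φ : 𝓢(X ν, ℂ)).toLp 2), by
    intro j
    exact lineDeriv_toLp φ _⟩

/-- The symmetric operator `A_u = ½ (u(p)·q + q·u(p))` on Schwartz functions, for a vector field
`u` with smooth components of polynomial growth.  Here `q_j` is multiplication by `x_j`, and
`u_j(p)`, `p = -i∇`, is the Fourier multiplier with symbol `u_j`; the factor `2π` comes from the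
normalisation `∫ e^{-2πi x·ξ} f(x) dx` of the Fourier transform, for which `p` corresponds to
multiplication by `2πξ`. -/
def conjOp {ν : ℕ} (u : X ν → X ν) (φ : 𝓢(X ν, ℂ)) : 𝓢(X ν, ℂ) :=
  (1 / 2 : ℂ) • ∑ j : Fin ν,
    (SchwartzMap.fourierMultiplierCLM ℂ (fun ξ : X ν => ((u ((2 * Real.pi) • ξ) j : ℝ) : ℂ))
        (SchwartzMap.smulLeftCLM ℂ (fun x : X ν => ((x j : ℝ) : ℂ)) φ)
      + SchwartzMap.smulLeftCLM ℂ (fun x : X ν => ((x j : ℝ) : ℂ))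
        (SchwartzMap.fourierMultiplierCLM ℂ
          (fun ξ : X ν => ((u ((2 * Real.pi) • ξ) j : ℝ) : ℂ)) φ))

/-- The graph in `L² × L²` of `A_u` with domain `C_c^∞(ℝ^ν)`. -/
def conjGraph {ν : ℕ} (u : X ν → X ν) : Set (L2 ν × L2 ν) :=
  {p | ∃ φ : 𝓢(X ν, ℂ), HasCompactSupport (φ : X ν → ℂ) ∧
    p = (φ.toLp 2, (conjOp u φ).toLp 2)}

/-- `U` is the strongly continuous one-parameter unitary group `t ↦ e^{itA_u}` on `L²`, where `A_u`
denotes the closure of the operator `½ (u(p)·q + q·u(p))` on `C_c^∞(ℝ^ν)`: the infinitesimal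
generator of `U` is exactly `i A_u`, domains included. -/
structure IsConjGroup {ν : ℕ} (u : X ν → X ν) (U : ℝ → L2 ν →L[ℂ] L2 ν) : Prop where
  map_zero : U 0 = ContinuousLinearMap.id ℂ (L2 ν)
  map_add : ∀ s t : ℝ, U (s + t) = (U s).comp (U t)
  norm_map : ∀ (t : ℝ) (f : L2 ν), ‖U t f‖ = ‖f‖
  continuous : ∀ f : L2 ν, Continuous fun t : ℝ => U t f
  generator : ∀ f h : L2 ν,
    HasDerivAt (fun t : ℝ => U t f) (Complex.I • h) 0 ↔ (f, h) ∈ closure (conjGraph u)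

/-- `W` is the group `t ↦ e^{itA_u}` on `H¹`: the group on `L²` exists, leaves `H¹` invariant, and
its restriction to `H¹` is `W`. -/
def IsConjGroupH1 {ν : ℕ} (u : X ν → X ν) (W : ℝ → H1 ν →L[ℂ] H1 ν) : Prop :=
  ∃ U : ℝ → L2 ν →L[ℂ] L2 ν, IsConjGroup u U ∧
    ∀ (t : ℝ) (f : H1 ν), H1.toL2 (W t f) = U t (H1.toL2 f)

/-- `T` is of class `C^k(A_u, H¹, H⁻¹)`: for every `f ∈ H¹` the map
`t ↦ e^{itA_u} T e^{-itA_u} f ∈ H⁻¹` is of class `C^k`.  The group on `H⁻¹` is the adjoint one,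
`⟨e^{itA_u} ℓ, g⟩ = ⟨ℓ, e^{-itA_u} g⟩`, which extends the group on `L²`. -/
def IsOfClass {ν : ℕ} (k : ℕ∞) (u : X ν → X ν) (T : H1 ν →L[ℂ] Hneg1 ν) : Prop :=
  ∃ W : ℝ → H1 ν →L[ℂ] H1 ν, IsConjGroupH1 u W ∧
    ∀ f : H1 ν, ContDiff ℝ k (fun t : ℝ => ((T (W (-t) f)).comp (W (-t)) : Hneg1 ν))

/-- The class `𝒰`: smooth vector fields, bounded with all their derivatives, such that
`x · u(x) > 0` for all `x ≠ 0`. -/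
structure IsAdmissible {ν : ℕ} (u : X ν → X ν) : Prop where
  smooth : ContDiff ℝ ∞ u
  bounded : ∀ n : ℕ, ∃ C : ℝ, ∀ x : X ν, ‖iteratedFDeriv ℝ n u x‖ ≤ C
  pos : ∀ x : X ν, x ≠ 0 → 0 < inner ℝ x (u x)

/-- The vector field `u(x) = x`, for which `A_u` is the generator of dilations
`A_D = ½ (p·q + q·p)`. -/
def dilationField (ν : ℕ) : X ν → X ν := fun x => x

/-- `T : H¹ → H⁻¹` is the operator of multiplication by the function `V`:
`⟨T φ, ψ⟩ = ∫ V φ ψ̄` for all `φ, ψ ∈ C_c^∞(ℝ^ν)`. -/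
def IsMultiplicationBy {ν : ℕ} (V : X ν → ℝ) (T : H1 ν →L[ℂ] Hneg1 ν) : Prop :=
  ∀ φ ψ : 𝓢(X ν, ℂ), HasCompactSupport (φ : X ν → ℂ) → HasCompactSupport (ψ : X ν → ℂ) →
    T (H1.ofSchwartz φ) (H1.ofSchwartz ψ) = ∫ x, (V x : ℂ) * φ x * starRingEnd ℂ (ψ x)

/-- The function `V` is `Δ`-bounded: multiplication by `V` maps `H² = D(Δ)` into `L²`, and
`‖V f‖ ≤ a ‖Δ f‖ + b ‖f‖` for all `f ∈ H²`, with constants `a`, `b`. -/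
def IsLaplacianBounded {ν : ℕ} (V : X ν → ℝ) : Prop :=
  ∃ a b : ℝ, ∀ f h : L2 ν, TemperedDistribution.MemSobolev 2 2 (f : 𝓢'(X ν, ℂ)) →
    Δ (f : 𝓢'(X ν, ℂ)) = (h : 𝓢'(X ν, ℂ)) →
    ∃ hV : MemLp (fun x => (V x : ℂ) * f x) 2 volume, ‖hV.toLp‖ ≤ a * ‖h‖ + b * ‖f‖

/-- The potential `V(x) = (1 - κ(|x|)) e^{3|x|/4} sin(e^{|x|})`. -/
def potential {ν : ℕ} (κ : ℝ → ℝ) (x : X ν) : ℝ :=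
  (1 - κ ‖x‖) * Real.exp (3 * ‖x‖ / 4) * Real.sin (Real.exp ‖x‖)

end Oscillating

end

open scoped ContDiff
noncomputable section
open MeasureTheory SchwartzMap LineDeriv Laplacian
namespace Oscillating

open scoped ENNReal FourierTransform Topology
open Filter

section

variable {ν : ℕ}

/-! ### Bounded multiplication operators on `L²` -/

/-! The theorem rests on a decomposition `V = div F + H` with `F(x) = x m(|x|)` and `m(r) = -(1 -
κ(r)) e^{-r/4} cos(e^r) / r`. Differentiating `cos(e^r)` produces a factor `e^r`, so the
exponentially large `V` is the divergence of a field of size `e^{-|x|/4}`, up to a remainder `H` of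
that same size (`IsCutoff.radial_divergence`, `IsCutoff.sum_fderiv_fieldF`). Integrating by parts,
the form of `V` becomes `∫ H φ ψ̄ - ∑ ∫ F_j (∂_j φ ψ̄ + φ ∂_j ψ̄)`, which is bounded on `H¹`. Each
coefficient is split as `expWeight` times a second, still rapidly decaying, factor. Thus
`potentialOp` is a finite sum of products `B* A` (`pairOp`), where `A, B : H¹ → L²` are `f ↦ g f` or
`f ↦ g ∂_j f` with `g` rapidly decaying. Uniqueness is the density of test functions in `H¹`.

Compactness: each product has a factor `f ↦ g f` without derivative, and this map is compact from
`H¹` to `L²` (`isCompactOperator_mulOp`), because a momentum cutoff approximates the inclusion in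
norm and `g(q) θ(cp)` is Hilbert-Schmidt. The adjoint of a compact operator is compact, so it does
not matter on which side the factor stands.

Smoothness for `u ∈ 𝒰`: since `u` is bounded with its derivatives, one application of `A_u` costs
one power of `x` and no derivative (`wnorm_conjOp_le`). Hence `A_u^n g(q)` is bounded for every `n`,
however wildly `g` oscillates. The matrix elements of `g(q) e^{itA_u}` therefore have derivatives of
all orders with uniform bounds, and `contDiff_of_weak` upgrades this to smoothness in norm. A factor
`g ∂_j` is treated with `[A_u, ∂_j] = -u_j(p)`.

The groups have to be constructed. Essential self-adjointness of `A_u`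
(`eq_zero_of_orthogonal_range`) follows from a mollifier whose commutator with `A_u` tends strongly
to zero; it needs only bounded derivatives of `u`, so it includes dilations. A proof of Stone's
theorem by bounded approximations then gives the group. Invariance of `H¹` is a Gronwall estimate
for a bounded regularisation of the weight `1 + |ξ|²`, uniform in the regularisation
(`IsConjGroup.energy_le`).

Both negative statements are tested on `θ(x/R)`, equal to one for `|x| ≤ 2R` and zero for `|x| ≥
3R`, with integrals of `sin²(e^{|x|})` over the shell `2R - 1 ≤ |x| ≤ 2R` bounded below. In `L²`, `V
θ(x/R)` has squared norm at least of order `e^{3R}`, whereas the squared norms of `θ(x/R)` and of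
its Laplacian are `O(R^ν)`; so `V` is not `Δ`-bounded. If `V` were of class `C¹(A_D)`, the uniform
boundedness principle would bound the commutator form by `C ‖φ‖ ‖ψ‖` in `H¹`. Take `φ = θ(x/R)` and
`ψ = Q φ` with `Q = (1 - κ) cos(e^{|x|})`. The commutator then contains the integral of `|x|
e^{7|x|/4} sin²(e^{|x|})` over the shell, of order at least `e^{7R/2}`; the product of the norms is
only `O(R^ν e^{3R})` and the other terms are `O(R^ν e^{9R/4})`. -/

open Classical in
/-- Multiplication by an essentially bounded function on `L²` (and `0` for other functions). -/
def mulL2 (g : X ν → ℂ) : L2 ν →L[ℂ] L2 ν :=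
  if h : MemLp g ∞ (volume : Measure (X ν)) then
    (ContinuousLinearMap.mul ℂ ℂ).holderL volume ∞ 2 2 (h.toLp g) else 0

theorem coeFn_mulL2 {g : X ν → ℂ} (h : MemLp g ∞ (volume : Measure (X ν))) (f : L2 ν) :
    mulL2 g f =ᵐ[volume] fun x => g x * f x := by
  rw [mulL2, dif_pos h, ContinuousLinearMap.holderL_apply_apply]
  filter_upwards [(ContinuousLinearMap.mul ℂ ℂ).coeFn_holder (r := 2) (h.toLp g) f, h.coeFn_toLp]
    with x hx hx'
  rw [hx, hx']
  rfl

theorem norm_mulL2_apply_le {g : X ν → ℂ} (h : MemLp g ∞ (volume : Measure (X ν))) {C : ℝ}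
    (hC : ∀ x, ‖g x‖ ≤ C) (f : L2 ν) : ‖mulL2 g f‖ ≤ C * ‖f‖ := by
  apply Lp.norm_le_mul_norm_of_ae_le_mul
  filter_upwards [coeFn_mulL2 h f] with x hx
  rw [hx, norm_mul]
  exact mul_le_mul_of_nonneg_right (hC x) (norm_nonneg _)

theorem memLp_top_of_continuous {g : X ν → ℂ} (hg : Continuous g) {C : ℝ} (hC : ∀ x, ‖g x‖ ≤ C) :
    MemLp g ∞ (volume : Measure (X ν)) :=
  memLp_top_of_bound hg.aestronglyMeasurable C (Eventually.of_forall hC)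

theorem memLp_top_conj {g : X ν → ℂ} (h : MemLp g ∞ (volume : Measure (X ν))) :
    MemLp (fun x => starRingEnd ℂ (g x)) ∞ (volume : Measure (X ν)) := by
  refine h.of_le (Complex.continuous_conj.comp_aestronglyMeasurable h.1) ?_
  exact Eventually.of_forall fun x => by simp

theorem inner_mulL2_left {g : X ν → ℂ} (h : MemLp g ∞ (volume : Measure (X ν))) (f k : L2 ν) :
    inner ℂ (mulL2 g f) k = inner ℂ f (mulL2 (fun x => starRingEnd ℂ (g x)) k) := by
  rw [L2.inner_def, L2.inner_def]
  apply integral_congr_ae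
  filter_upwards [coeFn_mulL2 h f, coeFn_mulL2 (memLp_top_conj h) k] with x a b
  rw [a, b]
  simp only [RCLike.inner_apply, map_mul]
  ring

theorem inner_mulL2_left_of_real {g : X ν → ℝ} (h : MemLp (fun x => (g x : ℂ)) ∞ (volume : Measure (X ν)))
    (f k : L2 ν) :
    inner ℂ (mulL2 (fun x => (g x : ℂ)) f) k = inner ℂ f (mulL2 (fun x => (g x : ℂ)) k) := by
  rw [inner_mulL2_left h]
  simp

/-- The embedding of Schwartz functions into `L²`. -/
abbrev embL2 (φ : 𝓢(X ν, ℂ)) : L2 ν := φ.toLp 2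

theorem embL2_eq (φ : 𝓢(X ν, ℂ)) : embL2 φ = toLpCLM ℂ (E := X ν) ℂ 2 volume φ := rfl

theorem embL2_add (φ ψ : 𝓢(X ν, ℂ)) : embL2 (φ + ψ) = embL2 φ + embL2 ψ := by
  simp only [embL2_eq, map_add]

theorem embL2_sub (φ ψ : 𝓢(X ν, ℂ)) : embL2 (φ - ψ) = embL2 φ - embL2 ψ := by
  simp only [embL2_eq, map_sub]

theorem embL2_smul (c : ℂ) (φ : 𝓢(X ν, ℂ)) : embL2 (c • φ) = c • embL2 φ := by
  simp only [embL2_eq, map_smul]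

theorem embL2_sum {ι : Type*} (s : Finset ι) (φ : ι → 𝓢(X ν, ℂ)) :
    embL2 (∑ i ∈ s, φ i) = ∑ i ∈ s, embL2 (φ i) := by
  simp only [embL2_eq, map_sum]

theorem continuous_embL2 : Continuous (embL2 : 𝓢(X ν, ℂ) → L2 ν) :=
  (toLpCLM ℂ (E := X ν) ℂ 2 volume).continuous

theorem denseRange_embL2 : DenseRange (embL2 : 𝓢(X ν, ℂ) → L2 ν) :=
  SchwartzMap.denseRange_toLpCLM ENNReal.ofNat_ne_top

theorem coeFn_embL2 (φ : 𝓢(X ν, ℂ)) : embL2 φ =ᵐ[volume] φ := φ.coeFn_toLp 2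

/-- Multiplication of Schwartz functions by a function of temperate growth. -/
abbrev mulS (g : X ν → ℂ) : 𝓢(X ν, ℂ) →L[ℂ] 𝓢(X ν, ℂ) := SchwartzMap.smulLeftCLM ℂ g

/-- Fourier multipliers on Schwartz functions. -/
abbrev mulF (m : X ν → ℂ) : 𝓢(X ν, ℂ) →L[ℂ] 𝓢(X ν, ℂ) := SchwartzMap.fourierMultiplierCLM ℂ m

theorem mulL2_embL2 {g : X ν → ℂ} (h : MemLp g ∞ (volume : Measure (X ν)))
    (hg : g.HasTemperateGrowth) (φ : 𝓢(X ν, ℂ)) : mulL2 g (embL2 φ) = embL2 (mulS g φ) := by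
  apply Lp.ext
  filter_upwards [coeFn_mulL2 h (embL2 φ), coeFn_embL2 φ, coeFn_embL2 (mulS g φ)] with x a b c
  rw [a, b, c, SchwartzMap.smulLeftCLM_apply_apply hg, smul_eq_mul]

/-- Fourier multipliers on `L²` with an essentially bounded symbol. -/
def fmulL2 (m : X ν → ℂ) : L2 ν →L[ℂ] L2 ν :=
  ((Lp.fourierTransformₗᵢ (X ν) ℂ).symm.toContinuousLinearEquiv : L2 ν →L[ℂ] L2 ν).comp
    ((mulL2 m).comp
      ((Lp.fourierTransformₗᵢ (X ν) ℂ).toContinuousLinearEquiv : L2 ν →L[ℂ] L2 ν))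

theorem fmulL2_apply (m : X ν → ℂ) (f : L2 ν) : fmulL2 m f = 𝓕⁻ (mulL2 m (𝓕 f)) := rfl

theorem fourier_fmulL2 (m : X ν → ℂ) (f : L2 ν) : 𝓕 (fmulL2 m f) = mulL2 m (𝓕 f) := by
  rw [fmulL2_apply, FourierTransform.fourier_fourierInv_eq]

theorem norm_fourierInv_L2 (f : L2 ν) : ‖𝓕⁻ f‖ = ‖f‖ :=
  (Lp.fourierTransformₗᵢ (X ν) ℂ).symm.norm_map f

theorem norm_fmulL2_apply_le {m : X ν → ℂ} (h : MemLp m ∞ (volume : Measure (X ν))) {C : ℝ}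
    (hC : ∀ x, ‖m x‖ ≤ C) (f : L2 ν) : ‖fmulL2 m f‖ ≤ C * ‖f‖ := by
  rw [fmulL2_apply, norm_fourierInv_L2]
  simpa using norm_mulL2_apply_le h hC (𝓕 f)

theorem inner_fmulL2_left {g : X ν → ℂ} (h : MemLp g ∞ (volume : Measure (X ν))) (f k : L2 ν) :
    inner ℂ (fmulL2 g f) k = inner ℂ f (fmulL2 (fun x => starRingEnd ℂ (g x)) k) := by
  rw [← Lp.inner_fourier_eq, fourier_fmulL2, inner_mulL2_left h, ← fourier_fmulL2,
    Lp.inner_fourier_eq]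

theorem inner_fmulL2_left_of_real {g : X ν → ℝ}
    (h : MemLp (fun x => (g x : ℂ)) ∞ (volume : Measure (X ν))) (f k : L2 ν) :
    inner ℂ (fmulL2 (fun x => (g x : ℂ)) f) k = inner ℂ f (fmulL2 (fun x => (g x : ℂ)) k) := by
  rw [inner_fmulL2_left h]
  simp

theorem fmulL2_embL2 {g : X ν → ℂ} (h : MemLp g ∞ (volume : Measure (X ν)))
    (hg : g.HasTemperateGrowth) (φ : 𝓢(X ν, ℂ)) : fmulL2 g (embL2 φ) = embL2 (mulF g φ) := by
  rw [fmulL2_apply, embL2, SchwartzMap.toLp_fourier_eq, mulL2_embL2 h hg,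
    SchwartzMap.toLp_fourierInv_eq]
  rfl

/-- Strong convergence of multiplication operators. -/
theorem tendsto_mulL2 {g : ℕ → X ν → ℂ} {g₀ : X ν → ℂ}
    (h : ∀ n, MemLp (g n) ∞ (volume : Measure (X ν))) (h₀ : MemLp g₀ ∞ (volume : Measure (X ν)))
    {C : ℝ} (hC : ∀ n x, ‖g n x‖ ≤ C) (hC₀ : ∀ x, ‖g₀ x‖ ≤ C)
    (hlim : ∀ x, Tendsto (fun n => g n x) atTop (𝓝 (g₀ x))) (f : L2 ν) :
    Tendsto (fun n => mulL2 (g n) f) atTop (𝓝 (mulL2 g₀ f)) := by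
  rw [tendsto_iff_norm_sub_tendsto_zero]
  have key : Tendsto (fun n => ‖mulL2 (g n) f - mulL2 g₀ f‖ ^ 2) atTop (𝓝 0) := by
    have h1 : ∀ n, ‖mulL2 (g n) f - mulL2 g₀ f‖ ^ 2 = ∫ x, ‖(g n x - g₀ x) * f x‖ ^ 2 := by
      intro n
      rw [← @inner_self_eq_norm_sq ℂ, L2.inner_def, ← integral_re (L2.integrable_inner _ _)]
      apply integral_congr_ae
      filter_upwards [Lp.coeFn_sub (mulL2 (g n) f) (mulL2 g₀ f), coeFn_mulL2 (h n) f,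
        coeFn_mulL2 h₀ f] with x a b c
      rw [a, Pi.sub_apply, b, c, inner_self_eq_norm_sq, sub_mul]
    simp_rw [h1]
    have h2 : (0 : ℝ) = ∫ _ : X ν, (0 : ℝ) := by simp
    rw [h2]
    apply tendsto_integral_of_dominated_convergence (fun x => (2 * C) ^ 2 * ‖f x‖ ^ 2)
    · intro n
      exact ((((h n).1.sub h₀.1).mul (Lp.aestronglyMeasurable f)).norm.pow 2)
    · exact ((Lp.memLp f).integrable_norm_pow (by norm_num)).const_mul _
    · intro n
      refine Eventually.of_forall fun x => ?_
      rw [Real.norm_of_nonneg (by positivity), norm_mul, mul_pow]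
      gcongr
      calc ‖g n x - g₀ x‖ ≤ ‖g n x‖ + ‖g₀ x‖ := norm_sub_le _ _
        _ ≤ 2 * C := by linarith [hC n x, hC₀ x]
    · refine Eventually.of_forall fun x => ?_
      have : Tendsto (fun n => ‖(g n x - g₀ x) * f x‖ ^ 2) atTop (𝓝 (‖(g₀ x - g₀ x) * f x‖ ^ 2)) :=
        ((((hlim x).sub_const _).mul_const _).norm.pow 2)
      simpa using this
  have := (Real.continuous_sqrt.tendsto 0).comp key
  simpa [Function.comp_def, Real.sqrt_sq (norm_nonneg _)] using this

/-! ### Operators on Schwartz functions -/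

/-- The `j`-th coordinate function. -/
abbrev coord (j : Fin ν) : X ν → ℂ := fun x => ((x j : ℝ) : ℂ)

/-- The `j`-th standard basis vector. -/
abbrev stdVec (j : Fin ν) : X ν := EuclideanSpace.single j (1 : ℝ)

theorem hasTemperateGrowth_coord (j : Fin ν) : (coord j).HasTemperateGrowth := by
  have h : (fun x : X ν => (x j : ℝ)).HasTemperateGrowth :=
    (EuclideanSpace.proj j : X ν →L[ℝ] ℝ).hasTemperateGrowth
  exact Function.HasTemperateGrowth.comp (g := Complex.ofReal)
    Function.Complex.hasTemperateGrowth_ofReal h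

theorem inner_stdVec (x : X ν) (j : Fin ν) : inner ℝ x (stdVec j) = x j := by
  simp [stdVec, EuclideanSpace.inner_single_right]

/-- The partial derivative of a function. -/
abbrev pd (j : Fin ν) (m : X ν → ℂ) : X ν → ℂ := fun ξ => fderiv ℝ m ξ (stdVec j)

theorem hasTemperateGrowth_fderiv {E F : Type*} [NormedAddCommGroup E] [NormedSpace ℝ E]
    [NormedAddCommGroup F] [NormedSpace ℝ F] {m : E → F} (hm : m.HasTemperateGrowth) :
    (fderiv ℝ m).HasTemperateGrowth := by
  refine ⟨hm.1.fderiv_right (by simp), fun n => ?_⟩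
  obtain ⟨k, C, h⟩ := hm.2 (n + 1)
  exact ⟨k, C, fun x => by rw [norm_iteratedFDeriv_fderiv]; exact h x⟩

theorem hasTemperateGrowth_pd {m : X ν → ℂ} (hm : m.HasTemperateGrowth) (j : Fin ν) :
    (pd j m).HasTemperateGrowth :=
  ((ContinuousLinearMap.apply ℝ ℂ (stdVec j)).hasTemperateGrowth).comp
    (hasTemperateGrowth_fderiv hm)

theorem lineDeriv_mulS {m : X ν → ℂ} (hm : m.HasTemperateGrowth) (j : Fin ν) (φ : 𝓢(X ν, ℂ)) :
    ∂_{stdVec j} (mulS m φ) = mulS (pd j m) φ + mulS m (∂_{stdVec j} φ) := by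
  ext x
  rw [SchwartzMap.lineDerivOp_apply_eq_fderiv, SchwartzMap.smulLeftCLM_apply hm,
    add_apply, SchwartzMap.smulLeftCLM_apply_apply (hasTemperateGrowth_pd hm j),
    SchwartzMap.smulLeftCLM_apply_apply hm, SchwartzMap.lineDerivOp_apply_eq_fderiv]
  have h1 : DifferentiableAt ℝ m x := (hm.1.differentiable (by simp)).differentiableAt
  rw [fderiv_fun_smul h1 φ.differentiableAt]
  simp [pd]
  ring

/-- The canonical commutation relation: the Fourier transform turns `x_j` into `(i/2π) ∂_j`, and the
Leibniz rule for `∂_j (m 𝓕φ)` leaves the term with `∂_j m`. -/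
theorem mulF_mulS_coord {m : X ν → ℂ} (hm : m.HasTemperateGrowth) (j : Fin ν) (φ : 𝓢(X ν, ℂ)) :
    mulF m (mulS (coord j) φ) = mulS (coord j) (mulF m φ)
      - (Complex.I / (2 * Real.pi)) • mulF (pd j m) φ := by
  have hc : (2 * (Real.pi : ℂ) * Complex.I) ≠ 0 := by
    simp [Real.pi_ne_zero]
  have hin : (fun x : X ν => inner ℝ x (stdVec j)) = fun x => (x j : ℝ) := by
    ext x; exact inner_stdVec x j
  have hcoord : ∀ ψ : 𝓢(X ν, ℂ), SchwartzMap.smulLeftCLM ℂ (inner ℝ · (stdVec j)) ψ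
      = mulS (coord j) ψ := by
    intro ψ
    have hr : (fun x : X ν => inner ℝ x (stdVec j)).HasTemperateGrowth := by fun_prop
    rw [← SchwartzMap.smulLeftCLM_ofReal ℂ hr]
    congr 2
    ext x
    simp [coord, inner_stdVec x j]
  have h1 : 𝓕 (mulS (coord j) φ) = (Complex.I / (2 * Real.pi)) • ∂_{stdVec j} (𝓕 φ) := by
    rw [SchwartzMap.lineDerivOp_fourier_eq, hcoord, FourierTransform.fourier_smul, smul_smul]
    have : Complex.I / (2 * Real.pi) * -(2 * Real.pi * Complex.I) = 1 := by
      have : (Real.pi : ℂ) ≠ 0 := by simp [Real.pi_ne_zero]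
      field_simp
      simp
    rw [this, one_smul]
  have h2 : ∀ ψ : 𝓢(X ν, ℂ), 𝓕⁻ ((Complex.I / (2 * Real.pi)) • ∂_{stdVec j} ψ)
      = mulS (coord j) (𝓕⁻ ψ) := by
    intro ψ
    rw [FourierTransform.fourierInv_smul, SchwartzMap.fourierInv_lineDerivOp_eq, hcoord, smul_smul]
    have : Complex.I / (2 * Real.pi) * -(2 * Real.pi * Complex.I) = 1 := by
      have : (Real.pi : ℂ) ≠ 0 := by simp [Real.pi_ne_zero]
      field_simp
      simp
    rw [this, one_smul]
  rw [SchwartzMap.fourierMultiplierCLM_apply, h1, map_smul]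
  have h3 : mulS m (∂_{stdVec j} (𝓕 φ)) = ∂_{stdVec j} (mulS m (𝓕 φ)) - mulS (pd j m) (𝓕 φ) := by
    rw [lineDeriv_mulS hm, add_sub_cancel_left]
  have hsub : ∀ a b : 𝓢(X ν, ℂ), 𝓕⁻ (a - b) = 𝓕⁻ a - 𝓕⁻ b := fun a b =>
    map_sub (FourierTransform.fourierInvCLM ℂ 𝓢(X ν, ℂ)) a b
  rw [h3, smul_sub, hsub, h2, FourierTransform.fourierInv_smul]
  rfl

theorem inner_embL2 (φ ψ : 𝓢(X ν, ℂ)) :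
    inner ℂ (embL2 φ) (embL2 ψ) = ∫ x, ψ x * starRingEnd ℂ (φ x) := by
  rw [L2.inner_def]
  apply integral_congr_ae
  filter_upwards [coeFn_embL2 φ, coeFn_embL2 ψ] with x a b
  rw [a, b, RCLike.inner_apply]

theorem inner_mulS_left_of_real {g : X ν → ℝ} (hg : (fun x => (g x : ℂ)).HasTemperateGrowth)
    (φ ψ : 𝓢(X ν, ℂ)) :
    inner ℂ (embL2 (mulS (fun x => (g x : ℂ)) φ)) (embL2 ψ)
      = inner ℂ (embL2 φ) (embL2 (mulS (fun x => (g x : ℂ)) ψ)) := by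
  rw [inner_embL2, inner_embL2]
  congr 1
  ext x
  rw [SchwartzMap.smulLeftCLM_apply_apply hg, SchwartzMap.smulLeftCLM_apply_apply hg]
  simp only [smul_eq_mul, map_mul, Complex.conj_ofReal]
  ring

theorem inner_mulF_left_of_real {g : X ν → ℝ} (hg : (fun x => (g x : ℂ)).HasTemperateGrowth)
    (φ ψ : 𝓢(X ν, ℂ)) :
    inner ℂ (embL2 (mulF (fun x => (g x : ℂ)) φ)) (embL2 ψ)
      = inner ℂ (embL2 φ) (embL2 (mulF (fun x => (g x : ℂ)) ψ)) := by
  have h : ∀ χ : 𝓢(X ν, ℂ), 𝓕 (embL2 (mulF (fun x => (g x : ℂ)) χ))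
      = embL2 (mulS (fun x => (g x : ℂ)) (𝓕 χ)) := by
    intro χ
    rw [SchwartzMap.toLp_fourier_eq, SchwartzMap.fourierMultiplierCLM_apply,
      FourierTransform.fourier_fourierInv_eq]
  rw [← Lp.inner_fourier_eq, h, ← Lp.inner_fourier_eq (embL2 φ), h, SchwartzMap.toLp_fourier_eq,
    SchwartzMap.toLp_fourier_eq, inner_mulS_left_of_real hg]

end

section

variable {ν : ℕ}

/-! ### Vector fields and the operator `A_u` -/

/-- Smooth vector fields with bounded derivatives of order at least one. -/
structure IsField (u : X ν → X ν) : Prop where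
  smooth : ContDiff ℝ ∞ u
  bounded : ∀ n : ℕ, 1 ≤ n → ∃ C : ℝ, ∀ x : X ν, ‖iteratedFDeriv ℝ n u x‖ ≤ C

theorem IsAdmissible.isField {u : X ν → X ν} (h : IsAdmissible u) : IsField u :=
  ⟨h.smooth, fun n _ => h.bounded n⟩

theorem isField_dilationField : IsField (dilationField ν) := by
  refine ⟨contDiff_id, fun n hn => ?_⟩
  obtain ⟨n, rfl⟩ : ∃ m, n = m + 1 := ⟨n - 1, by omega⟩
  refine ⟨1, fun x => ?_⟩
  rw [← norm_iteratedFDeriv_fderiv]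
  have : fderiv ℝ (dilationField ν) = fun _ => ContinuousLinearMap.id ℝ (X ν) := by
    ext1 y
    exact fderiv_fun_id
  rw [this]
  rcases n with _ | n
  · simpa using ContinuousLinearMap.norm_id_le
  · rw [iteratedFDeriv_succ_const]
    simp

theorem IsField.norm_fderiv_le {u : X ν → X ν} (h : IsField u) :
    ∃ C : ℝ, 0 ≤ C ∧ ∀ x, ‖fderiv ℝ u x‖ ≤ C := by
  obtain ⟨C, hC⟩ := h.bounded 1 le_rfl
  refine ⟨C, (norm_nonneg _).trans (hC 0), fun x => ?_⟩
  rw [← norm_iteratedFDeriv_zero (𝕜 := ℝ) (f := fderiv ℝ u), norm_iteratedFDeriv_fderiv]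
  exact hC x

theorem IsField.norm_le {u : X ν → X ν} (h : IsField u) :
    ∃ C : ℝ, 0 ≤ C ∧ ∀ x, ‖u x‖ ≤ C * (1 + ‖x‖) := by
  obtain ⟨C, hC0, hC⟩ := h.norm_fderiv_le
  refine ⟨‖u 0‖ + C, by positivity, fun x => ?_⟩
  have h1 : ‖u x - u 0‖ ≤ C * ‖x - 0‖ :=
    Convex.norm_image_sub_le_of_norm_fderiv_le (𝕜 := ℝ) (s := Set.univ)
      (fun y _ => (h.smooth.differentiable (by simp)).differentiableAt) (fun y _ => hC y)
      convex_univ (Set.mem_univ _) (Set.mem_univ _)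
  have h2 : ‖u x‖ ≤ ‖u x - u 0‖ + ‖u 0‖ := by simpa using norm_add_le (u x - u 0) (u 0)
  have h3 := norm_nonneg x
  have h4 := norm_nonneg (u 0)
  rw [sub_zero] at h1
  nlinarith

theorem IsField.hasTemperateGrowth {u : X ν → X ν} (h : IsField u) : u.HasTemperateGrowth := by
  refine ⟨h.smooth, fun n => ?_⟩
  rcases n with _ | n
  · obtain ⟨C, hC0, hC⟩ := h.norm_le
    exact ⟨1, C, fun x => by simpa using hC x⟩
  · obtain ⟨C, hC⟩ := h.bounded (n + 1) (by omega)
    exact ⟨0, C, fun x => by simpa using hC x⟩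

/-- The symbol of `u_j(p)`, real version. -/
abbrev symbR (u : X ν → X ν) (j : Fin ν) : X ν → ℝ := fun ξ => u ((2 * Real.pi) • ξ) j

/-- The symbol of `u_j(p)`. -/
abbrev symb (u : X ν → X ν) (j : Fin ν) : X ν → ℂ := fun ξ => ((u ((2 * Real.pi) • ξ) j : ℝ) : ℂ)

/-- The linear map that expresses `symb` through `u`. -/
def coordC (j : Fin ν) : X ν →L[ℝ] ℂ := Complex.ofRealCLM.comp (EuclideanSpace.proj j)

theorem symb_eq (u : X ν → X ν) (j : Fin ν) : symb u j = fun ξ => coordC j (u ((2 * Real.pi) • ξ)) :=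
  rfl

theorem IsField.hasTemperateGrowth_symb {u : X ν → X ν} (h : IsField u) (j : Fin ν) :
    (symb u j).HasTemperateGrowth := by
  rw [symb_eq]
  have h1 : (fun ξ : X ν => (2 * Real.pi) • ξ).HasTemperateGrowth :=
    ((2 * Real.pi) • ContinuousLinearMap.id ℝ (X ν)).hasTemperateGrowth
  exact (coordC j).hasTemperateGrowth.comp (h.hasTemperateGrowth.comp h1)

theorem norm_stdVec (j : Fin ν) : ‖stdVec j‖ = 1 := by simp [stdVec]

theorem IsField.norm_pd_symb_le {u : X ν → X ν} (h : IsField u) :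
    ∃ C : ℝ, 0 ≤ C ∧ ∀ j k ξ, ‖pd k (symb u j) ξ‖ ≤ C := by
  obtain ⟨C, hC0, hC⟩ := h.norm_fderiv_le
  refine ⟨C * (2 * Real.pi), by positivity, fun j k ξ => ?_⟩
  have h1 : HasFDerivAt (symb u j)
      ((coordC j).comp ((fderiv ℝ u ((2 * Real.pi) • ξ)).comp
        ((2 * Real.pi) • ContinuousLinearMap.id ℝ (X ν)))) ξ := by
    rw [symb_eq]
    refine (coordC j).hasFDerivAt.comp ξ (HasFDerivAt.comp ξ ?_ ?_)
    · exact ((h.smooth.differentiable (by simp)).differentiableAt).hasFDerivAt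
    · exact ((2 * Real.pi) • ContinuousLinearMap.id ℝ (X ν)).hasFDerivAt
  rw [pd, h1.fderiv]
  simp only [ContinuousLinearMap.comp_apply, smul_apply,
    ContinuousLinearMap.id_apply, map_smul, coordC, Complex.ofRealCLM_apply, norm_smul]
  rw [Real.norm_of_nonneg (by positivity), mul_comm C]
  gcongr
  calc ‖(((fderiv ℝ u ((2 * Real.pi) • ξ) (stdVec k)) j : ℝ) : ℂ)‖
      = ‖(fderiv ℝ u ((2 * Real.pi) • ξ) (stdVec k)) j‖ := Complex.norm_real _
    _ ≤ ‖fderiv ℝ u ((2 * Real.pi) • ξ) (stdVec k)‖ := PiLp.norm_apply_le _ j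
    _ ≤ ‖fderiv ℝ u ((2 * Real.pi) • ξ)‖ * ‖stdVec k‖ := ContinuousLinearMap.le_opNorm _ _
    _ ≤ C := by rw [norm_stdVec, mul_one]; exact hC _

theorem IsField.norm_symb_le {u : X ν → X ν} (h : IsField u) :
    ∃ C : ℝ, 0 ≤ C ∧ ∀ j ξ, ‖symb u j ξ‖ ≤ C * (1 + ‖ξ‖) := by
  obtain ⟨C, hC0, hC⟩ := h.norm_le
  refine ⟨C * (2 * Real.pi + 1), by positivity, fun j ξ => ?_⟩
  have h1 : ‖symb u j ξ‖ ≤ ‖u ((2 * Real.pi) • ξ)‖ := by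
    rw [Complex.norm_real]; exact PiLp.norm_apply_le _ j
  refine h1.trans ((hC _).trans ?_)
  rw [norm_smul, Real.norm_of_nonneg (by positivity), mul_assoc C]
  refine mul_le_mul_of_nonneg_left ?_ hC0
  have := norm_nonneg ξ
  nlinarith [Real.pi_pos]

/-- The constant `i / 2π`. -/
abbrev cpi : ℂ := Complex.I / (2 * Real.pi)

theorem mulS_coord_mulF {m : X ν → ℂ} (hm : m.HasTemperateGrowth) (j : Fin ν) (φ : 𝓢(X ν, ℂ)) :
    mulS (coord j) (mulF m φ) = mulF m (mulS (coord j) φ) + cpi • mulF (pd j m) φ := by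
  rw [mulF_mulS_coord hm]; abel

theorem conjOp_eq (u : X ν → X ν) (φ : 𝓢(X ν, ℂ)) :
    conjOp u φ = (1 / 2 : ℂ) • ∑ j : Fin ν, (mulF (symb u j) (mulS (coord j) φ)
      + mulS (coord j) (mulF (symb u j) φ)) := rfl

/-- With the coordinates acting first, `A_u` is visibly controlled by weighted norms of `φ`. The
other ordering, `conjOp_eq_right`, is the one in which a Fourier multiplier commutes past everything
except the coordinates. -/
theorem conjOp_eq_left {u : X ν → X ν} (h : IsField u) (φ : 𝓢(X ν, ℂ)) :
    conjOp u φ = ∑ j : Fin ν, (mulF (symb u j) (mulS (coord j) φ)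
      + (cpi / 2) • mulF (pd j (symb u j)) φ) := by
  rw [conjOp_eq, Finset.smul_sum]
  refine Finset.sum_congr rfl fun j _ => ?_
  rw [mulS_coord_mulF (h.hasTemperateGrowth_symb j)]
  module

theorem conjOp_eq_right {u : X ν → X ν} (h : IsField u) (φ : 𝓢(X ν, ℂ)) :
    conjOp u φ = ∑ j : Fin ν, (mulS (coord j) (mulF (symb u j) φ)
      - (cpi / 2) • mulF (pd j (symb u j)) φ) := by
  rw [conjOp_eq, Finset.smul_sum]
  refine Finset.sum_congr rfl fun j _ => ?_
  rw [mulF_mulS_coord (h.hasTemperateGrowth_symb j)]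
  module

/-- `A_u` as a continuous operator on Schwartz functions. -/
def conjCLM (u : X ν → X ν) : 𝓢(X ν, ℂ) →L[ℂ] 𝓢(X ν, ℂ) :=
  (1 / 2 : ℂ) • ∑ j : Fin ν, ((mulF (symb u j)).comp (mulS (coord j))
      + (mulS (coord j)).comp (mulF (symb u j)))

theorem conjCLM_apply (u : X ν → X ν) (φ : 𝓢(X ν, ℂ)) : conjCLM u φ = conjOp u φ := by
  simp [conjCLM, conjOp_eq]

theorem inner_conjOp_left {u : X ν → X ν} (h : IsField u) (φ ψ : 𝓢(X ν, ℂ)) :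
    inner ℂ (embL2 (conjOp u φ)) (embL2 ψ) = inner ℂ (embL2 φ) (embL2 (conjOp u ψ)) := by
  simp only [conjOp_eq, embL2_smul, embL2_sum, embL2_add, inner_smul_left, inner_smul_right,
    sum_inner, inner_sum, inner_add_left, inner_add_right]
  have h1 : starRingEnd ℂ (1 / 2 : ℂ) = 1 / 2 := by
    rw [show (1 / 2 : ℂ) = ((1 / 2 : ℝ) : ℂ) by push_cast; rfl, Complex.conj_ofReal]
  rw [h1]
  congr 1
  refine Finset.sum_congr rfl fun j _ => ?_
  rw [inner_mulF_left_of_real (g := symbR u j) (h.hasTemperateGrowth_symb j),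
    inner_mulS_left_of_real (g := fun x => x j) (hasTemperateGrowth_coord j),
    inner_mulS_left_of_real (g := fun x => x j) (hasTemperateGrowth_coord j),
    inner_mulF_left_of_real (g := symbR u j) (h.hasTemperateGrowth_symb j)]
  ring

theorem mulF_mulF {m₁ m₂ : X ν → ℂ} (h₁ : m₁.HasTemperateGrowth) (h₂ : m₂.HasTemperateGrowth)
    (φ : 𝓢(X ν, ℂ)) : mulF m₁ (mulF m₂ φ) = mulF (fun x => m₁ x * m₂ x) φ :=
  SchwartzMap.fourierMultiplierCLM_fourierMultiplierCLM_apply h₁ h₂ φ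

theorem mulF_comm {m₁ m₂ : X ν → ℂ} (h₁ : m₁.HasTemperateGrowth) (h₂ : m₂.HasTemperateGrowth)
    (φ : 𝓢(X ν, ℂ)) : mulF m₁ (mulF m₂ φ) = mulF m₂ (mulF m₁ φ) := by
  rw [mulF_mulF h₁ h₂, mulF_mulF h₂ h₁]
  simp only [mul_comm]

theorem mulS_mulS {m₁ m₂ : X ν → ℂ} (h₁ : m₁.HasTemperateGrowth) (h₂ : m₂.HasTemperateGrowth)
    (φ : 𝓢(X ν, ℂ)) : mulS m₁ (mulS m₂ φ) = mulS (fun x => m₁ x * m₂ x) φ :=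
  SchwartzMap.smulLeftCLM_smulLeftCLM_apply h₁ h₂ φ

theorem mulS_comm {m₁ m₂ : X ν → ℂ} (h₁ : m₁.HasTemperateGrowth) (h₂ : m₂.HasTemperateGrowth)
    (φ : 𝓢(X ν, ℂ)) : mulS m₁ (mulS m₂ φ) = mulS m₂ (mulS m₁ φ) := by
  rw [mulS_mulS h₁ h₂, mulS_mulS h₂ h₁]
  simp only [mul_comm]

/-- The commutator of `A_u` with a Fourier multiplier. -/
theorem conjOp_mulF {u : X ν → X ν} (h : IsField u) {m : X ν → ℂ} (hm : m.HasTemperateGrowth)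
    (φ : 𝓢(X ν, ℂ)) :
    conjOp u (mulF m φ) = mulF m (conjOp u φ)
      + cpi • ∑ j : Fin ν, mulF (symb u j) (mulF (pd j m) φ) := by
  rw [conjOp_eq_right h, conjOp_eq_right h, map_sum, Finset.smul_sum, ← Finset.sum_add_distrib]
  refine Finset.sum_congr rfl fun j _ => ?_
  have ha := h.hasTemperateGrowth_symb j
  rw [map_sub, map_smul, mulF_mulS_coord hm, mulF_comm hm ha,
    mulF_comm hm (hasTemperateGrowth_pd ha j), mulF_comm (hasTemperateGrowth_pd hm j) ha]
  abel

/-- The resolvent identity `a r - r a = r (r⁻¹ a - a r⁻¹) r` with `r⁻¹ = 1 + ε |x|²`: the inner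
commutator is `ε ∑ [x_k², a]`, and `[x_k², a] = x_k [x_k, a] + [x_k, a] x_k`, where `[x_k, a]` is
again a multiplier. Only first derivatives of `a` appear, each between two copies of `r`. -/
theorem mulF_mulS_resolvent {a r : X ν → ℂ} (ha : a.HasTemperateGrowth)
    (hr : r.HasTemperateGrowth) {ε : ℂ} (hε : ∀ x, r x * (1 + ε * ∑ k, coord k x * coord k x) = 1)
    (φ : 𝓢(X ν, ℂ)) :
    mulF a (mulS r φ) = mulS r (mulF a φ) + (ε * cpi) • ∑ k : Fin ν,
      (mulS r (mulS (coord k) (mulF (pd k a) (mulS r φ)))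
        + mulS r (mulF (pd k a) (mulS (coord k) (mulS r φ)))) := by
  have hcoord := fun k : Fin ν => hasTemperateGrowth_coord k
  have key : ∀ χ : 𝓢(X ν, ℂ),
      mulS r χ + ε • ∑ k : Fin ν, mulS r (mulS (coord k) (mulS (coord k) χ)) = χ := by
    intro χ
    ext x
    simp only [add_apply, smul_apply, sum_apply, smul_eq_mul,
      SchwartzMap.smulLeftCLM_apply_apply hr, SchwartzMap.smulLeftCLM_apply_apply (hcoord _)]
    calc _ = r x * (1 + ε * ∑ k, coord k x * coord k x) * χ x := by
          simp only [Finset.mul_sum, Finset.sum_mul, add_mul, mul_add, mul_one]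
          congr 1
          refine Finset.sum_congr rfl fun k _ => ?_
          ring
      _ = χ x := by rw [hε, one_mul]
  set χ := mulS r φ with hχ
  have h1 : χ + ε • ∑ k : Fin ν, mulS (coord k) (mulS (coord k) χ) = φ := by
    conv_rhs => rw [← key φ]
    rw [hχ]
    congr 2
    refine Finset.sum_congr rfl fun k _ => ?_
    rw [mulS_comm (hcoord k) hr, mulS_comm (hcoord k) hr]
  conv_lhs => rw [← key (mulF a χ)]
  conv_rhs => rw [← h1]
  simp only [map_add, map_smul, map_sum, Finset.smul_sum]
  rw [add_assoc, ← Finset.sum_add_distrib]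
  congr 1
  refine Finset.sum_congr rfl fun k _ => ?_
  rw [mulF_mulS_coord ha, mulF_mulS_coord ha, map_sub, map_smul, map_sub, map_sub, map_smul,
    map_smul]
  module

end

section

variable {ν : ℕ}

/-! ### Essential self-adjointness of `A_u` -/

theorem tendsto_mulL2_apply {g : ℕ → X ν → ℂ} {g₀ : X ν → ℂ}
    (h : ∀ n, MemLp (g n) ∞ (volume : Measure (X ν))) (h₀ : MemLp g₀ ∞ (volume : Measure (X ν)))
    {C : ℝ} (hC : ∀ n x, ‖g n x‖ ≤ C) (hC₀ : ∀ x, ‖g₀ x‖ ≤ C)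
    (hlim : ∀ x, Tendsto (fun n => g n x) atTop (𝓝 (g₀ x))) {f : ℕ → L2 ν} {f₀ : L2 ν}
    (hf : Tendsto f atTop (𝓝 f₀)) :
    Tendsto (fun n => mulL2 (g n) (f n)) atTop (𝓝 (mulL2 g₀ f₀)) := by
  have h1 := tendsto_mulL2 h h₀ hC hC₀ hlim f₀
  have h2 : Tendsto (fun n => mulL2 (g n) (f n - f₀)) atTop (𝓝 0) := by
    have h3 : Tendsto (fun n => C * ‖f n - f₀‖) atTop (𝓝 0) := by
      simpa using (tendsto_iff_norm_sub_tendsto_zero.1 hf).const_mul C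
    exact squeeze_zero_norm (fun n => norm_mulL2_apply_le (h n) (hC n) _) h3
  simpa using h2.add h1

theorem tendsto_fmulL2_apply {g : ℕ → X ν → ℂ} {g₀ : X ν → ℂ}
    (h : ∀ n, MemLp (g n) ∞ (volume : Measure (X ν))) (h₀ : MemLp g₀ ∞ (volume : Measure (X ν)))
    {C : ℝ} (hC : ∀ n x, ‖g n x‖ ≤ C) (hC₀ : ∀ x, ‖g₀ x‖ ≤ C)
    (hlim : ∀ x, Tendsto (fun n => g n x) atTop (𝓝 (g₀ x))) {f : ℕ → L2 ν} {f₀ : L2 ν}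
    (hf : Tendsto f atTop (𝓝 f₀)) :
    Tendsto (fun n => fmulL2 (g n) (f n)) atTop (𝓝 (fmulL2 g₀ f₀)) := by
  simp_rw [fmulL2_apply]
  exact ((Lp.fourierTransformₗᵢ (X ν) ℂ).symm.continuous.tendsto _).comp
    (tendsto_mulL2_apply h h₀ hC hC₀ hlim
      (((Lp.fourierTransformₗᵢ (X ν) ℂ).continuous.tendsto _).comp hf))

theorem mulL2_zero (f : L2 ν) : mulL2 (fun _ => 0) f = 0 := by
  apply Lp.ext
  filter_upwards [coeFn_mulL2 (memLp_top_const (0 : ℂ)) f, Lp.coeFn_zero ℂ 2 volume] with x a b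
  rw [a, b]
  simp

theorem mulL2_one (f : L2 ν) : mulL2 (fun _ => 1) f = f := by
  apply Lp.ext
  filter_upwards [coeFn_mulL2 (memLp_top_const (1 : ℂ)) f] with x a
  rw [a, one_mul]

theorem fmulL2_zero (f : L2 ν) : fmulL2 (fun _ => 0) f = 0 := by
  rw [fmulL2_apply, mulL2_zero]
  exact (Lp.fourierTransformₗᵢ (X ν) ℂ).symm.map_zero

theorem fmulL2_one (f : L2 ν) : fmulL2 (fun _ => 1) f = f := by
  rw [fmulL2_apply, mulL2_one, FourierTransform.fourierInv_fourier_eq]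

/-- The mollifier `(1 + t² |x|²)⁻¹`. -/
def mollR (t : ℝ) (x : X ν) : ℝ := (1 + t ^ 2 * ‖x‖ ^ 2)⁻¹

/-- The mollifier `(1 + t² |x|²)⁻¹`, complex valued. -/
abbrev moll (t : ℝ) : X ν → ℂ := fun x => ((mollR t x : ℝ) : ℂ)

theorem mollR_pos (t : ℝ) (x : X ν) : 0 < mollR t x := by unfold mollR; positivity

theorem mollR_mul (t : ℝ) (x : X ν) : mollR t x * (1 + t ^ 2 * ‖x‖ ^ 2) = 1 :=
  inv_mul_cancel₀ (by positivity)

theorem mollR_le_one (t : ℝ) (x : X ν) : mollR t x ≤ 1 := by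
  unfold mollR
  exact inv_le_one_of_one_le₀ (by nlinarith [sq_nonneg t, sq_nonneg ‖x‖, mul_nonneg (sq_nonneg t) (sq_nonneg ‖x‖)])

theorem mul_mollR_le_one (t : ℝ) (x : X ν) {c : ℝ} (hc : c ≤ 1 + t ^ 2 * ‖x‖ ^ 2) :
    c * mollR t x ≤ 1 := by
  rw [← mollR_mul t x, mul_comm]
  exact mul_le_mul_of_nonneg_left hc (mollR_pos t x).le

theorem hasTemperateGrowth_moll (t : ℝ) : (moll t : X ν → ℂ).HasTemperateGrowth := by
  have h1 : (fun x : X ν => (1 + ‖x‖ ^ 2) ^ (-1 : ℝ)).HasTemperateGrowth :=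
    Function.hasTemperateGrowth_one_add_norm_sq_rpow (X ν) (-1)
  have h2 : (fun x : X ν => t • x).HasTemperateGrowth :=
    (t • ContinuousLinearMap.id ℝ (X ν)).hasTemperateGrowth
  have h3 := Function.HasTemperateGrowth.comp (g := Complex.ofReal)
    Function.Complex.hasTemperateGrowth_ofReal (h1.comp h2)
  convert h3 using 1
  ext x
  simp only [moll, Function.comp, mollR, norm_smul, mul_pow, Real.norm_eq_abs, sq_abs, Real.rpow_neg_one]

theorem norm_moll_le (t : ℝ) (x : X ν) : ‖moll t x‖ ≤ 1 := by
  rw [Complex.norm_real, Real.norm_of_nonneg (mollR_pos t x).le]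
  exact mollR_le_one t x

theorem memLp_top_of_temperate {g : X ν → ℂ} (hg : g.HasTemperateGrowth) {C : ℝ}
    (hC : ∀ x, ‖g x‖ ≤ C) : MemLp g ∞ (volume : Measure (X ν)) :=
  memLp_top_of_continuous hg.1.continuous hC

theorem memLp_moll (t : ℝ) : MemLp (moll t : X ν → ℂ) ∞ volume :=
  memLp_top_of_temperate (hasTemperateGrowth_moll t) (norm_moll_le t)

/-- `t x_k (1 + t² |x|²)⁻¹`. -/
abbrev mollA (t : ℝ) (k : Fin ν) : X ν → ℂ := fun x => (t : ℂ) * (coord k x * moll t x)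

/-- `t² x_j x_k (1 + t² |x|²)⁻¹`. -/
abbrev mollB (t : ℝ) (j k : Fin ν) : X ν → ℂ :=
  fun x => ((t ^ 2 : ℝ) : ℂ) * (coord j x * (coord k x * moll t x))

theorem hasTemperateGrowth_coord_mul {g : X ν → ℂ} (hg : g.HasTemperateGrowth) (k : Fin ν) :
    (fun x => coord k x * g x).HasTemperateGrowth :=
  (hasTemperateGrowth_coord k).mul hg

theorem hasTemperateGrowth_mollA (t : ℝ) (k : Fin ν) : (mollA t k).HasTemperateGrowth :=
  (Function.HasTemperateGrowth.const (t : ℂ)).mul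
    (hasTemperateGrowth_coord_mul (hasTemperateGrowth_moll t) k)

theorem hasTemperateGrowth_mollB (t : ℝ) (j k : Fin ν) : (mollB t j k).HasTemperateGrowth :=
  (Function.HasTemperateGrowth.const ((t ^ 2 : ℝ) : ℂ)).mul (hasTemperateGrowth_coord_mul
    (hasTemperateGrowth_coord_mul (hasTemperateGrowth_moll t) k) j)

theorem norm_coord_le (j : Fin ν) (x : X ν) : ‖coord j x‖ ≤ ‖x‖ := by
  rw [Complex.norm_real]; exact PiLp.norm_apply_le _ j

theorem norm_mollA_le (t : ℝ) (k : Fin ν) (x : X ν) : ‖mollA t k x‖ ≤ 1 := by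
  have h1 := norm_coord_le k x
  rw [norm_mul, norm_mul, Complex.norm_real, Complex.norm_real (mollR t x),
    Real.norm_of_nonneg (mollR_pos t x).le, ← mul_assoc]
  apply mul_mollR_le_one
  rw [Real.norm_eq_abs]
  have h2 : |t| * ‖coord k x‖ ≤ |t| * ‖x‖ := by gcongr
  nlinarith [sq_nonneg (|t| * ‖x‖ - 1), sq_abs t]

theorem norm_mollB_le (t : ℝ) (j k : Fin ν) (x : X ν) : ‖mollB t j k x‖ ≤ 1 := by
  rw [norm_mul, norm_mul, norm_mul, Complex.norm_real, Complex.norm_real (mollR t x),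
    Real.norm_of_nonneg (mollR_pos t x).le, ← mul_assoc, ← mul_assoc]
  apply mul_mollR_le_one
  rw [Real.norm_of_nonneg (sq_nonneg t)]
  calc t ^ 2 * ‖coord j x‖ * ‖coord k x‖ ≤ t ^ 2 * ‖x‖ * ‖x‖ := by
        gcongr <;> exact norm_coord_le _ x
    _ ≤ 1 + t ^ 2 * ‖x‖ ^ 2 := by nlinarith

theorem memLp_mollA (t : ℝ) (k : Fin ν) : MemLp (mollA t k) ∞ volume :=
  memLp_top_of_temperate (hasTemperateGrowth_mollA t k) (norm_mollA_le t k)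

theorem memLp_mollB (t : ℝ) (j k : Fin ν) : MemLp (mollB t j k) ∞ volume :=
  memLp_top_of_temperate (hasTemperateGrowth_mollB t j k) (norm_mollB_le t j k)

theorem continuous_mollR_left (x : X ν) : Continuous fun t : ℝ => mollR t x := by
  unfold mollR
  exact (by fun_prop : Continuous fun t : ℝ => 1 + t ^ 2 * ‖x‖ ^ 2).inv₀ fun t => by positivity

theorem tendsto_moll {t : ℕ → ℝ} (ht : Tendsto t atTop (𝓝 0)) (x : X ν) :
    Tendsto (fun n => moll (t n) x) atTop (𝓝 1) := by
  have h := (Complex.continuous_ofReal.comp (continuous_mollR_left x)).tendsto 0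
  have h2 := h.comp ht
  simpa [moll, mollR, Function.comp_def] using h2

theorem tendsto_mollA {t : ℕ → ℝ} (ht : Tendsto t atTop (𝓝 0)) (k : Fin ν) (x : X ν) :
    Tendsto (fun n => mollA (t n) k x) atTop (𝓝 0) := by
  have h1 : Tendsto (fun n => ((t n : ℝ) : ℂ)) atTop (𝓝 ((0 : ℝ) : ℂ)) :=
    (Complex.continuous_ofReal.tendsto 0).comp ht
  simpa using h1.mul ((tendsto_moll ht x).const_mul (coord k x))

theorem tendsto_mollB {t : ℕ → ℝ} (ht : Tendsto t atTop (𝓝 0)) (j k : Fin ν) (x : X ν) :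
    Tendsto (fun n => mollB (t n) j k x) atTop (𝓝 0) := by
  have h1 : Tendsto (fun n => ((t n ^ 2 : ℝ) : ℂ)) atTop (𝓝 ((0 : ℝ) : ℂ)) :=
    (Complex.continuous_ofReal.tendsto 0).comp (by simpa using ht.pow 2)
  simpa [mollB] using h1.mul (((tendsto_moll ht x).const_mul (coord k x)).const_mul (coord j x))

theorem pd_moll (t : ℝ) (k : Fin ν) (x : X ν) :
    pd k (moll t) x = -2 * (t : ℂ) * (mollA t k x * moll t x) := by
  have h1 : HasFDerivAt (fun y : X ν => 1 + t ^ 2 * ‖y‖ ^ 2)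
      (t ^ 2 • (2 • innerSL ℝ x)) x :=
    ((hasStrictFDerivAt_norm_sq x).hasFDerivAt.const_mul (t ^ 2)).const_add 1
  have h2 : HasFDerivAt (mollR t : X ν → ℝ)
      ((-((1 + t ^ 2 * ‖x‖ ^ 2) ^ 2)⁻¹) • (t ^ 2 • (2 • innerSL ℝ x))) x :=
    (hasDerivAt_inv (by positivity)).comp_hasFDerivAt x h1
  have h3 := (Complex.ofRealCLM.hasFDerivAt (x := mollR t x)).comp x h2
  have h4 : fderiv ℝ (moll t : X ν → ℂ) x = _ := h3.fderiv
  rw [pd, h4]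
  have h5 : inner ℝ x (stdVec k) = x k := inner_stdVec x k
  simp only [ContinuousLinearMap.comp_apply, smul_apply, innerSL_apply_apply, h5,
    Complex.ofRealCLM_apply, smul_eq_mul, nsmul_eq_mul, mollA, coord, moll, mollR]
  push_cast
  rw [← inv_pow]
  ring

/-- `∑ u_j ∂_j (1 + t² |ξ|²)⁻¹`. -/
abbrev mollE (u : X ν → X ν) (t : ℝ) (j : Fin ν) : X ν → ℂ := fun ξ => symb u j ξ * pd j (moll t) ξ

theorem hasTemperateGrowth_mollE {u : X ν → X ν} (h : IsField u) (t : ℝ) (j : Fin ν) :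
    (mollE u t j).HasTemperateGrowth :=
  (h.hasTemperateGrowth_symb j).mul (hasTemperateGrowth_pd (hasTemperateGrowth_moll t) j)

/-- The gradient of the mollifier carries a factor `t`, and `|t| (1 + |ξ|) (1 + t²|ξ|²)⁻¹ ≤ 2` for
`|t| ≤ 1`; this absorbs the linear growth of `u` uniformly in `t`. -/
theorem norm_mollE_le {u : X ν → X ν} (h : IsField u) :
    ∃ C : ℝ, ∀ t : ℝ, |t| ≤ 1 → ∀ j ξ, ‖mollE u t j ξ‖ ≤ C := by
  obtain ⟨C, hC0, hC⟩ := h.norm_symb_le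
  refine ⟨C * 4, fun t ht j ξ => ?_⟩
  have e : ‖mollE u t j ξ‖ = ‖symb u j ξ‖ * (2 * |t| * (‖mollA t j ξ‖ * mollR t ξ)) := by
    rw [norm_mul, pd_moll, norm_mul, norm_mul, norm_mul, norm_neg, Complex.norm_real t,
      Complex.norm_real (mollR t ξ), Real.norm_of_nonneg (mollR_pos t ξ).le, Real.norm_eq_abs,
      Complex.norm_two]
  rw [e]
  have h1 := norm_mollA_le t j ξ
  have h2 : (|t| * (1 + ‖ξ‖)) * mollR t ξ ≤ 2 := by
    have h3 : (|t| * (1 + ‖ξ‖) / 2) * mollR t ξ ≤ 1 := by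
      apply mul_mollR_le_one
      nlinarith [sq_nonneg (|t| * ‖ξ‖ - 1), sq_abs t]
    linarith
  have h4 := mollR_pos t ξ
  calc ‖symb u j ξ‖ * (2 * |t| * (‖mollA t j ξ‖ * mollR t ξ))
      ≤ (C * (1 + ‖ξ‖)) * (2 * |t| * (1 * mollR t ξ)) := by
        have := hC j ξ
        gcongr
    _ = C * (2 * ((|t| * (1 + ‖ξ‖)) * mollR t ξ)) := by ring
    _ ≤ C * 4 := by gcongr; linarith

theorem tendsto_mollE (u : X ν → X ν) {t : ℕ → ℝ} (ht : Tendsto t atTop (𝓝 0)) (j : Fin ν)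
    (x : X ν) : Tendsto (fun n => mollE u (t n) j x) atTop (𝓝 0) := by
  have h1 : Tendsto (fun n => ((t n : ℝ) : ℂ)) atTop (𝓝 ((0 : ℝ) : ℂ)) :=
    (Complex.continuous_ofReal.tendsto 0).comp ht
  have h2 := ((h1.const_mul (-2)).mul ((tendsto_mollA ht j x).mul (tendsto_moll ht x))).const_mul
    (symb u j x)
  simp_rw [mollE, pd_moll]
  simpa using h2

/-- The commutator of `A_u` with multiplication by the mollifier, on `L²`. -/
def commMoll (u : X ν → X ν) (t : ℝ) (f : L2 ν) : L2 ν :=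
  (cpi / 2) • ∑ j : Fin ν, ∑ k : Fin ν,
    (mulL2 (mollA t k) (fmulL2 (pd k (symb u j)) (mulL2 (mollA t j) f))
      + mulL2 (moll t) (fmulL2 (pd k (symb u j)) (mulL2 (mollB t k j) f))
      + (mulL2 (mollB t j k) (fmulL2 (pd k (symb u j)) (mulL2 (moll t) f))
      + mulL2 (mollA t j) (fmulL2 (pd k (symb u j)) (mulL2 (mollA t k) f))))

theorem continuous_commMoll (u : X ν → X ν) (t : ℝ) : Continuous (commMoll u t) := by
  unfold commMoll
  fun_prop

/-- Every summand contains a factor `mollA` or `mollB`, which is bounded by one and tends pointwise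
to zero, hence strongly; the remaining factors converge strongly. -/
theorem tendsto_commMoll (u : X ν → X ν) {t : ℕ → ℝ} (ht : Tendsto t atTop (𝓝 0))
    {f : ℕ → L2 ν} {f₀ : L2 ν} (hf : Tendsto f atTop (𝓝 f₀)) :
    Tendsto (fun n => commMoll u (t n) (f n)) atTop (𝓝 0) := by
  have hz : MemLp (fun _ : X ν => (0 : ℂ)) ∞ volume := memLp_top_const 0
  have ho : MemLp (fun _ : X ν => (1 : ℂ)) ∞ volume := memLp_top_const 1
  have hA : ∀ (k : Fin ν) {f : ℕ → L2 ν} {f₀ : L2 ν}, Tendsto f atTop (𝓝 f₀) →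
      Tendsto (fun n => mulL2 (mollA (t n) k) (f n)) atTop (𝓝 0) := by
    intro k f f₀ hf
    have := tendsto_mulL2_apply (fun n => memLp_mollA (t n) k) hz (fun n => norm_mollA_le (t n) k)
      (by simp) (tendsto_mollA ht k) hf
    rwa [mulL2_zero] at this
  have hB : ∀ (j k : Fin ν) {f : ℕ → L2 ν} {f₀ : L2 ν}, Tendsto f atTop (𝓝 f₀) →
      Tendsto (fun n => mulL2 (mollB (t n) j k) (f n)) atTop (𝓝 0) := by
    intro j k f f₀ hf
    have := tendsto_mulL2_apply (fun n => memLp_mollB (t n) j k) hz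
      (fun n => norm_mollB_le (t n) j k) (by simp) (tendsto_mollB ht j k) hf
    rwa [mulL2_zero] at this
  have hM : ∀ {f : ℕ → L2 ν} {f₀ : L2 ν}, Tendsto f atTop (𝓝 f₀) →
      Tendsto (fun n => mulL2 (moll (t n)) (f n)) atTop (𝓝 f₀) := by
    intro f f₀ hf
    have := tendsto_mulL2_apply (fun n => memLp_moll (t n)) ho (fun n => norm_moll_le (t n))
      (by simp) (tendsto_moll ht) hf
    rwa [mulL2_one] at this
  have hF : ∀ (m : X ν → ℂ) {f : ℕ → L2 ν} {f₀ : L2 ν}, Tendsto f atTop (𝓝 f₀) →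
      Tendsto (fun n => fmulL2 m (f n)) atTop (𝓝 (fmulL2 m f₀)) := fun m f f₀ hf =>
    ((fmulL2 m).continuous.tendsto _).comp hf
  unfold commMoll
  have key : Tendsto (fun n => (cpi / 2) • ∑ j : Fin ν, ∑ k : Fin ν,
    (mulL2 (mollA (t n) k) (fmulL2 (pd k (symb u j)) (mulL2 (mollA (t n) j) (f n)))
      + mulL2 (moll (t n)) (fmulL2 (pd k (symb u j)) (mulL2 (mollB (t n) k j) (f n)))
      + (mulL2 (mollB (t n) j k) (fmulL2 (pd k (symb u j)) (mulL2 (moll (t n)) (f n)))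
      + mulL2 (mollA (t n) j) (fmulL2 (pd k (symb u j)) (mulL2 (mollA (t n) k) (f n))))))
      atTop (𝓝 ((cpi / 2) • ∑ _j : Fin ν, ∑ _k : Fin ν, ((0 + 0) + (0 + 0)))) := by
    refine Tendsto.const_smul (tendsto_finsetSum _ fun j _ => tendsto_finsetSum _ fun k _ => ?_) _
    refine ((hA k (hF _ (hA j hf))).add ?_).add
      ((hB j k (hF _ (hM hf))).add (hA j (hF _ (hA k hf))))
    have := hM (hF (pd k (symb u j)) (hB k j hf))
    rwa [map_zero] at this
  simpa using key

/-- In the commutator of `x_j u_j(p)` with the mollifier, the factor `t²` of the resolvent identity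
is shared among the coordinates, so that only the bounded symbols `t x_k r`, `t² x_j x_k r` and `r`
remain, `r` being the mollifier. -/
theorem conjOp_mulS_moll {u : X ν → X ν} (h : IsField u) (t : ℝ) (φ : 𝓢(X ν, ℂ)) :
    embL2 (conjOp u (mulS (moll t) φ)) = embL2 (mulS (moll t) (conjOp u φ))
      + commMoll u t (embL2 φ) := by
  have hr := hasTemperateGrowth_moll (ν := ν) t
  have hcoord := fun k : Fin ν => hasTemperateGrowth_coord k
  have ha := fun j : Fin ν => h.hasTemperateGrowth_symb j
  obtain ⟨C, hC0, hC⟩ := h.norm_pd_symb_le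
  have hpd : ∀ j k, MemLp (pd k (symb u j)) ∞ volume := fun j k =>
    memLp_top_of_temperate (hasTemperateGrowth_pd (ha j) k) (hC j k)
  have hε : ∀ x : X ν, moll t x * (1 + ((t ^ 2 : ℝ) : ℂ) * ∑ k, coord k x * coord k x) = 1 := by
    intro x
    have h1 : (∑ k, coord k x * coord k x : ℂ) = ((‖x‖ ^ 2 : ℝ) : ℂ) := by
      rw [EuclideanSpace.real_norm_sq_eq]
      push_cast
      exact Finset.sum_congr rfl fun k _ => (sq _).symm
    rw [h1]
    exact_mod_cast mollR_mul t x
  have hA : ∀ (k : Fin ν) (ψ : 𝓢(X ν, ℂ)), mulS (mollA t k) ψ = (t : ℂ) • mulS (coord k) (mulS (moll t) ψ) := by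
    intro k ψ
    rw [mulS_mulS (hcoord k) hr]
    ext x
    rw [SchwartzMap.smulLeftCLM_apply_apply (hasTemperateGrowth_mollA t k), smul_apply,
      SchwartzMap.smulLeftCLM_apply_apply (hasTemperateGrowth_coord_mul hr k)]
    simp only [smul_eq_mul]; ring
  have hB : ∀ (j k : Fin ν) (ψ : 𝓢(X ν, ℂ)), mulS (mollB t j k) ψ
      = ((t ^ 2 : ℝ) : ℂ) • mulS (coord j) (mulS (coord k) (mulS (moll t) ψ)) := by
    intro j k ψ
    rw [mulS_mulS (hcoord k) hr, mulS_mulS (hcoord j) (hasTemperateGrowth_coord_mul hr k)]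
    ext x
    rw [SchwartzMap.smulLeftCLM_apply_apply (hasTemperateGrowth_mollB t j k), smul_apply,
      SchwartzMap.smulLeftCLM_apply_apply
        (hasTemperateGrowth_coord_mul (hasTemperateGrowth_coord_mul hr k) j)]
    simp only [smul_eq_mul]; ring
  have key : conjOp u (mulS (moll t) φ) = mulS (moll t) (conjOp u φ) +
      (cpi / 2) • ∑ j : Fin ν, ∑ k : Fin ν,
    (mulS (mollA t k) (mulF (pd k (symb u j)) (mulS (mollA t j) φ))
      + mulS (moll t) (mulF (pd k (symb u j)) (mulS (mollB t k j) φ))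
      + (mulS (mollB t j k) (mulF (pd k (symb u j)) (mulS (moll t) φ))
      + mulS (mollA t j) (mulF (pd k (symb u j)) (mulS (mollA t k) φ)))) := by
    rw [conjOp_eq, conjOp_eq, map_smul, map_sum, Finset.smul_sum, Finset.smul_sum, Finset.smul_sum,
      ← Finset.sum_add_distrib]
    refine Finset.sum_congr rfl fun j _ => ?_
    rw [mulS_comm (hcoord j) hr φ, mulF_mulS_resolvent (ha j) hr hε, map_add,
      mulF_mulS_resolvent (ha j) hr hε φ, map_add, mulS_comm (hcoord j) hr]
    simp only [hA, hB, map_smul, map_add, map_sum, Finset.smul_sum, smul_add, smul_smul,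
      Finset.sum_add_distrib]
    simp only [mulS_comm (hcoord _) hr]
    have e : ((t ^ 2 : ℝ) : ℂ) = t * t := by push_cast; ring
    simp only [e]
    ring_nf
    abel
  rw [key, embL2_add, embL2_smul, embL2_sum]
  congr 2
  refine Finset.sum_congr rfl fun j _ => ?_
  rw [embL2_sum]
  refine Finset.sum_congr rfl fun k _ => ?_
  rw [embL2_add, embL2_add, embL2_add]
  have hM := memLp_moll (ν := ν) t
  simp only [mulL2_embL2 (memLp_mollA t _) (hasTemperateGrowth_mollA t _),
    mulL2_embL2 (memLp_mollB t _ _) (hasTemperateGrowth_mollB t _ _), mulL2_embL2 hM hr,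
    fmulL2_embL2 (hpd j k) (hasTemperateGrowth_pd (ha j) k)]

end

/-! ### Double mollification and density of the ranges of `A_u + iλ` -/

section

variable {ν : ℕ}

/-- The mollifying operator `P R P`, with `P`, `R` the mollifier in momentum and position. -/
def mollOp (t : ℝ) (f : L2 ν) : L2 ν := fmulL2 (moll t) (mulL2 (moll t) (fmulL2 (moll t) f))

/-- The bounded extension of `A_u P R P`. -/
def conjMoll (u : X ν → X ν) (t : ℝ) (f : L2 ν) : L2 ν :=
  ∑ j : Fin ν,
    (fmulL2 (fun ξ => symb u j ξ * moll t ξ) (mulL2 (fun x => coord j x * moll t x)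
        (fmulL2 (moll t) f))
      + cpi • fmulL2 (mollE u t j) (mulL2 (moll t) (fmulL2 (moll t) f))
      + (cpi / 2) • fmulL2 (fun ξ => pd j (symb u j) ξ * moll t ξ)
        (mulL2 (moll t) (fmulL2 (moll t) f)))

/-- The commutator of `A_u` and `P R P`. -/
def commMollOp (u : X ν → X ν) (t : ℝ) (f : L2 ν) : L2 ν :=
  cpi • ∑ j : Fin ν, fmulL2 (mollE u t j) (mulL2 (moll t) (fmulL2 (moll t) f))
    + fmulL2 (moll t) (commMoll u t (fmulL2 (moll t) f))
    + cpi • ∑ j : Fin ν, fmulL2 (moll t) (mulL2 (moll t) (fmulL2 (mollE u t j) f))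

theorem continuous_mollOp (t : ℝ) : Continuous (mollOp t : L2 ν → L2 ν) := by
  unfold mollOp; fun_prop

theorem continuous_conjMoll (u : X ν → X ν) (t : ℝ) : Continuous (conjMoll u t) := by
  unfold conjMoll; fun_prop

theorem continuous_commMollOp (u : X ν → X ν) (t : ℝ) : Continuous (commMollOp u t) := by
  have := continuous_commMoll u t
  unfold commMollOp; fun_prop

/-- The mollifying operator on Schwartz functions. -/
abbrev mollS (t : ℝ) (φ : 𝓢(X ν, ℂ)) : 𝓢(X ν, ℂ) :=
  mulF (moll t) (mulS (moll t) (mulF (moll t) φ))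

theorem mollOp_embL2 (t : ℝ) (φ : 𝓢(X ν, ℂ)) : mollOp t (embL2 φ) = embL2 (mollS t φ) := by
  have h1 := memLp_moll (ν := ν) t
  have h2 := hasTemperateGrowth_moll (ν := ν) t
  rw [mollOp, fmulL2_embL2 h1 h2, mulL2_embL2 h1 h2, fmulL2_embL2 h1 h2]

theorem memLp_mollE {u : X ν → X ν} (h : IsField u) {t : ℝ} (ht : |t| ≤ 1) (j : Fin ν) :
    MemLp (mollE u t j) ∞ volume := by
  obtain ⟨C, hC⟩ := norm_mollE_le h
  exact memLp_top_of_temperate (hasTemperateGrowth_mollE h t j) (hC t ht j)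

theorem one_add_mul_mollR_le {t : ℝ} (ht : t ≠ 0) (x : X ν) :
    (1 + ‖x‖) * mollR t x ≤ 1 + |t|⁻¹ := by
  have ht' : 0 < |t| := abs_pos.2 ht
  have h1 : (|t| * ‖x‖) * mollR t x ≤ 1 := by
    apply mul_mollR_le_one
    nlinarith [sq_nonneg (|t| * ‖x‖ - 1), sq_abs t]
  have h2 := mollR_le_one t x
  have h3 : ‖x‖ * mollR t x ≤ |t|⁻¹ := by
    rw [← one_div, le_div_iff₀ ht']
    linarith
  linarith

/-- The outer momentum mollifier absorbs the growth of `u`, the position mollifier that of `x_j`.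
Moving `x_j` inside the outer multiplier costs the `mollE` term. The bounds blow up as `t → 0`, so
`t ≠ 0` is needed here. -/
theorem conjMoll_embL2 {u : X ν → X ν} (h : IsField u) {t : ℝ} (ht : |t| ≤ 1) (ht0 : t ≠ 0)
    (φ : 𝓢(X ν, ℂ)) : conjMoll u t (embL2 φ) = embL2 (conjOp u (mollS t φ)) := by
  have h1 := memLp_moll (ν := ν) t
  have h2 := hasTemperateGrowth_moll (ν := ν) t
  have ha := fun j : Fin ν => h.hasTemperateGrowth_symb j
  have hcoord := fun k : Fin ν => hasTemperateGrowth_coord k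
  obtain ⟨C, hC0, hC⟩ := h.norm_pd_symb_le
  obtain ⟨C', hC0', hC'⟩ := h.norm_symb_le
  have hE := fun j => memLp_mollE h ht j
  have hE' := fun j => hasTemperateGrowth_mollE h t j
  have hm1 : ∀ j, MemLp (fun ξ => symb u j ξ * moll t ξ) ∞ volume := fun j =>
    memLp_top_of_temperate ((ha j).mul h2) (C := C' * (1 + |t|⁻¹)) fun ξ => by
      rw [norm_mul, Complex.norm_real (mollR t ξ), Real.norm_of_nonneg (mollR_pos t ξ).le]
      calc ‖symb u j ξ‖ * mollR t ξ ≤ (C' * (1 + ‖ξ‖)) * mollR t ξ :=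
            mul_le_mul_of_nonneg_right (hC' j ξ) (mollR_pos t ξ).le
        _ = C' * ((1 + ‖ξ‖) * mollR t ξ) := by ring
        _ ≤ _ := mul_le_mul_of_nonneg_left (one_add_mul_mollR_le ht0 ξ) hC0'
  have hm2 : ∀ j : Fin ν, MemLp (fun x => coord j x * moll t x) ∞ volume := fun j =>
    memLp_top_of_temperate ((hcoord j).mul h2) (C := 1 + |t|⁻¹) fun x => by
      rw [norm_mul, Complex.norm_real (mollR t x), Real.norm_of_nonneg (mollR_pos t x).le]
      refine le_trans ?_ (one_add_mul_mollR_le ht0 x)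
      refine mul_le_mul_of_nonneg_right ?_ (mollR_pos t x).le
      linarith [norm_coord_le j x]
  have hm3 : ∀ j, MemLp (fun ξ => pd j (symb u j) ξ * moll t ξ) ∞ volume := fun j =>
    memLp_top_of_temperate ((hasTemperateGrowth_pd (ha j) j).mul h2) (C := C * 1) fun ξ => by
      rw [norm_mul]
      exact mul_le_mul (hC j j ξ) (norm_moll_le t ξ) (norm_nonneg _) hC0
  unfold conjMoll
  rw [conjOp_eq_left h, embL2_sum]
  refine Finset.sum_congr rfl fun j _ => ?_
  rw [fmulL2_embL2 h1 h2, mulL2_embL2 h1 h2, mulL2_embL2 (hm2 j) ((hcoord j).mul h2),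
    fmulL2_embL2 (hm1 j) ((ha j).mul h2), fmulL2_embL2 (hE j) (hE' j),
    fmulL2_embL2 (hm3 j) ((hasTemperateGrowth_pd (ha j) j).mul h2),
    ← embL2_smul, ← embL2_smul, ← embL2_add, ← embL2_add]
  congr 1
  rw [mulS_coord_mulF h2, map_add, map_smul, mulS_mulS (hcoord j) h2, mulF_mulF (ha j) h2,
    mulF_mulF (ha j) (hasTemperateGrowth_pd h2 j), mulF_mulF (hasTemperateGrowth_pd (ha j) j) h2]

/-- The Leibniz rule for the commutator of `A_u` with the triple product `P R P`: one term for each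
factor. -/
theorem conjOp_mollS {u : X ν → X ν} (h : IsField u) {t : ℝ} (ht : |t| ≤ 1)
    (φ : 𝓢(X ν, ℂ)) : embL2 (conjOp u (mollS t φ))
      = mollOp t (embL2 (conjOp u φ)) + commMollOp u t (embL2 φ) := by
  have h1 := memLp_moll (ν := ν) t
  have h2 := hasTemperateGrowth_moll (ν := ν) t
  have ha := fun j : Fin ν => h.hasTemperateGrowth_symb j
  have hE := fun j => memLp_mollE h ht j
  have hE' := fun j => hasTemperateGrowth_mollE h t j
  have hp := fun j => hasTemperateGrowth_pd h2 j
  rw [conjOp_mulF h h2, embL2_add, ← fmulL2_embL2 h1 h2, conjOp_mulS_moll h, conjOp_mulF h h2,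
    map_add]
  unfold commMollOp
  rw [fmulL2_embL2 h1 h2 φ, mulL2_embL2 h1 h2]
  have e1 : ∀ j, embL2 (mulF (symb u j) (mulF (pd j (moll t)) (mulS (moll t) (mulF (moll t) φ))))
      = fmulL2 (mollE u t j) (embL2 (mulS (moll t) (mulF (moll t) φ))) := by
    intro j
    rw [mulF_mulF (ha j) (hp j), ← fmulL2_embL2 (hE j) (hE' j)]
  have e2 : fmulL2 (moll t) (embL2 (mulS (moll t) (mulF (moll t) (conjOp u φ))))
      = mollOp t (embL2 (conjOp u φ)) := by
    rw [mollOp_embL2, fmulL2_embL2 h1 h2]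
  have e3 : ∀ j, fmulL2 (moll t) (embL2 (mulS (moll t) (mulF (symb u j) (mulF (pd j (moll t)) φ))))
      = fmulL2 (moll t) (mulL2 (moll t) (fmulL2 (mollE u t j) (embL2 φ))) := by
    intro j
    rw [mulF_mulF (ha j) (hp j), ← mulL2_embL2 h1 h2, ← fmulL2_embL2 (hE j) (hE' j)]
  rw [map_add, map_smul, map_sum]
  simp only [embL2_add, embL2_smul, embL2_sum, map_add, map_smul, map_sum, e1, e2, e3, map_sum]
  abel

theorem tendsto_moll_ops {t : ℕ → ℝ} (ht : Tendsto t atTop (𝓝 0)) {f : ℕ → L2 ν} {f₀ : L2 ν}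
    (hf : Tendsto f atTop (𝓝 f₀)) :
    Tendsto (fun n => mulL2 (moll (t n)) (f n)) atTop (𝓝 f₀) ∧
      Tendsto (fun n => fmulL2 (moll (t n)) (f n)) atTop (𝓝 f₀) := by
  have ho : MemLp (fun _ : X ν => (1 : ℂ)) ∞ volume := memLp_top_const 1
  constructor
  · have := tendsto_mulL2_apply (fun n => memLp_moll (t n)) ho (fun n => norm_moll_le (t n))
      (by simp) (tendsto_moll ht) hf
    rwa [mulL2_one] at this
  · have := tendsto_fmulL2_apply (fun n => memLp_moll (t n)) ho (fun n => norm_moll_le (t n))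
      (by simp) (tendsto_moll ht) hf
    rwa [fmulL2_one] at this

theorem tendsto_mollOp {t : ℕ → ℝ} (ht : Tendsto t atTop (𝓝 0)) (f : L2 ν) :
    Tendsto (fun n => mollOp (t n) f) atTop (𝓝 f) :=
  (tendsto_moll_ops ht (tendsto_moll_ops ht (tendsto_moll_ops ht tendsto_const_nhds).2).1).2

theorem tendsto_commMollOp {u : X ν → X ν} (h : IsField u) {t : ℕ → ℝ}
    (ht : Tendsto t atTop (𝓝 0)) (ht1 : ∀ n, |t n| ≤ 1) (f : L2 ν) :
    Tendsto (fun n => commMollOp u (t n) f) atTop (𝓝 0) := by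
  obtain ⟨C, hC⟩ := norm_mollE_le h
  have hz : MemLp (fun _ : X ν => (0 : ℂ)) ∞ volume := memLp_top_const 0
  have hC0 : ∀ j : Fin ν, 0 ≤ C := fun j => (norm_nonneg _).trans (hC (t 0) (ht1 0) j 0)
  have hE : ∀ (j : Fin ν) {f : ℕ → L2 ν} {f₀ : L2 ν}, Tendsto f atTop (𝓝 f₀) →
      Tendsto (fun n => fmulL2 (mollE u (t n) j) (f n)) atTop (𝓝 0) := by
    intro j f f₀ hf
    have := tendsto_fmulL2_apply (fun n => memLp_mollE h (ht1 n) j) hz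
      (fun n => hC (t n) (ht1 n) j) (fun _ => by simpa using hC0 j) (tendsto_mollE u ht j) hf
    rwa [fmulL2_zero] at this
  have hP : Tendsto (fun n => fmulL2 (moll (t n)) f) atTop (𝓝 f) :=
    (tendsto_moll_ops ht tendsto_const_nhds).2
  have key := (((tendsto_finsetSum Finset.univ fun j _ =>
      hE j (tendsto_moll_ops ht hP).1).const_smul cpi).add
    (tendsto_moll_ops ht (tendsto_commMoll u ht hP)).2).add
    ((tendsto_finsetSum Finset.univ fun j _ => (tendsto_moll_ops ht
      (tendsto_moll_ops ht (hE j (tendsto_const_nhds (x := f)))).1).2).const_smul cpi)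
  simpa [commMollOp] using key

theorem inner_mollOp_left (t : ℝ) (f g : L2 ν) :
    inner ℂ (mollOp t f) g = inner ℂ f (mollOp t g) := by
  have h1 := memLp_moll (ν := ν) t
  unfold mollOp
  rw [inner_fmulL2_left_of_real (g := mollR t) h1, inner_mulL2_left_of_real (g := mollR t) h1,
    inner_fmulL2_left_of_real (g := mollR t) h1]

/-- The ranges of `A_u ± iλ` on Schwartz functions are dense. -/
theorem eq_zero_of_orthogonal_range {u : X ν → X ν} (h : IsField u) {l : ℝ} (hl : l ≠ 0)
    (ψ : L2 ν) (hψ : ∀ φ : 𝓢(X ν, ℂ),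
      inner ℂ (embL2 (conjOp u φ) + (l * Complex.I : ℂ) • embL2 φ) ψ = 0) : ψ = 0 := by
  -- Formally `A_u ψ = iλ ψ` in the weak sense, and symmetry of `A_u` would force `ψ = 0`. Since `ψ`
  -- need not lie in the domain, the identity is tested on the mollified `ψ`; the failure of
  -- symmetry is then exactly the commutator with the mollifier, which disappears as `t → 0`.
  have main : ∀ t : ℝ, |t| ≤ 1 → t ≠ 0 →
      2 * (l * Complex.I) * inner ℂ (mollOp t ψ) ψ = -inner ℂ ψ (commMollOp u t ψ) := by
    intro t ht ht0
    -- The hypothesis for mollified Schwartz functions, extended by continuity because `A_u P R P`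
    -- is bounded.
    have e1 : inner ℂ (conjMoll u t ψ) ψ = (l * Complex.I) * inner ℂ (mollOp t ψ) ψ := by
      refine denseRange_embL2.induction_on
        (p := fun f => inner ℂ (conjMoll u t f) ψ = (l * Complex.I) * inner ℂ (mollOp t f) ψ)
        ψ ?_ ?_
      · refine isClosed_eq ?_ ?_
        · exact (continuous_conjMoll u t).inner continuous_const
        · exact continuous_const.mul ((continuous_mollOp t).inner continuous_const)
      · intro φ
        have := hψ (mollS t φ)
        rw [inner_add_left, inner_smul_left] at this
        rw [conjMoll_embL2 h ht ht0, mollOp_embL2]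
        simp only [map_mul, Complex.conj_ofReal, Complex.conj_I] at this
        linear_combination this
    -- The adjoint of `A M` is `M A = A M - [A, M]`, where `M = P R P`.
    have e2 : ∀ f g : L2 ν, inner ℂ (conjMoll u t f) g
        = inner ℂ f (conjMoll u t g) - inner ℂ f (commMollOp u t g) := by
      intro f g
      refine denseRange_embL2.induction_on₂ (p := fun f g => inner ℂ (conjMoll u t f) g
        = inner ℂ f (conjMoll u t g) - inner ℂ f (commMollOp u t g)) ?_ ?_ f g
      · refine isClosed_eq ?_ ?_
        · exact ((continuous_conjMoll u t).comp continuous_fst).inner continuous_snd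
        · exact (continuous_fst.inner ((continuous_conjMoll u t).comp continuous_snd)).sub
            (continuous_fst.inner ((continuous_commMollOp u t).comp continuous_snd))
      · intro φ χ
        rw [conjMoll_embL2 h ht ht0, conjMoll_embL2 h ht ht0, inner_conjOp_left h,
          ← mollOp_embL2, inner_mollOp_left, conjOp_mollS h ht, inner_add_right]
        ring
    have e3 := e2 ψ ψ
    have e4 : inner ℂ ψ (conjMoll u t ψ) = -(l * Complex.I) * inner ℂ (mollOp t ψ) ψ := by
      rw [← inner_conj_symm, e1, map_mul, map_mul, Complex.conj_I, Complex.conj_ofReal,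
        inner_conj_symm, ← inner_mollOp_left]
      ring
    rw [e1, e4] at e3
    linear_combination e3
  set t : ℕ → ℝ := fun n => 1 / ((n : ℝ) + 1) with ht
  have ht0 : Tendsto t atTop (𝓝 0) := tendsto_one_div_add_atTop_nhds_zero_nat
  have ht1 : ∀ n, |t n| ≤ 1 := fun n => by
    rw [ht, abs_of_nonneg (by positivity)]
    exact (div_le_one (by positivity)).2 (by linarith [(Nat.cast_nonneg n : (0 : ℝ) ≤ n)])
  have ht2 : ∀ n, t n ≠ 0 := fun n => by simp only [ht]; positivity
  have l1 : Tendsto (fun n => 2 * (l * Complex.I) * inner ℂ (mollOp (t n) ψ) ψ) atTop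
      (𝓝 (2 * (l * Complex.I) * inner ℂ ψ ψ)) :=
    ((tendsto_mollOp ht0 ψ).inner tendsto_const_nhds).const_mul _
  have l2 : Tendsto (fun n => -inner ℂ ψ (commMollOp u (t n) ψ)) atTop (𝓝 (-inner ℂ ψ 0)) :=
    (tendsto_const_nhds.inner (tendsto_commMollOp h ht0 ht1 ψ)).neg
  have l3 := tendsto_nhds_unique (l1.congr fun n => main (t n) (ht1 n) (ht2 n)) l2
  rw [inner_zero_right, neg_zero] at l3
  have : (2 * (l * Complex.I) : ℂ) ≠ 0 := by simp [hl]
  exact inner_self_eq_zero.1 ((mul_eq_zero.1 l3).resolve_left this)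

end

section

/-! ### Stone's theorem: the unitary group of a self-adjoint graph -/

variable {H : Type*} [NormedAddCommGroup H] [InnerProductSpace ℂ H] [CompleteSpace H]

/-- A closed, symmetric, densely defined graph such that all `A + iλ`, `λ ≠ 0` real, have dense
range; that is, the graph of a self-adjoint operator. -/
structure IsSelfAdjointGraph (Γ : Submodule ℂ (H × H)) : Prop where
  closed : IsClosed (Γ : Set (H × H))
  symm : ∀ p ∈ Γ, ∀ q ∈ Γ, inner ℂ p.2 q.1 = inner ℂ p.1 q.2
  dense : Dense (Prod.fst '' (Γ : Set (H × H)))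
  range : ∀ l : ℝ, l ≠ 0 → ∀ ψ : H,
    (∀ p ∈ Γ, inner ℂ (p.2 + (l * Complex.I : ℂ) • p.1) ψ = 0) → ψ = 0

namespace IsSelfAdjointGraph

variable {Γ : Submodule ℂ (H × H)}

/-- The cross term is the real part of `iλ` times a number that symmetry makes real. -/
theorem norm_sq (h : IsSelfAdjointGraph Γ) (l : ℝ) {p : H × H} (hp : p ∈ Γ) :
    ‖p.2 + (l * Complex.I : ℂ) • p.1‖ ^ 2 = ‖p.2‖ ^ 2 + l ^ 2 * ‖p.1‖ ^ 2 := by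
  have h1 : (inner ℂ p.2 p.1 : ℂ).im = 0 := by
    have h2 := h.symm p hp p hp
    rw [← inner_conj_symm p.1 p.2] at h2
    exact Complex.conj_eq_iff_im.1 h2.symm
  rw [@norm_add_sq ℂ, inner_smul_right, norm_smul, mul_pow]
  simp [h1]

theorem norm_fst_le (h : IsSelfAdjointGraph Γ) (l : ℝ) {p : H × H} (hp : p ∈ Γ) :
    |l| * ‖p.1‖ ≤ ‖p.2 + (l * Complex.I : ℂ) • p.1‖ := by
  apply le_of_sq_le_sq _ (norm_nonneg _)
  rw [h.norm_sq l hp, mul_pow, sq_abs]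
  nlinarith [sq_nonneg ‖p.2‖]

theorem norm_snd_le (h : IsSelfAdjointGraph Γ) (l : ℝ) {p : H × H} (hp : p ∈ Γ) :
    ‖p.2‖ ≤ ‖p.2 + (l * Complex.I : ℂ) • p.1‖ := by
  apply le_of_sq_le_sq _ (norm_nonneg _)
  rw [h.norm_sq l hp]
  nlinarith [sq_nonneg ‖p.1‖, mul_nonneg (sq_nonneg l) (sq_nonneg ‖p.1‖)]

/-- On the closed graph, `A + iλ` is bounded below for the graph norm, hence has closed range; the
range is also dense by assumption. -/
theorem exists_resolvent (h : IsSelfAdjointGraph Γ) {l : ℝ} (hl : l ≠ 0) (g : H) :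
    ∃ f : H, (f, g - (l * Complex.I : ℂ) • f) ∈ Γ := by
  let T : Γ →L[ℂ] H := ((ContinuousLinearMap.snd ℂ H H) +
    (l * Complex.I : ℂ) • (ContinuousLinearMap.fst ℂ H H)).comp Γ.subtypeL
  have hT : ∀ p : Γ, T p = p.1.2 + (l * Complex.I : ℂ) • p.1.1 := fun p => rfl
  have : CompleteSpace Γ := h.closed.completeSpace_coe
  have hlip : AntilipschitzWith (1 + ‖l‖₊⁻¹) T := by
    refine AddMonoidHomClass.antilipschitz_of_bound T fun p => ?_
    have h1 := h.norm_fst_le l p.2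
    have h2 := h.norm_snd_le l p.2
    have h3 : 0 < |l| := abs_pos.2 hl
    rw [← hT] at h1 h2
    have h4 : ‖p.1.1‖ ≤ |l|⁻¹ * ‖T p‖ := by
      rw [inv_mul_eq_div, le_div_iff₀ h3]; linarith
    have h5 : ‖p‖ = max ‖p.1.1‖ ‖p.1.2‖ := rfl
    rw [h5]
    simp only [NNReal.coe_add, NNReal.coe_one, NNReal.coe_inv, coe_nnnorm, Real.norm_eq_abs]
    have h6 : 0 ≤ |l|⁻¹ * ‖T p‖ := by positivity
    have h7 := norm_nonneg (T p)
    refine max_le ?_ ?_ <;> nlinarith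
  have hclosed : IsClosed (T.range : Set H) := by
    rw [LinearMap.coe_range]
    exact hlip.isClosed_range T.uniformContinuous
  have htop : T.range = ⊤ := by
    have h8 : (T.range).topologicalClosure = ⊤ := by
      rw [Submodule.topologicalClosure_eq_top_iff, Submodule.eq_bot_iff]
      intro ψ hψ
      refine h.range l hl ψ fun p hp => ?_
      exact (Submodule.mem_orthogonal _ _).1 hψ _ ⟨⟨p, hp⟩, rfl⟩
    rwa [IsClosed.submodule_topologicalClosure_eq hclosed] at h8
  obtain ⟨p, hp⟩ : g ∈ T.range := htop ▸ Submodule.mem_top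
  refine ⟨p.1.1, ?_⟩
  have : g - (l * Complex.I : ℂ) • p.1.1 = p.1.2 := by
    rw [← hp]
    change p.1.2 + (l * Complex.I : ℂ) • p.1.1 - _ = _
    rw [add_sub_cancel_right]
  rw [this]
  exact p.2

theorem eq_of_mem (h : IsSelfAdjointGraph Γ) {l : ℝ} (hl : l ≠ 0) {f g k : H}
    (hf : (f, g - (l * Complex.I : ℂ) • f) ∈ Γ) (hk : (k, g - (l * Complex.I : ℂ) • k) ∈ Γ) :
    f = k := by
  have h1 := h.norm_fst_le l (Γ.sub_mem hf hk)
  have h2 : (g - (l * Complex.I : ℂ) • f - (g - (l * Complex.I : ℂ) • k))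
      + (l * Complex.I : ℂ) • (f - k) = 0 := by module
  simp only [Prod.mk_sub_mk] at h1
  rw [h2, norm_zero] at h1
  have h3 : 0 < |l| := abs_pos.2 hl
  have h4 : ‖f - k‖ ≤ 0 := by
    by_contra hc
    push Not at hc
    nlinarith
  exact sub_eq_zero.1 (norm_le_zero_iff.1 h4)

open Classical in
/-- The resolvent `(A + iλ)⁻¹`. -/
def res (h : IsSelfAdjointGraph Γ) (l : ℝ) : H →L[ℂ] H :=
  if hl : l ≠ 0 then
    LinearMap.mkContinuous
      { toFun := fun g => (h.exists_resolvent hl g).choose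
        map_add' := fun g g' => h.eq_of_mem hl (h.exists_resolvent hl (g + g')).choose_spec <| by
          have := Γ.add_mem (h.exists_resolvent hl g).choose_spec
            (h.exists_resolvent hl g').choose_spec
          convert this using 1
          ext
          · rfl
          · simp only [Prod.mk_add_mk]; module
        map_smul' := fun c g => h.eq_of_mem hl (h.exists_resolvent hl (c • g)).choose_spec <| by
          have := Γ.smul_mem c (h.exists_resolvent hl g).choose_spec
          convert this using 1
          ext
          · rfl
          · simp only [Prod.smul_mk, RingHom.id_apply]; module } |l|⁻¹ (fun g => by
        have h1 := h.norm_fst_le l (h.exists_resolvent hl g).choose_spec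
        simp only [sub_add_cancel] at h1
        have h3 : 0 < |l| := abs_pos.2 hl
        rw [inv_mul_eq_div, le_div_iff₀ h3, mul_comm]
        exact h1)
  else 0

theorem res_mem (h : IsSelfAdjointGraph Γ) {l : ℝ} (hl : l ≠ 0) (g : H) :
    (h.res l g, g - (l * Complex.I : ℂ) • h.res l g) ∈ Γ := by
  rw [res, dif_pos hl]
  exact (h.exists_resolvent hl g).choose_spec

theorem eq_res (h : IsSelfAdjointGraph Γ) {l : ℝ} (hl : l ≠ 0) {f k : H} (hf : (f, k) ∈ Γ) :
    h.res l (k + (l * Complex.I : ℂ) • f) = f := by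
  refine h.eq_of_mem hl (h.res_mem hl _) ?_
  rwa [add_sub_cancel_right]

theorem norm_res_le (h : IsSelfAdjointGraph Γ) {l : ℝ} (hl : l ≠ 0) (g : H) :
    |l| * ‖h.res l g‖ ≤ ‖g‖ := by
  have h1 := h.norm_fst_le l (h.res_mem hl g)
  simpa using h1

theorem inner_res_left (h : IsSelfAdjointGraph Γ) {l : ℝ} (hl : l ≠ 0) (f g : H) :
    inner ℂ (h.res l f) g = inner ℂ f (h.res (-l) g) := by
  have h1 := h.symm _ (h.res_mem hl f) _ (h.res_mem (neg_ne_zero.2 hl) g)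
  simp only [inner_sub_left, inner_sub_right, inner_smul_left, inner_smul_right, map_mul,
    Complex.conj_ofReal, Complex.conj_I, Complex.ofReal_neg] at h1
  linear_combination -h1

theorem res_sub (h : IsSelfAdjointGraph Γ) {l m : ℝ} (hl : l ≠ 0) (hm : m ≠ 0) (g : H) :
    h.res m g = h.res l g + ((l - m) * Complex.I : ℂ) • h.res l (h.res m g) := by
  have h1 := h.eq_res hl (h.res_mem hm g)
  rw [← h1]
  conv_lhs => rw [h1]
  rw [← map_smul, ← map_add]
  conv_lhs => rw [← h1]
  congr 1
  rw [h1]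
  module

theorem res_comm (h : IsSelfAdjointGraph Γ) {l m : ℝ} (hl : l ≠ 0) (hm : m ≠ 0) (g : H) :
    h.res l (h.res m g) = h.res m (h.res l g) := by
  rcases eq_or_ne l m with rfl | hlm
  · rfl
  have h1 := h.res_sub hl hm g
  have h2 := h.res_sub hm hl g
  have h3 : ((l - m) * Complex.I : ℂ) ≠ 0 :=
    mul_ne_zero (sub_ne_zero.2 (by exact_mod_cast hlm)) Complex.I_ne_zero
  have h4 : ((l - m) * Complex.I : ℂ) • h.res l (h.res m g)
      = ((l - m) * Complex.I : ℂ) • h.res m (h.res l g) := by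
    have e1 : ((l - m) * Complex.I : ℂ) • h.res l (h.res m g) = h.res m g - h.res l g :=
      (sub_eq_of_eq_add' h1).symm
    have e2 : ((m - l) * Complex.I : ℂ) • h.res m (h.res l g) = h.res l g - h.res m g :=
      (sub_eq_of_eq_add' h2).symm
    have e3 : ((l - m) * Complex.I : ℂ) • h.res m (h.res l g)
        = -(((m - l) * Complex.I : ℂ) • h.res m (h.res l g)) := by module
    rw [e1, e3, e2]
    abel
  exact smul_right_injective H h3 h4

/-- The bounded symmetric approximations of the operator. -/
def approx (h : IsSelfAdjointGraph Γ) (n : ℕ) : H →L[ℂ] H :=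
  (((n : ℝ) + 1) ^ 2 / 2 : ℂ) • (h.res ((n : ℝ) + 1) + h.res (-((n : ℝ) + 1)))

theorem approx_comm (h : IsSelfAdjointGraph Γ) (m n : ℕ) :
    Commute (h.approx m) (h.approx n) := by
  have hp : ∀ k : ℕ, ((k : ℝ) + 1) ≠ 0 := fun k => by positivity
  have hn : ∀ k : ℕ, -((k : ℝ) + 1) ≠ 0 := fun k => neg_ne_zero.2 (hp k)
  have hc : ∀ {a b : ℝ}, a ≠ 0 → b ≠ 0 → Commute (h.res a) (h.res b) := fun ha hb =>
    ContinuousLinearMap.ext fun g => h.res_comm ha hb g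
  unfold approx
  refine Commute.smul_left (Commute.smul_right ?_ _) _
  exact ((hc (hp m) (hp n)).add_right (hc (hp m) (hn n))).add_left
    ((hc (hn m) (hp n)).add_right (hc (hn m) (hn n)))

theorem isSelfAdjoint_approx (h : IsSelfAdjointGraph Γ) (n : ℕ) : IsSelfAdjoint (h.approx n) := by
  have hp : ((n : ℝ) + 1) ≠ 0 := by positivity
  rw [ContinuousLinearMap.isSelfAdjoint_iff_isSymmetric]
  intro f g
  simp only [approx, ContinuousLinearMap.coe_coe, smul_apply, add_apply, inner_smul_left,
    inner_smul_right, inner_add_left, inner_add_right, h.inner_res_left hp,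
    h.inner_res_left (neg_ne_zero.2 hp), neg_neg]
  have : starRingEnd ℂ (((n : ℝ) + 1) ^ 2 / 2 : ℂ) = (((n : ℝ) + 1) ^ 2 / 2 : ℂ) := by
    rw [show (((n : ℝ) + 1) ^ 2 / 2 : ℂ) = ((((n : ℝ) + 1) ^ 2 / 2 : ℝ) : ℂ) by push_cast; rfl,
      Complex.conj_ofReal]
  rw [this]
  ring

/-- These operators are contractions, so it suffices to argue on the domain. There `iλ (A + iλ)⁻¹ f
= f - (A + iλ)⁻¹ A f`, and the last term is at most `‖A f‖ / |λ|`. -/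
theorem tendsto_smul_res (h : IsSelfAdjointGraph Γ) {l : ℕ → ℝ}
    (hl : Tendsto (fun n => |l n|) atTop atTop) (hl0 : ∀ n, l n ≠ 0) (g : H) :
    Tendsto (fun n => (l n * Complex.I : ℂ) • h.res (l n) g) atTop (𝓝 g) := by
  have hbound : ∀ n g, ‖(l n * Complex.I : ℂ) • h.res (l n) g‖ ≤ ‖g‖ := fun n g => by
    rw [norm_smul]
    simpa using h.norm_res_le (hl0 n) g
  rw [Metric.tendsto_atTop]
  intro ε hε
  obtain ⟨_, hf, ⟨⟨f, k⟩, hfk, rfl⟩⟩ := Metric.dense_iff.1 h.dense g (ε / 3) (by positivity)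
  obtain ⟨N, hN⟩ := (tendsto_atTop.1 hl (‖k‖ / (ε / 3) + 1)).exists_forall_of_atTop
  refine ⟨N, fun n hn => ?_⟩
  have h1 : (l n * Complex.I : ℂ) • h.res (l n) f = f - h.res (l n) k := by
    have h2 := h.eq_res (hl0 n) hfk
    rw [map_add, map_smul] at h2
    exact eq_sub_of_add_eq' h2
  have h2 : ‖h.res (l n) k‖ < ε / 3 := by
    have h3 := h.norm_res_le (hl0 n) k
    have h4 := hN n hn
    have h5 : ‖k‖ < |l n| * (ε / 3) := by
      have : ‖k‖ / (ε / 3) < |l n| := by linarith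
      rwa [div_lt_iff₀ (by positivity)] at this
    have h6 : 0 < |l n| := abs_pos.2 (hl0 n)
    by_contra hc
    push Not at hc
    nlinarith
  rw [Metric.mem_ball, dist_eq_norm] at hf
  simp only at hf
  rw [dist_eq_norm]
  have e : (l n * Complex.I : ℂ) • h.res (l n) g - g
      = -((l n * Complex.I : ℂ) • h.res (l n) (f - g)) - h.res (l n) k + (f - g) := by
    rw [map_sub, smul_sub, h1]; abel
  rw [e]
  calc _ ≤ ‖(l n * Complex.I : ℂ) • h.res (l n) (f - g)‖ + ‖h.res (l n) k‖ + ‖f - g‖ := by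
        refine (norm_add_le _ _).trans ?_
        gcongr
        refine (norm_sub_le _ _).trans ?_
        rw [norm_neg]
    _ < ε := by linarith [hbound n (f - g)]

/-- With `λ = n + 1`, the approximation is `λ² A (A² + λ²)⁻¹`. On the domain it equals the mean of
`±iλ (A ± iλ)⁻¹ A f`, and both terms tend to `A f`. -/
theorem tendsto_approx (h : IsSelfAdjointGraph Γ) {f k : H} (hfk : (f, k) ∈ Γ) :
    Tendsto (fun n => h.approx n f) atTop (𝓝 k) := by
  have hp : ∀ n : ℕ, ((n : ℝ) + 1) ≠ 0 := fun n => by positivity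
  have hn : ∀ n : ℕ, -((n : ℝ) + 1) ≠ 0 := fun n => neg_ne_zero.2 (hp n)
  have ht : Tendsto (fun n : ℕ => |(n : ℝ) + 1|) atTop atTop :=
    tendsto_abs_atTop_atTop.comp (tendsto_atTop_add_const_right _ _ tendsto_natCast_atTop_atTop)
  have h1 := h.tendsto_smul_res ht hp k
  have h2 := h.tendsto_smul_res (l := fun n : ℕ => -((n : ℝ) + 1)) (by simpa only [abs_neg] using ht) hn k
  have h3 := (h1.add h2).const_smul (1 / 2 : ℂ)
  have h4 : (1 / 2 : ℂ) • (k + k) = k := by module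
  rw [h4] at h3
  refine h3.congr fun n => ?_
  have e1 := h.eq_res (hp n) hfk
  have e2 := h.eq_res (hn n) hfk
  rw [map_add, map_smul] at e1 e2
  have e3 : (((n : ℝ) + 1 : ℝ) * Complex.I : ℂ) ≠ 0 :=
    mul_ne_zero (by exact_mod_cast hp n) Complex.I_ne_zero
  have e4 : h.res ((n : ℝ) + 1) k = f - (((n : ℝ) + 1 : ℝ) * Complex.I : ℂ) • h.res ((n : ℝ) + 1) f :=
    eq_sub_of_add_eq e1
  have e5 : h.res (-((n : ℝ) + 1)) k
      = f - ((-((n : ℝ) + 1) : ℝ) * Complex.I : ℂ) • h.res (-((n : ℝ) + 1)) f :=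
    eq_sub_of_add_eq e2
  rw [e4, e5]
  simp only [approx, smul_apply, add_apply, smul_sub, smul_add, smul_smul]
  push_cast
  have hI := Complex.I_mul_I
  match_scalars
  · ring
  · linear_combination (-(1 / 2 : ℂ) * ((n : ℂ) + 1) ^ 2) * hI
  · linear_combination (-(1 / 2 : ℂ) * ((n : ℂ) + 1) ^ 2) * hI

end IsSelfAdjointGraph

/-! Exponentials of bounded self-adjoint operators -/

/-- The unitary group of a bounded operator. -/
def expI (B : H →L[ℂ] H) (t : ℝ) : H →L[ℂ] H := NormedSpace.exp (t • (Complex.I • B))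

theorem expI_zero (B : H →L[ℂ] H) : expI B 0 = 1 := by simp [expI, NormedSpace.exp_zero]

theorem expI_add (B : H →L[ℂ] H) (s t : ℝ) : expI B (s + t) = expI B s * expI B t := by
  let _ : NormedAlgebra ℚ (H →L[ℂ] H) := .restrictScalars ℚ ℂ _
  rw [expI, add_smul]
  exact NormedSpace.exp_add_of_commute (((Commute.refl _).smul_left _).smul_right _)

theorem hasDerivAt_expI (B : H →L[ℂ] H) (t : ℝ) (f : H) :
    HasDerivAt (fun s => expI B s f) (expI B t (Complex.I • B f)) t := by
  have h := hasDerivAt_exp_smul_const (𝕂 := ℝ) (Complex.I • B) t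
  exact ((ContinuousLinearMap.apply ℂ H f).restrictScalars ℝ).hasFDerivAt.comp_hasDerivAt t h

theorem continuous_expI (B : H →L[ℂ] H) (f : H) : Continuous fun t => expI B t f :=
  continuous_iff_continuousAt.2 fun t => (hasDerivAt_expI B t f).continuousAt

theorem norm_expI {B : H →L[ℂ] H} (hB : IsSelfAdjoint B) (t : ℝ) (f : H) : ‖expI B t f‖ = ‖f‖ := by
  refine ContinuousLinearMap.norm_map_of_mem_unitary ?_ f
  let _ : NormedAlgebra ℚ (H →L[ℂ] H) := .restrictScalars ℚ ℂ _
  refine NormedSpace.exp_mem_unitary_of_mem_skewAdjoint ?_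
  rw [skewAdjoint.mem_iff]
  simp [star_smul, hB.star_eq]

theorem norm_expI_sub_le {B : H →L[ℂ] H} (hB : IsSelfAdjoint B) (t : ℝ) (f : H) :
    ‖expI B t f - f‖ ≤ |t| * ‖B f‖ := by
  have h := Convex.norm_image_sub_le_of_norm_hasDerivWithin_le (s := Set.univ)
    (f := fun s => expI B s f) (C := ‖B f‖) (x := (0 : ℝ)) (y := t)
    (fun x _ => (hasDerivAt_expI B x f).hasDerivWithinAt)
    (fun x _ => by rw [norm_expI hB, norm_smul]; simp) convex_univ (Set.mem_univ _) (Set.mem_univ _)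
  rw [expI_zero] at h
  simpa [mul_comm] using h

/-- As `B` and `C` commute, `e^{itB} = e^{itC} e^{it(B - C)}`, and the unitary `e^{itC}` drops out
of the norm. -/
theorem norm_expI_sub_expI_le {B C : H →L[ℂ] H} (hB : IsSelfAdjoint B) (hC : IsSelfAdjoint C)
    (hBC : Commute B C) (t : ℝ) (f : H) : ‖expI B t f - expI C t f‖ ≤ |t| * ‖B f - C f‖ := by
  have h1 : expI B t = expI C t * expI (B - C) t := by
    let _ : NormedAlgebra ℚ (H →L[ℂ] H) := .restrictScalars ℚ ℂ _
    unfold expI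
    rw [← NormedSpace.exp_add_of_commute]
    · congr 1
      rw [← smul_add, ← smul_add]
      congr 2
      abel
    · have : Commute C (B - C) := hBC.symm.sub_right (Commute.refl C)
      exact (((this.smul_right _).smul_left _).smul_right _).smul_left _
  have h2 : expI B t f - expI C t f = expI C t (expI (B - C) t f - f) := by
    rw [h1, map_sub]; rfl
  rw [h2, norm_expI hC]
  exact norm_expI_sub_le (hB.sub hC) t f

end

/-! ### The unitary group as a strong limit, and its generator -/

section

variable {H : Type*} [NormedAddCommGroup H] [InnerProductSpace ℂ H] [CompleteSpace H]

namespace IsSelfAdjointGraph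

variable {Γ : Submodule ℂ (H × H)}

theorem cauchySeq_expI (h : IsSelfAdjointGraph Γ) (t : ℝ) (g : H) :
    CauchySeq fun n => expI (h.approx n) t g := by
  rw [Metric.cauchySeq_iff']
  intro ε hε
  obtain ⟨_, hf, ⟨⟨f, k⟩, hfk, rfl⟩⟩ := Metric.dense_iff.1 h.dense g (ε / 3) (by positivity)
  have h1 := (h.tendsto_approx hfk).cauchySeq
  obtain ⟨N, hN⟩ := Metric.cauchySeq_iff'.1 h1 (ε / 3 / (|t| + 1)) (by positivity)
  refine ⟨N, fun n hn => ?_⟩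
  have hs := h.isSelfAdjoint_approx
  have h2 := norm_expI_sub_expI_le (hs n) (hs N) (h.approx_comm n N) t f
  have h3 := hN n hn
  rw [Metric.mem_ball, dist_eq_norm] at hf
  rw [dist_eq_norm] at h3 ⊢
  simp only at hf
  have e : expI (h.approx n) t g - expI (h.approx N) t g
      = -expI (h.approx n) t (f - g) + (expI (h.approx n) t f - expI (h.approx N) t f)
        + expI (h.approx N) t (f - g) := by
    rw [map_sub, map_sub]; abel
  rw [e]
  have h4 : |t| * ‖h.approx n f - h.approx N f‖ ≤ ε / 3 := by
    have h5 : 0 < |t| + 1 := by positivity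
    calc |t| * ‖h.approx n f - h.approx N f‖ ≤ (|t| + 1) * (ε / 3 / (|t| + 1)) := by
          gcongr; linarith
      _ = ε / 3 := by field_simp
  refine (norm_add₃_le).trans_lt ?_
  rw [norm_neg, norm_expI (hs n), norm_expI (hs N)]
  linarith

theorem exists_limit (h : IsSelfAdjointGraph Γ) (t : ℝ) :
    ∃ U : H →L[ℂ] H, ∀ g, Tendsto (fun n => expI (h.approx n) t g) atTop (𝓝 (U g)) := by
  choose f hf using fun g => cauchySeq_tendsto_of_complete (h.cauchySeq_expI t g)
  exact ⟨continuousLinearMapOfTendsto (fun n => expI (h.approx n) t) (tendsto_pi_nhds.2 hf), hf⟩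

/-- The unitary group generated by a self-adjoint graph. -/
def group (h : IsSelfAdjointGraph Γ) (t : ℝ) : H →L[ℂ] H := (h.exists_limit t).choose

theorem tendsto_group (h : IsSelfAdjointGraph Γ) (t : ℝ) (g : H) :
    Tendsto (fun n => expI (h.approx n) t g) atTop (𝓝 (h.group t g)) :=
  (h.exists_limit t).choose_spec g

theorem group_zero (h : IsSelfAdjointGraph Γ) : h.group 0 = ContinuousLinearMap.id ℂ H := by
  ext g
  refine tendsto_nhds_unique (h.tendsto_group 0 g) ?_
  simp [expI_zero]

theorem norm_group (h : IsSelfAdjointGraph Γ) (t : ℝ) (g : H) : ‖h.group t g‖ = ‖g‖ := by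
  refine tendsto_nhds_unique (h.tendsto_group t g).norm ?_
  simp only [norm_expI (h.isSelfAdjoint_approx _)]
  exact tendsto_const_nhds

theorem tendsto_expI_apply (h : IsSelfAdjointGraph Γ) (t : ℝ) {f : ℕ → H} {g : H}
    (hf : Tendsto f atTop (𝓝 g)) :
    Tendsto (fun n => expI (h.approx n) t (f n)) atTop (𝓝 (h.group t g)) := by
  have h1 : Tendsto (fun n => expI (h.approx n) t (f n - g)) atTop (𝓝 0) := by
    refine squeeze_zero_norm (fun n => ?_) (tendsto_iff_norm_sub_tendsto_zero.1 hf)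
    rw [norm_expI (h.isSelfAdjoint_approx _)]
  simpa using h1.add (h.tendsto_group t g)

theorem group_add (h : IsSelfAdjointGraph Γ) (s t : ℝ) :
    h.group (s + t) = (h.group s).comp (h.group t) := by
  ext g
  refine tendsto_nhds_unique (h.tendsto_group (s + t) g) ?_
  simp_rw [expI_add]
  exact h.tendsto_expI_apply s (h.tendsto_group t g)

theorem norm_group_sub_le (h : IsSelfAdjointGraph Γ) (t : ℝ) {f k : H} (hfk : (f, k) ∈ Γ) :
    ‖h.group t f - f‖ ≤ |t| * ‖k‖ :=
  le_of_tendsto_of_tendsto' ((h.tendsto_group t f).sub_const f).norm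
    ((h.tendsto_approx hfk).norm.const_mul _)
    fun n => norm_expI_sub_le (h.isSelfAdjoint_approx n) t f

theorem continuous_group (h : IsSelfAdjointGraph Γ) (g : H) : Continuous fun t => h.group t g := by
  have h0 : Tendsto (fun t => h.group t g) (𝓝 0) (𝓝 g) := by
    rw [Metric.tendsto_nhds]
    intro ε hε
    obtain ⟨_, hf, ⟨⟨f, k⟩, hfk, rfl⟩⟩ := Metric.dense_iff.1 h.dense g (ε / 3) (by positivity)
    rw [Metric.mem_ball, dist_eq_norm] at hf
    simp only at hf
    have hlim : Tendsto (fun t : ℝ => |t| * ‖k‖) (𝓝 0) (𝓝 (|0| * ‖k‖)) :=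
      (continuous_abs.tendsto 0).mul_const _
    have hev : ∀ᶠ t : ℝ in 𝓝 0, |t| * ‖k‖ < ε / 3 :=
      hlim.eventually_lt_const (by simpa using (by positivity : 0 < ε / 3))
    filter_upwards [hev] with t ht
    have h1 := h.norm_group_sub_le t hfk
    rw [dist_eq_norm]
    have e : h.group t g - g = -h.group t (f - g) + (h.group t f - f) + (f - g) := by
      rw [map_sub]; abel
    rw [e]
    refine (norm_add₃_le).trans_lt ?_
    rw [norm_neg, h.norm_group]
    linarith
  rw [continuous_iff_continuousAt]
  intro t
  have h1 : Tendsto (fun s => h.group t (h.group (s - t) g)) (𝓝 t) (𝓝 (h.group t g)) := by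
    refine ((h.group t).continuous.tendsto g).comp (h0.comp ?_)
    have : Tendsto (fun s : ℝ => s - t) (𝓝 t) (𝓝 (t - t)) := tendsto_id.sub_const t
    rwa [sub_self] at this
  refine h1.congr fun s => ?_
  change ((h.group t).comp (h.group (s - t))) g = _
  rw [← h.group_add]
  congr 2
  ring

/-- The limit is taken in the integrated equation `e^{itB} f = f + ∫ e^{isB} iB f ds` for the
bounded approximations `B`; strong continuity of the limit group then allows differentiation at
zero. -/
theorem hasDerivAt_group (h : IsSelfAdjointGraph Γ) {f k : H} (hfk : (f, k) ∈ Γ) :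
    HasDerivAt (fun t => h.group t f) (Complex.I • k) 0 := by
  have hcont : ∀ n, Continuous fun s => expI (h.approx n) s (Complex.I • h.approx n f) :=
    fun n => continuous_expI _ _
  have hk := (h.tendsto_approx hfk).const_smul Complex.I
  obtain ⟨C, hC⟩ := hk.norm.bddAbove_range
  have h1 : ∀ t : ℝ, h.group t f = f + ∫ s in (0 : ℝ)..t, h.group s (Complex.I • k) := by
    intro t
    have e1 : ∀ n, expI (h.approx n) t f
        = f + ∫ s in (0 : ℝ)..t, expI (h.approx n) s (Complex.I • h.approx n f) := by
      intro n
      rw [intervalIntegral.integral_eq_sub_of_hasDerivAt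
        (fun s _ => hasDerivAt_expI (h.approx n) s f) ((hcont n).intervalIntegrable _ _), expI_zero]
      simp
    refine tendsto_nhds_unique (h.tendsto_group t f) ?_
    simp_rw [e1]
    refine Tendsto.const_add f ?_
    refine intervalIntegral.tendsto_integral_filter_of_dominated_convergence (fun _ => C) ?_ ?_ ?_ ?_
    · exact Eventually.of_forall fun n => (hcont n).aestronglyMeasurable
    · refine Eventually.of_forall fun n => Eventually.of_forall fun s _ => ?_
      rw [norm_expI (h.isSelfAdjoint_approx n)]
      exact hC ⟨n, rfl⟩
    · exact intervalIntegrable_const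
    · exact Eventually.of_forall fun s _ => h.tendsto_expI_apply s hk
  have hc := h.continuous_group (Complex.I • k)
  have h2 := (intervalIntegral.integral_hasDerivAt_right (hc.intervalIntegrable 0 0)
    hc.stronglyMeasurable.stronglyMeasurableAtFilter hc.continuousAt).const_add f
  rw [h.group_zero] at h2
  simp_rw [← h1] at h2
  exact h2

/-- The generator has no larger domain: if `a` in the domain solves `(A + i) a = k + i f`, then
`e^{itA} (f - a)` has derivative `f - a` at zero, and conservation of the norm gives `‖f - a‖ = 0`.
-/
theorem mem_of_hasDerivAt_group (h : IsSelfAdjointGraph Γ) {f k : H}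
    (hfk : HasDerivAt (fun t => h.group t f) (Complex.I • k) 0) : (f, k) ∈ Γ := by
  have h1 : (1 : ℝ) ≠ 0 := one_ne_zero
  set g := k + Complex.I • f with hg
  have hmem := h.res_mem h1 g
  set a := h.res 1 g with ha
  have h2 := h.hasDerivAt_group hmem
  have h3 := hfk.sub h2
  have e : Complex.I • k - Complex.I • (g - ((1 : ℝ) * Complex.I : ℂ) • a) = f - a := by
    rw [hg]
    have hI := Complex.I_mul_I
    match_scalars
    · ring
    · linear_combination -hI
    · linear_combination hI
  rw [e] at h3
  have h4 : HasDerivAt (fun t => h.group t (f - a)) (f - a) 0 := by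
    refine h3.congr_of_eventuallyEq (Eventually.of_forall fun t => ?_)
    exact map_sub _ _ _
  let _ : InnerProductSpace ℝ H := InnerProductSpace.rclikeToReal ℂ H
  have h5 := h4.norm_sq
  have h6 : (fun t : ℝ => ‖h.group t (f - a)‖ ^ 2) = fun _ => ‖f - a‖ ^ 2 := by
    ext t; rw [h.norm_group]
  rw [h6] at h5
  have h7 := h5.unique (hasDerivAt_const 0 _)
  rw [h.group_zero] at h7
  simp only [ContinuousLinearMap.id_apply] at h7
  have h8 : f - a = 0 := by
    rw [real_inner_self_eq_norm_sq] at h7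
    have : ‖f - a‖ ^ 2 = 0 := by linarith
    simpa using this
  have h9 : f = a := sub_eq_zero.1 h8
  rw [← h9] at hmem
  convert hmem using 2
  rw [hg]
  push_cast
  module

end IsSelfAdjointGraph

end

section

variable {ν : ℕ}

/-! ### Density of test functions in the Schwartz space -/

/-- A smooth bump function, equal to one on the ball of radius `2` and supported in the ball of
radius `3`. -/
def bump : ContDiffBump (0 : X ν) := ⟨2, 3, by norm_num, by norm_num⟩

/-- The cut-off function `θ(c x)`. -/
def cutoffR (c : ℝ) (x : X ν) : ℝ := bump (c • x)

/-- The cut-off function `θ(c x)`, complex valued. -/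
abbrev cutoff (c : ℝ) : X ν → ℂ := fun x => ((cutoffR c x : ℝ) : ℂ)

theorem contDiff_cutoffR (c : ℝ) : ContDiff ℝ ∞ (cutoffR c : X ν → ℝ) :=
  bump.contDiff.comp (contDiff_const_smul c)

theorem contDiff_cutoff (c : ℝ) : ContDiff ℝ ∞ (cutoff c : X ν → ℂ) :=
  Complex.ofRealCLM.contDiff.comp (contDiff_cutoffR c)

theorem cutoffR_nonneg (c : ℝ) (x : X ν) : 0 ≤ cutoffR c x := bump.nonneg

theorem cutoffR_le_one (c : ℝ) (x : X ν) : cutoffR c x ≤ 1 := bump.le_one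

theorem cutoffR_eq_one {c : ℝ} (hc : 0 ≤ c) {x : X ν} (hx : c * ‖x‖ ≤ 2) : cutoffR c x = 1 := by
  apply bump.one_of_mem_closedBall
  simpa [bump, norm_smul, abs_of_nonneg hc] using hx

theorem cutoffR_eq_zero {c : ℝ} (hc : 0 ≤ c) {x : X ν} (hx : 3 ≤ c * ‖x‖) : cutoffR c x = 0 := by
  apply bump.zero_of_le_dist
  simpa [bump, norm_smul, abs_of_nonneg hc] using hx

theorem hasCompactSupport_cutoffR {c : ℝ} (hc : c ≠ 0) :
    HasCompactSupport (cutoffR c : X ν → ℝ) :=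
  bump.hasCompactSupport.comp_smul hc

theorem hasCompactSupport_cutoff {c : ℝ} (hc : c ≠ 0) :
    HasCompactSupport (cutoff c : X ν → ℂ) :=
  (hasCompactSupport_cutoffR hc).comp_left (g := Complex.ofReal) Complex.ofReal_zero

theorem hasTemperateGrowth_cutoff {c : ℝ} (hc : c ≠ 0) :
    (cutoff c : X ν → ℂ).HasTemperateGrowth :=
  (hasCompactSupport_cutoff hc).hasTemperateGrowth (contDiff_cutoff c)

/-- The derivative vanishes where `c |x| < 2` and is bounded uniformly in `c ≤ 1` elsewhere, where
the factor `c |x|` is at least `2`. -/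
theorem norm_iteratedFDeriv_cutoff_sub_one_le (i : ℕ) : ∃ M : ℝ, 0 ≤ M ∧ ∀ c : ℝ, 0 < c → c ≤ 1 →
    ∀ x : X ν, ‖iteratedFDeriv ℝ i (fun y => cutoff c y - 1) x‖ ≤ M * (c * ‖x‖) := by
  set g : X ν → ℂ := fun y => cutoff 1 y - 1 with hg
  have hgs : ContDiff ℝ ∞ g := (contDiff_cutoff 1).sub contDiff_const
  have hbd : ∃ M : ℝ, 0 ≤ M ∧ ∀ x, ‖iteratedFDeriv ℝ i g x‖ ≤ M := by
    set φ : 𝓢(X ν, ℂ) := (hasCompactSupport_cutoff (ν := ν) one_ne_zero).toSchwartzMap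
      (contDiff_cutoff 1) with hφ
    rcases i with _ | i
    · refine ⟨1 + 1, by norm_num, fun x => ?_⟩
      rw [norm_iteratedFDeriv_zero]
      refine (norm_sub_le _ _).trans ?_
      rw [norm_one, Complex.norm_real, Real.norm_of_nonneg (cutoffR_nonneg _ _)]
      gcongr
      exact cutoffR_le_one _ _
    · obtain ⟨C, hC⟩ := φ.decay 0 (i + 1)
      refine ⟨C, hC.1.le, fun x => ?_⟩
      have h1 := hC.2 x
      rw [pow_zero, one_mul] at h1
      have h2 : g = (fun y => φ y - (fun _ : X ν => (1 : ℂ)) y) := rfl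
      have h3 : iteratedFDeriv ℝ (i + 1) g x = iteratedFDeriv ℝ (i + 1) φ x := by
        rw [h2, show (fun y => φ y - (fun _ : X ν => (1 : ℂ)) y) = (φ : X ν → ℂ) - fun _ => 1
          from rfl, iteratedFDeriv_sub_apply (φ.smooth _).contDiffAt contDiff_const.contDiffAt,
          iteratedFDeriv_succ_const]
        simp
      rwa [h3]
  obtain ⟨M, hM0, hM⟩ := hbd
  refine ⟨M, hM0, fun c hc hc1 x => ?_⟩
  have h1 : (fun y : X ν => cutoff c y - 1) = fun y => g (c • y) := by
    ext y; simp [hg, cutoff, cutoffR]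
  rw [h1]
  rcases lt_or_ge (c * ‖x‖) 2 with hx | hx
  · have h2 : (fun y => g (c • y)) =ᶠ[𝓝 x] fun _ => 0 := by
      have h3 : ∀ᶠ y in 𝓝 x, c * ‖y‖ < 2 :=
        (continuous_const.mul continuous_norm).continuousAt.eventually_lt_const hx
      filter_upwards [h3] with y hy
      rw [← congrFun h1 y]
      simp [cutoff, cutoffR_eq_one hc.le hy.le]
    rw [(h2.iteratedFDeriv ℝ i).eq_of_nhds]
    have : iteratedFDeriv ℝ i (fun _ : X ν => (0 : ℂ)) x = 0 := by
      rw [iteratedFDeriv_fun_zero]; rfl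
    rw [this, norm_zero]
    positivity
  · have h4 := congrFun (iteratedFDeriv_comp_const_smul (i := i) c
      (hgs.of_le (by exact_mod_cast le_top))) x
    rw [h4, norm_smul, norm_pow, Real.norm_of_nonneg hc.le]
    calc c ^ i * ‖iteratedFDeriv ℝ i g (c • x)‖ ≤ 1 * M := by
          gcongr
          · exact pow_le_one₀ hc.le hc1
          · exact hM _
      _ ≤ M * (c * ‖x‖) := by nlinarith

/-- In the Leibniz formula each derivative of `cutoff - 1` contributes `O(c |x|)`; the extra `|x|`
is paid for by the next weight of the Schwartz seminorms, and the factor `c` gives convergence. -/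
theorem tendsto_mulS_cutoff (φ : 𝓢(X ν, ℂ)) :
    Tendsto (fun n : ℕ => mulS (cutoff (1 / ((n : ℝ) + 1))) φ) atTop (𝓝 φ) := by
  rw [(schwartz_withSeminorms ℂ (X ν) ℂ).tendsto_nhds]
  rintro ⟨k, l⟩ ε hε
  choose M hM0 hM using fun i => norm_iteratedFDeriv_cutoff_sub_one_le (ν := ν) i
  set K : ℝ := ∑ i ∈ Finset.range (l + 1),
    (l.choose i : ℝ) * (M i * SchwartzMap.seminorm ℂ (k + 1) (l - i) φ) with hK
  have hK0 : 0 ≤ K := Finset.sum_nonneg fun i _ =>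
    mul_nonneg (Nat.cast_nonneg _) (mul_nonneg (hM0 i) (apply_nonneg _ _))
  have hbound : ∀ n : ℕ, SchwartzMap.seminorm ℂ k l (mulS (cutoff (1 / ((n : ℝ) + 1))) φ - φ)
      ≤ 1 / ((n : ℝ) + 1) * K := by
    intro n
    set c : ℝ := 1 / ((n : ℝ) + 1) with hc
    have hc0 : 0 < c := by positivity
    have hc1 : c ≤ 1 := (div_le_one (by positivity)).2 (by linarith [(Nat.cast_nonneg n : (0 : ℝ) ≤ n)])
    refine SchwartzMap.seminorm_le_bound ℂ k l _ (by positivity) fun x => ?_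
    have h1 : ⇑(mulS (cutoff c) φ - φ) = fun y => (cutoff c y - 1) * φ y := by
      ext y
      rw [sub_apply, SchwartzMap.smulLeftCLM_apply_apply (hasTemperateGrowth_cutoff hc0.ne'),
        smul_eq_mul]
      ring
    rw [h1]
    have h2 := norm_iteratedFDeriv_mul_le (𝕜 := ℝ) (N := ∞) (n := l)
      ((contDiff_cutoff c).sub contDiff_const : ContDiff ℝ ∞ fun y : X ν => cutoff c y - 1)
      (φ.smooth ⊤) x (by exact_mod_cast le_top)
    calc ‖x‖ ^ k * ‖iteratedFDeriv ℝ l (fun y => (cutoff c y - 1) * φ y) x‖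
        ≤ ‖x‖ ^ k * ∑ i ∈ Finset.range (l + 1), (l.choose i : ℝ) *
          ‖iteratedFDeriv ℝ i (fun y => cutoff c y - 1) x‖ * ‖iteratedFDeriv ℝ (l - i) φ x‖ := by
          gcongr
      _ ≤ c * K := by
          rw [hK, Finset.mul_sum, Finset.mul_sum]
          refine Finset.sum_le_sum fun i _ => ?_
          have h3 := hM i c hc0 hc1 x
          have h4 := SchwartzMap.le_seminorm ℂ (k + 1) (l - i) φ x
          calc ‖x‖ ^ k * ((l.choose i : ℝ) * ‖iteratedFDeriv ℝ i (fun y => cutoff c y - 1) x‖ *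
                ‖iteratedFDeriv ℝ (l - i) φ x‖)
              ≤ ‖x‖ ^ k * ((l.choose i : ℝ) * (M i * (c * ‖x‖)) *
                ‖iteratedFDeriv ℝ (l - i) φ x‖) := by gcongr
            _ = c * ((l.choose i : ℝ) * (M i *
                (‖x‖ ^ (k + 1) * ‖iteratedFDeriv ℝ (l - i) φ x‖))) := by ring
            _ ≤ _ := by
                gcongr
                exact hM0 i
  have hlim : Tendsto (fun n : ℕ => 1 / ((n : ℝ) + 1) * K) atTop (𝓝 (0 * K)) :=
    tendsto_one_div_add_atTop_nhds_zero_nat.mul_const K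
  rw [zero_mul] at hlim
  filter_upwards [hlim.eventually_lt_const hε] with n hn
  exact (hbound n).trans_lt hn

theorem hasCompactSupport_mulS {g : X ν → ℂ} (hg : g.HasTemperateGrowth) (h : HasCompactSupport g)
    (φ : 𝓢(X ν, ℂ)) : HasCompactSupport (mulS g φ : X ν → ℂ) := by
  rw [SchwartzMap.smulLeftCLM_apply hg]
  exact h.smul_right

/-- A closed condition that holds for test functions holds for Schwartz functions. -/
theorem schwartz_induction {p : 𝓢(X ν, ℂ) → Prop} (hp : IsClosed {φ | p φ})
    (h : ∀ φ : 𝓢(X ν, ℂ), HasCompactSupport (φ : X ν → ℂ) → p φ) (φ : 𝓢(X ν, ℂ)) : p φ := by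
  refine hp.mem_of_tendsto (tendsto_mulS_cutoff φ) (Eventually.of_forall fun n => ?_)
  have hc : (1 / ((n : ℝ) + 1)) ≠ 0 := by positivity
  exact h _ (hasCompactSupport_mulS (hasTemperateGrowth_cutoff hc) (hasCompactSupport_cutoff hc) φ)

/-! ### The unitary group of `A_u` -/

theorem mem_closure_conjGraph (u : X ν → X ν) (φ : 𝓢(X ν, ℂ)) :
    (embL2 φ, embL2 (conjOp u φ)) ∈ closure (conjGraph u) := by
  refine schwartz_induction (p := fun φ => (embL2 φ, embL2 (conjOp u φ)) ∈ closure (conjGraph u))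
    ?_ (fun φ hφ => subset_closure ⟨φ, hφ, rfl⟩) φ
  refine isClosed_closure.preimage ?_
  refine continuous_embL2.prodMk (continuous_embL2.comp ?_)
  exact (conjCLM u).continuous.congr fun φ => conjCLM_apply u φ

/-- The graph of `A_u` on test functions, as a subspace. -/
def conjSubmodule (u : X ν → X ν) : Submodule ℂ (L2 ν × L2 ν) where
  carrier := conjGraph u
  zero_mem' := ⟨0, HasCompactSupport.zero, by
    rw [← conjCLM_apply, map_zero]
    exact Prod.ext (map_zero (toLpCLM ℂ (E := X ν) ℂ 2 volume)).symm
      (map_zero (toLpCLM ℂ (E := X ν) ℂ 2 volume)).symm⟩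
  add_mem' := by
    rintro _ _ ⟨φ, hφ, rfl⟩ ⟨ψ, hψ, rfl⟩
    refine ⟨φ + ψ, hφ.add hψ, ?_⟩
    rw [← conjCLM_apply, ← conjCLM_apply, ← conjCLM_apply, map_add]
    exact Prod.ext (embL2_add _ _).symm (embL2_add _ _).symm
  smul_mem' := by
    rintro c _ ⟨φ, hφ, rfl⟩
    refine ⟨c • φ, hφ.smul_left (f := fun _ => c), ?_⟩
    rw [← conjCLM_apply, ← conjCLM_apply, map_smul]
    exact Prod.ext (embL2_smul _ _).symm (embL2_smul _ _).symm

theorem isSelfAdjointGraph_conj {u : X ν → X ν} (h : IsField u) :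
    IsSelfAdjointGraph (conjSubmodule u).topologicalClosure where
  closed := Submodule.isClosed_topologicalClosure _
  symm := by
    intro p hp q hq
    have hp' : p ∈ closure (conjGraph u) := hp
    have hq' : q ∈ closure (conjGraph u) := hq
    have hcl : IsClosed {r : (L2 ν × L2 ν) × (L2 ν × L2 ν) |
        inner ℂ r.1.2 r.2.1 = inner ℂ r.1.1 r.2.2} := isClosed_eq (by fun_prop) (by fun_prop)
    have hmem : (p, q) ∈ closure (conjGraph u ×ˢ conjGraph u) := by
      rw [closure_prod_eq]; exact ⟨hp', hq'⟩
    refine closure_minimal ?_ hcl hmem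
    rintro ⟨_, _⟩ ⟨⟨φ, _, rfl⟩, ⟨ψ, _, rfl⟩⟩
    exact inner_conjOp_left h φ ψ
  dense := by
    refine denseRange_embL2.mono ?_
    rintro _ ⟨φ, rfl⟩
    exact ⟨_, mem_closure_conjGraph u φ, rfl⟩
  range := fun l hl ψ hψ => eq_zero_of_orthogonal_range h hl ψ fun φ =>
    hψ _ (mem_closure_conjGraph u φ)

theorem exists_isConjGroup {u : X ν → X ν} (h : IsField u) :
    ∃ U : ℝ → L2 ν →L[ℂ] L2 ν, IsConjGroup u U := by
  have hs := isSelfAdjointGraph_conj h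
  exact ⟨hs.group, hs.group_zero, hs.group_add, hs.norm_group, hs.continuous_group,
    fun f k => ⟨hs.mem_of_hasDerivAt_group, hs.hasDerivAt_group⟩⟩

namespace IsConjGroup

variable {u : X ν → X ν} {U : ℝ → L2 ν →L[ℂ] L2 ν}

theorem hasDerivAt_zero (hU : IsConjGroup u U) (φ : 𝓢(X ν, ℂ)) :
    HasDerivAt (fun t => U t (embL2 φ)) (Complex.I • embL2 (conjOp u φ)) 0 :=
  (hU.generator _ _).2 (mem_closure_conjGraph u φ)

theorem apply_neg_apply (hU : IsConjGroup u U) (t : ℝ) (f : L2 ν) : U (-t) (U t f) = f := by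
  change ((U (-t)).comp (U t)) f = f
  rw [← hU.map_add, neg_add_cancel, hU.map_zero]
  rfl

theorem inner_map_map (hU : IsConjGroup u U) (t : ℝ) (f g : L2 ν) :
    inner ℂ (U t f) (U t g) = inner ℂ f g :=
  (LinearMap.norm_map_iff_inner_map_map (U t)).1 (hU.norm_map t) f g

end IsConjGroup

end

section

variable {ν : ℕ}

/-! ### The Sobolev space `H¹` -/

/-- The complex conjugate of a Schwartz function. -/
def conjS (φ : 𝓢(X ν, ℂ)) : 𝓢(X ν, ℂ) := φ.postcompCLM (Complex.conjCLE : ℂ →L[ℝ] ℂ)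

@[simp]
theorem conjS_apply (φ : 𝓢(X ν, ℂ)) (x : X ν) : conjS φ x = starRingEnd ℂ (φ x) := rfl

theorem conjS_conjS (φ : 𝓢(X ν, ℂ)) : conjS (conjS φ) = φ := by ext x; simp

theorem lineDeriv_conjS (φ : 𝓢(X ν, ℂ)) (m : X ν) : ∂_{m} (conjS φ) = conjS (∂_{m} φ) := by
  ext x
  rw [conjS_apply, SchwartzMap.lineDerivOp_apply_eq_fderiv, SchwartzMap.lineDerivOp_apply_eq_fderiv]
  have h : HasFDerivAt (conjS φ) ((Complex.conjCLE : ℂ →L[ℝ] ℂ).comp (fderiv ℝ φ x)) x :=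
    (Complex.conjCLE : ℂ →L[ℝ] ℂ).hasFDerivAt.comp x φ.differentiableAt.hasFDerivAt
  rw [h.fderiv]
  simp

theorem inner_embL2_left (φ : 𝓢(X ν, ℂ)) (f : L2 ν) :
    inner ℂ (embL2 φ) f = (f : 𝓢'(X ν, ℂ)) (conjS φ) := by
  rw [L2.inner_def, Lp.toTemperedDistribution_apply]
  apply integral_congr_ae
  filter_upwards [coeFn_embL2 φ] with x a
  rw [a, RCLike.inner_apply, conjS_apply, smul_eq_mul, mul_comm]

theorem lineDeriv_eq_iff (j : Fin ν) (f h : L2 ν) :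
    ∂_{stdVec j} (f : 𝓢'(X ν, ℂ)) = (h : 𝓢'(X ν, ℂ)) ↔
      ∀ φ : 𝓢(X ν, ℂ), inner ℂ (embL2 (∂_{stdVec j} φ)) f = - inner ℂ (embL2 φ) h := by
  constructor
  · intro H φ
    rw [inner_embL2_left, inner_embL2_left, ← H, TemperedDistribution.lineDerivOp_apply_apply,
      map_neg, lineDeriv_conjS, neg_neg]
  · intro H
    ext φ
    have h1 := H (conjS φ)
    rw [inner_embL2_left, inner_embL2_left, lineDeriv_conjS, conjS_conjS, conjS_conjS] at h1
    rw [TemperedDistribution.lineDerivOp_apply_apply, map_neg, h1, neg_neg]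

namespace H1

/-- The `j`-th distributional derivative of an element of `H¹`. -/
def d (F : H1 ν) (j : Fin ν) : L2 ν :=
  (F : WithLp 2 (L2 ν × PiLp 2 (fun _ : Fin ν => L2 ν))).snd j

theorem inner_lineDeriv (F : H1 ν) (j : Fin ν) (φ : 𝓢(X ν, ℂ)) :
    inner ℂ (embL2 (∂_{stdVec j} φ)) (toL2 F) = - inner ℂ (embL2 φ) (d F j) :=
  (lineDeriv_eq_iff j _ _).1 (F.2 j) φ

theorem norm_sq_eq (F : H1 ν) : ‖F‖ ^ 2 = ‖toL2 F‖ ^ 2 + ∑ j, ‖d F j‖ ^ 2 := by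
  rw [Submodule.coe_norm, WithLp.prod_norm_sq_eq_of_L2, PiLp.norm_sq_eq_of_L2]
  rfl

theorem inner_eq (F G : H1 ν) :
    inner ℂ F G = inner ℂ (toL2 F) (toL2 G) + ∑ j, inner ℂ (d F j) (d G j) := by
  rw [Submodule.coe_inner, WithLp.prod_inner_apply, PiLp.inner_apply]
  rfl

theorem norm_toL2_le (F : H1 ν) : ‖toL2 F‖ ≤ ‖F‖ := by
  refine le_of_sq_le_sq ?_ (norm_nonneg _)
  rw [norm_sq_eq]
  exact le_add_of_nonneg_right (Finset.sum_nonneg fun _ _ => by positivity)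

theorem norm_d_le (F : H1 ν) (j : Fin ν) : ‖d F j‖ ≤ ‖F‖ := by
  refine le_of_sq_le_sq ?_ (norm_nonneg _)
  rw [norm_sq_eq]
  exact (Finset.single_le_sum (f := fun j => ‖d F j‖ ^ 2) (fun _ _ => by positivity)
    (Finset.mem_univ j)).trans (le_add_of_nonneg_left (by positivity))

/-- The inclusion `H¹ → L²` as a bounded operator. -/
def toL2CLM : H1 ν →L[ℂ] L2 ν :=
  LinearMap.mkContinuous ⟨⟨H1.toL2, fun _ _ => rfl⟩, fun _ _ => rfl⟩ 1 fun F => by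
    rw [one_mul]; exact norm_toL2_le F

@[simp] theorem toL2CLM_apply (F : H1 ν) : toL2CLM F = toL2 F := rfl

/-- The derivative `∂_j : H¹ → L²` as a bounded operator. -/
def dCLM (j : Fin ν) : H1 ν →L[ℂ] L2 ν :=
  LinearMap.mkContinuous ⟨⟨fun F => d F j, fun _ _ => rfl⟩, fun _ _ => rfl⟩ 1 fun F => by
    rw [one_mul]; exact norm_d_le F j

@[simp] theorem dCLM_apply (j : Fin ν) (F : H1 ν) : dCLM j F = d F j := rfl

@[simp] theorem toL2_ofSchwartz (φ : 𝓢(X ν, ℂ)) : toL2 (ofSchwartz φ) = embL2 φ := rfl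

@[simp] theorem d_ofSchwartz (φ : 𝓢(X ν, ℂ)) (j : Fin ν) :
    d (ofSchwartz φ) j = embL2 (∂_{stdVec j} φ) := rfl

theorem ext_d {F G : H1 ν} (h : toL2 F = toL2 G) (h' : ∀ j, d F j = d G j) : F = G := by
  have h1 : F - G = 0 := by
    have h2 : ‖F - G‖ ^ 2 = 0 := by
      have e1 : toL2 (F - G) = 0 := by
        rw [← toL2CLM_apply, map_sub, toL2CLM_apply, toL2CLM_apply, h, sub_self]
      have e2 : ∀ j, d (F - G) j = 0 := fun j => by
        rw [← dCLM_apply, map_sub, dCLM_apply, dCLM_apply, h', sub_self]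
      rw [norm_sq_eq, e1]
      simp [e2]
    exact norm_eq_zero.1 (by simpa using h2)
  exact sub_eq_zero.1 h1

theorem toL2_injective : Function.Injective (H1.toL2 : H1 ν → L2 ν) := by
  intro F G h
  refine ext_d h fun j => ?_
  refine sub_eq_zero.1 (denseRange_embL2.eq_zero_of_inner_right ℂ ?_)
  intro φ
  have h1 := inner_lineDeriv F j φ
  rw [h, inner_lineDeriv G j φ] at h1
  rw [inner_sub_right, sub_eq_zero]
  exact (neg_injective h1).symm

/-- An element of `H¹` from a function and its derivatives. -/
def mk (f : L2 ν) (h : Fin ν → L2 ν)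
    (H : ∀ j, ∀ φ : 𝓢(X ν, ℂ), inner ℂ (embL2 (∂_{stdVec j} φ)) f = - inner ℂ (embL2 φ) (h j)) :
    H1 ν :=
  ⟨WithLp.toLp 2 (f, WithLp.toLp 2 h), fun j => (lineDeriv_eq_iff j _ _).2 (H j)⟩

theorem ofSchwartz_add (φ ψ : 𝓢(X ν, ℂ)) : ofSchwartz (φ + ψ) = ofSchwartz φ + ofSchwartz ψ :=
  toL2_injective (embL2_add φ ψ)

theorem ofSchwartz_smul (c : ℂ) (φ : 𝓢(X ν, ℂ)) : ofSchwartz (c • φ) = c • ofSchwartz φ :=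
  toL2_injective (embL2_smul c φ)

theorem continuous_ofSchwartz : Continuous (ofSchwartz : 𝓢(X ν, ℂ) → H1 ν) := by
  refine Continuous.subtype_mk ?_ _
  refine (WithLp.prod_continuous_toLp 2 _ _).comp (continuous_embL2.prodMk ?_)
  refine (PiLp.continuous_toLp 2 _).comp (continuous_pi fun j => ?_)
  exact continuous_embL2.comp (lineDerivOpCLM ℂ 𝓢(X ν, ℂ) (stdVec j)).continuous

instance : CompleteSpace (H1 ν) := by
  have hcl : IsClosed (H1 ν : Set (WithLp 2 (L2 ν × PiLp 2 (fun _ : Fin ν => L2 ν)))) := by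
    have : (H1 ν : Set (WithLp 2 (L2 ν × PiLp 2 (fun _ : Fin ν => L2 ν)))) =
        ⋂ j : Fin ν, ⋂ φ : 𝓢(X ν, ℂ), {p | inner ℂ (embL2 (∂_{stdVec j} φ)) p.fst
          = - inner ℂ (embL2 φ) (p.snd j)} := by
      ext p
      simp only [Set.mem_iInter, Set.mem_ofPred_eq]
      exact forall_congr' fun j => lineDeriv_eq_iff j _ _
    rw [this]
    refine isClosed_iInter fun j => isClosed_iInter fun φ => isClosed_eq ?_ ?_
    · exact continuous_const.inner (WithLp.prod_continuous_ofLp 2 _ _ |>.fst)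
    · refine (continuous_const.inner ?_).neg
      exact (continuous_apply j).comp
        ((PiLp.continuous_ofLp 2 _).comp (WithLp.prod_continuous_ofLp 2 _ _ |>.snd))
  exact hcl.completeSpace_coe

end H1

/-! ### Fourier description of `H¹` and density of test functions -/

/-- The factor `2πi`. -/
abbrev tpi : ℂ := 2 * Real.pi * Complex.I

theorem conj_tpi : starRingEnd ℂ tpi = -tpi := by
  simp only [tpi, map_mul, Complex.conj_ofReal, Complex.conj_I, map_ofNat]
  ring

theorem lineDeriv_eq_mulF (j : Fin ν) (φ : 𝓢(X ν, ℂ)) :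
    ∂_{stdVec j} φ = tpi • mulF (coord j) φ := by
  rw [SchwartzMap.lineDeriv_eq_fourierMultiplierCLM]
  have h : Function.HasTemperateGrowth (EuclideanSpace.proj j : X ν →L[ℝ] ℝ) :=
    (EuclideanSpace.proj j : X ν →L[ℝ] ℝ).hasTemperateGrowth
  have := SchwartzMap.fourierMultiplierCLM_ofReal (𝕜 := ℂ) (F := ℂ) h φ
  have e : (fun x : X ν => inner ℝ x (stdVec j)) = EuclideanSpace.proj j := by
    ext x; exact inner_stdVec x j
  rw [e]
  exact congrArg (fun ψ => tpi • ψ) this.symm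

theorem mulF_sub {m₁ m₂ : X ν → ℂ} (h₁ : m₁.HasTemperateGrowth) (h₂ : m₂.HasTemperateGrowth)
    (φ : 𝓢(X ν, ℂ)) : mulF (fun ξ => m₁ ξ - m₂ ξ) φ = mulF m₁ φ - mulF m₂ φ := by
  have h := congrArg (fun T => T (𝓕 φ)) (SchwartzMap.smulLeftCLM_sub (F := ℂ) h₁ h₂)
  have h' : mulS (fun ξ => m₁ ξ - m₂ ξ) (𝓕 φ) = mulS m₁ (𝓕 φ) - mulS m₂ (𝓕 φ) := h
  rw [SchwartzMap.fourierMultiplierCLM_apply, h']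
  exact map_sub (FourierTransform.fourierInvCLM ℂ 𝓢(X ν, ℂ)) _ _

theorem mulF_sum {m : Fin ν → X ν → ℂ} (h : ∀ j, (m j).HasTemperateGrowth) (φ : 𝓢(X ν, ℂ)) :
    mulF (fun ξ => ∑ j, m j ξ) φ = ∑ j, mulF (m j) φ := by
  have h1 := congrArg (fun T => T φ)
    (SchwartzMap.fourierMultiplierCLM_sum (s := Finset.univ) ℂ fun j _ => h j)
  exact h1.trans (sum_apply _ _ _)

theorem mulF_const_mul {m : X ν → ℂ} (h : m.HasTemperateGrowth) (c : ℂ) (φ : 𝓢(X ν, ℂ)) :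
    mulF (fun ξ => c * m ξ) φ = c • mulF m φ :=
  congrArg (fun T => T φ) (SchwartzMap.fourierMultiplierCLM_smul h c)

theorem mulF_one (φ : 𝓢(X ν, ℂ)) : mulF (fun _ => 1) φ = φ := by
  have h := congrArg (fun T => T φ)
    (SchwartzMap.fourierMultiplierCLM_const (E := X ν) (F := ℂ) (1 : ℂ))
  exact h.trans (by simp)

theorem sum_coord_sq (ξ : X ν) : ∑ j : Fin ν, coord j ξ * coord j ξ = ((‖ξ‖ ^ 2 : ℝ) : ℂ) := by
  rw [EuclideanSpace.norm_sq_eq]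
  push_cast
  refine Finset.sum_congr rfl fun j _ => ?_
  rw [Real.norm_eq_abs, ← pow_two]
  norm_cast
  rw [sq_abs]

/-- The Fourier multiplier `(1 + 4π²|ξ|²)⁻¹` inverts `1 - Δ`. -/
theorem sub_sum_lineDeriv_mulF_moll (ψ : 𝓢(X ν, ℂ)) :
    mulF (moll (2 * Real.pi)) ψ
      - ∑ j : Fin ν, ∂_{stdVec j} (∂_{stdVec j} (mulF (moll (2 * Real.pi)) ψ)) = ψ := by
  have hm := hasTemperateGrowth_moll (ν := ν) (2 * Real.pi)
  have hg : ∀ j : Fin ν, (fun ξ : X ν =>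
      coord j ξ * (coord j ξ * moll (2 * Real.pi) ξ)).HasTemperateGrowth :=
    fun j => (hasTemperateGrowth_coord j).mul ((hasTemperateGrowth_coord j).mul hm)
  have h5 : ∀ j : Fin ν, ∂_{stdVec j} (∂_{stdVec j} (mulF (moll (2 * Real.pi)) ψ))
      = mulF (fun ξ => tpi ^ 2 * (coord j ξ * (coord j ξ * moll (2 * Real.pi) ξ))) ψ := by
    intro j
    have hc := hasTemperateGrowth_coord (ν := ν) j
    rw [lineDeriv_eq_mulF, lineDeriv_eq_mulF, map_smul, mulF_mulF hc hm,
      mulF_mulF hc (hasTemperateGrowth_coord_mul hm j), smul_smul, ← pow_two,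
      mulF_const_mul (hg j)]
  rw [Finset.sum_congr rfl fun j _ => h5 j,
    ← mulF_sum (m := fun j ξ => tpi ^ 2 * (coord j ξ * (coord j ξ * moll (2 * Real.pi) ξ)))
      (fun j => (Function.HasTemperateGrowth.const (tpi ^ 2)).mul (hg j))]
  have h7 : ∀ ξ : X ν, ∑ j : Fin ν, tpi ^ 2 * (coord j ξ * (coord j ξ * moll (2 * Real.pi) ξ))
      = moll (2 * Real.pi) ξ - 1 := by
    intro ξ
    have h9 : ((mollR (2 * Real.pi) ξ : ℝ) : ℂ) * (1 + ((2 * Real.pi : ℝ) : ℂ) ^ 2 *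
        ((‖ξ‖ ^ 2 : ℝ) : ℂ)) = 1 := by exact_mod_cast mollR_mul (2 * Real.pi) ξ
    calc ∑ j : Fin ν, tpi ^ 2 * (coord j ξ * (coord j ξ * moll (2 * Real.pi) ξ))
        = tpi ^ 2 * (∑ j : Fin ν, coord j ξ * coord j ξ) * moll (2 * Real.pi) ξ := by
          rw [Finset.mul_sum, Finset.sum_mul]
          exact Finset.sum_congr rfl fun j _ => by ring
      _ = moll (2 * Real.pi) ξ - 1 := by
          rw [sum_coord_sq, eq_sub_iff_add_eq, add_comm, ← h9]
          simp only [tpi, mul_pow, Complex.I_sq]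
          push_cast
          ring
  rw [funext h7, mulF_sub hm (Function.HasTemperateGrowth.const 1), mulF_one, sub_sub_cancel]

/-- `x_j (1 + s² |x|²)⁻¹`. -/
abbrev coordMoll (s : ℝ) (j : Fin ν) : X ν → ℂ := fun x => coord j x * moll s x

theorem hasTemperateGrowth_coordMoll (s : ℝ) (j : Fin ν) : (coordMoll s j).HasTemperateGrowth :=
  (hasTemperateGrowth_coord j).mul (hasTemperateGrowth_moll s)

theorem norm_coordMoll_le {s : ℝ} (hs : 0 < s) (j : Fin ν) (x : X ν) : ‖coordMoll s j x‖ ≤ s⁻¹ := by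
  have h := norm_mollA_le s j x
  rw [mollA, norm_mul, Complex.norm_real, Real.norm_of_nonneg hs.le] at h
  rwa [← le_div_iff₀' hs, one_div] at h

theorem memLp_coordMoll {s : ℝ} (hs : 0 < s) (j : Fin ν) : MemLp (coordMoll s j) ∞ volume :=
  memLp_top_of_temperate (hasTemperateGrowth_coordMoll s j) (norm_coordMoll_le hs j)

namespace H1

/-- The relation `𝓕(∂_j f) = 2πi ξ_j 𝓕f` in a form where both sides are bounded operators on `L²`.
Because `moll` never vanishes, `fourier_d` can divide it out pointwise. -/
theorem fmulL2_moll_d (F : H1 ν) {s : ℝ} (hs : 0 < s) (j : Fin ν) :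
    fmulL2 (moll s) (d F j) = tpi • fmulL2 (coordMoll s j) (toL2 F) := by
  refine sub_eq_zero.1 (denseRange_embL2.eq_zero_of_inner_right ℂ ?_)
  intro φ
  have hreal : (fun ξ => coordMoll s j ξ) = fun ξ : X ν => ((ξ j * mollR s ξ : ℝ) : ℂ) := by
    ext ξ; push_cast; rfl
  have h1 : inner ℂ (fmulL2 (coordMoll s j) (embL2 φ)) (toL2 F)
      = inner ℂ (embL2 φ) (fmulL2 (coordMoll s j) (toL2 F)) := by
    have := inner_fmulL2_left_of_real 
      (g := fun ξ : X ν => ξ j * mollR s ξ) (by rw [← hreal]; exact memLp_coordMoll hs j) (embL2 φ) (toL2 F)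
    rwa [← hreal] at this
  rw [inner_sub_right, ← inner_fmulL2_left_of_real (memLp_moll s),
    fmulL2_embL2 (memLp_moll s) (hasTemperateGrowth_moll s), ← neg_eq_iff_eq_neg.2 
    (inner_lineDeriv F j (mulF (moll s) φ)), lineDeriv_eq_mulF,
    mulF_mulF (hasTemperateGrowth_coord j) (hasTemperateGrowth_moll s), embL2_smul,
    inner_smul_left, conj_tpi, inner_smul_right, ← h1,
    fmulL2_embL2 (memLp_coordMoll hs j) (hasTemperateGrowth_coordMoll s j)]
  ring

theorem fourier_d (F : H1 ν) (j : Fin ν) :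
    (𝓕 (d F j) : L2 ν) =ᵐ[volume] fun ξ => tpi * (coord j ξ * (𝓕 (toL2 F) : L2 ν) ξ) := by
  have h := congrArg (fun f : L2 ν => (𝓕 f : L2 ν)) (fmulL2_moll_d F one_pos j)
  simp only [FourierTransform.fourier_smul] at h
  rw [fourier_fmulL2, fourier_fmulL2] at h
  have h1 := coeFn_mulL2 (memLp_moll (ν := ν) 1) (𝓕 (d F j))
  rw [h] at h1
  filter_upwards [h1, coeFn_mulL2 (memLp_coordMoll (ν := ν) one_pos j) (𝓕 (toL2 F)),
    Lp.coeFn_smul tpi (mulL2 (coordMoll 1 j) (𝓕 (toL2 F)))] with ξ a b c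
  have hne : moll 1 ξ ≠ 0 := Complex.ofReal_ne_zero.2 (mollR_pos 1 ξ).ne'
  apply mul_left_cancel₀ hne
  rw [← a, c, Pi.smul_apply, b, smul_eq_mul]
  ring

theorem inner_lineDeriv_of_fourier {f h : L2 ν} {j : Fin ν}
    (H : (𝓕 h : L2 ν) =ᵐ[volume] fun ξ => tpi * (coord j ξ * (𝓕 f : L2 ν) ξ)) (φ : 𝓢(X ν, ℂ)) :
    inner ℂ (embL2 (∂_{stdVec j} φ)) f = - inner ℂ (embL2 φ) h := by
  have h1 : 𝓕 (embL2 (∂_{stdVec j} φ)) = tpi • embL2 (mulS (coord j) (𝓕 φ)) := by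
    rw [lineDeriv_eq_mulF, embL2_smul, FourierTransform.fourier_smul, SchwartzMap.toLp_fourier_eq,
      SchwartzMap.fourierMultiplierCLM_apply, FourierTransform.fourier_fourierInv_eq]
  rw [← Lp.inner_fourier_eq, ← Lp.inner_fourier_eq (embL2 φ), h1, SchwartzMap.toLp_fourier_eq,
    L2.inner_def, L2.inner_def, ← integral_neg]
  apply integral_congr_ae
  filter_upwards [H, Lp.coeFn_smul tpi (embL2 (mulS (coord j) (𝓕 φ))),
    coeFn_embL2 (mulS (coord j) (𝓕 φ)), coeFn_embL2 (𝓕 φ)] with ξ a b c e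
  rw [b, Pi.smul_apply, c, a, e, SchwartzMap.smulLeftCLM_apply_apply (hasTemperateGrowth_coord j)]
  rw [RCLike.inner_apply, RCLike.inner_apply, smul_eq_mul, smul_eq_mul, map_mul, conj_tpi, map_mul,
    Complex.conj_ofReal]
  ring

theorem denseRange_of_forall_inner_eq_zero {H V : Type*} [NormedAddCommGroup H]
    [InnerProductSpace ℂ H] [CompleteSpace H] [AddCommGroup V] [Module ℂ V] {f : V → H}
    (hadd : ∀ φ ψ, f (φ + ψ) = f φ + f ψ) (hsmul : ∀ (c : ℂ) φ, f (c • φ) = c • f φ)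
    (h : ∀ F, (∀ φ, inner ℂ (f φ) F = 0) → F = 0) : DenseRange f := by
  let L : V →ₗ[ℂ] H := ⟨⟨f, hadd⟩, hsmul⟩
  have h2 : (LinearMap.range L).topologicalClosure = ⊤ := by
    rw [Submodule.topologicalClosure_eq_top_iff, Submodule.eq_bot_iff]
    exact fun F hF => h F fun φ => hF _ ⟨φ, rfl⟩
  intro F
  have h3 : F ∈ (LinearMap.range L).topologicalClosure := h2 ▸ Submodule.mem_top
  exact h3

/-- Test functions are dense in `H¹`. -/
theorem dense_of_isClosed {s : Set (H1 ν)} (hs : IsClosed s)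
    (h : ∀ φ : 𝓢(X ν, ℂ), HasCompactSupport (φ : X ν → ℂ) → ofSchwartz φ ∈ s) (F : H1 ν) :
    F ∈ s := by
  have h1 : ∀ φ : 𝓢(X ν, ℂ), ofSchwartz φ ∈ s := fun φ =>
    schwartz_induction (p := fun φ => ofSchwartz φ ∈ s) (hs.preimage continuous_ofSchwartz) h φ
  have h2 : DenseRange (ofSchwartz : 𝓢(X ν, ℂ) → H1 ν) := by
    refine denseRange_of_forall_inner_eq_zero (H := H1 ν) ofSchwartz_add ofSchwartz_smul
      fun F hF => ?_
    have hF' : ∀ φ, inner ℂ (ofSchwartz φ) F = 0 := hF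
    refine toL2_injective ?_
    change toL2 F = 0
    refine denseRange_embL2.eq_zero_of_inner_right ℂ ?_
    intro ψ
    -- This is `(1 - Δ)⁻¹ ψ`, for which the `H¹` inner product with `F` reduces to the `L²` inner
    -- product with `ψ`.
    set φ := mulF (moll (2 * Real.pi)) ψ with hφ
    have h3 := hF' φ
    rw [inner_eq, toL2_ofSchwartz] at h3
    have h4 : ∀ j, inner ℂ (d (ofSchwartz φ) j) (d F j)
        = - inner ℂ (embL2 (∂_{stdVec j} (∂_{stdVec j} φ))) (toL2 F) := fun j => by
      rw [inner_lineDeriv, neg_neg]; rfl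
    simp only [h4] at h3
    rw [Finset.sum_neg_distrib, ← sum_inner, ← sub_eq_add_neg, ← inner_sub_left] at h3
    rw [← h3]
    congr 1
    rw [← embL2_sum, ← embL2_sub]
    congr 1
    exact (sub_sum_lineDeriv_mulF_moll ψ).symm
  refine closure_minimal ?_ hs (h2 F)
  rintro _ ⟨φ, rfl⟩
  exact h1 φ

end H1

end

section

variable {ν : ℕ}

/-! ### The group of `A_u`: uniqueness and energy estimates -/

namespace IsConjGroup

variable {u : X ν → X ν} {U U' : ℝ → L2 ν →L[ℂ] L2 ν}

theorem hasDerivAt (hU : IsConjGroup u U) {f h : L2 ν} (hfh : (f, h) ∈ closure (conjGraph u))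
    (t : ℝ) : HasDerivAt (fun s => U s f) (Complex.I • U t h) t := by
  have h0 := (hU.generator f h).2 hfh
  have h1 : HasDerivAt (fun s => U (s - t) f) (Complex.I • h) t :=
    HasDerivAt.comp_sub_const t t (f := fun s => U s f) (by rwa [sub_self])
  have h2 := ((U t).restrictScalars ℝ).hasFDerivAt.comp_hasDerivAt t h1
  have h3 : (fun s => U s f) = ((U t).restrictScalars ℝ) ∘ fun s => U (s - t) f := by
    ext1 s
    change U s f = ((U t).comp (U (s - t))) f
    rw [← hU.map_add, add_sub_cancel]
  rw [h3, ← map_smul]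
  exact h2

theorem mem_closure (hU : IsConjGroup u U) {f h : L2 ν} (hfh : (f, h) ∈ closure (conjGraph u))
    (t : ℝ) : (U t f, U t h) ∈ closure (conjGraph u) := by
  rw [← hU.generator]
  have h1 : (fun s => U s (U t f)) = fun s => U (s + t) f := by
    ext1 s
    rw [hU.map_add]
    rfl
  rw [h1]
  exact HasDerivAt.comp_add_const 0 t (f := fun s => U s f) (by
    rw [zero_add]; exact hU.hasDerivAt hfh t)

end IsConjGroup

/-- The quadratic form `∫ g |𝓕 f|²`. -/
def energy (g : X ν → ℝ) (f : L2 ν) : ℝ := ∫ ξ, g ξ * ‖(𝓕 f : L2 ν) ξ‖ ^ 2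

theorem inner_ofReal_mul_self (r : ℝ) (z : ℂ) :
    inner ℂ ((r : ℂ) * z) z = ((r * ‖z‖ ^ 2 : ℝ) : ℂ) := by
  rw [RCLike.inner_apply, map_mul, Complex.conj_ofReal, mul_left_comm, Complex.mul_conj,
    Complex.normSq_eq_norm_sq, Complex.ofReal_mul]

theorem integrable_energy {g : X ν → ℝ} (hg : MemLp (fun ξ => (g ξ : ℂ)) ∞ volume) (f : L2 ν) :
    Integrable (fun ξ => g ξ * ‖(𝓕 f : L2 ν) ξ‖ ^ 2) := by
  have h := (L2.integrable_inner (𝕜 := ℂ) (mulL2 (fun ξ => (g ξ : ℂ)) (𝓕 f)) (𝓕 f)).re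
  refine h.congr ?_
  filter_upwards [coeFn_mulL2 hg (𝓕 f)] with ξ a
  rw [a, inner_ofReal_mul_self]
  exact Complex.ofReal_re _

theorem inner_fmulL2_self {g : X ν → ℝ} (hg : MemLp (fun ξ => (g ξ : ℂ)) ∞ volume) (f : L2 ν) :
    inner ℂ (fmulL2 (fun ξ => (g ξ : ℂ)) f) f = (energy g f : ℂ) := by
  rw [← Lp.inner_fourier_eq, fourier_fmulL2, L2.inner_def, energy, ← integral_complex_ofReal]
  apply integral_congr_ae
  filter_upwards [coeFn_mulL2 hg (𝓕 f)] with ξ a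
  rw [a, inner_ofReal_mul_self]

theorem norm_inner_fmulL2_le {m : X ν → ℂ} {g : X ν → ℝ} (hm : MemLp m ∞ volume)
    (hg : MemLp (fun ξ => (g ξ : ℂ)) ∞ volume) {C : ℝ} (h : ∀ ξ, ‖m ξ‖ ≤ C * g ξ) (f : L2 ν) :
    ‖inner ℂ (fmulL2 m f) f‖ ≤ C * energy g f := by
  rw [← Lp.inner_fourier_eq, fourier_fmulL2, L2.inner_def, energy, ← integral_const_mul]
  refine norm_integral_le_of_norm_le ((integrable_energy hg f).const_mul C) ?_
  filter_upwards [coeFn_mulL2 hm (𝓕 f)] with ξ a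
  rw [a, RCLike.inner_apply, map_mul, norm_mul, norm_mul, RCLike.norm_conj, RCLike.norm_conj]
  calc ‖(𝓕 f : L2 ν) ξ‖ * (‖m ξ‖ * ‖(𝓕 f : L2 ν) ξ‖) 
      = ‖m ξ‖ * ‖(𝓕 f : L2 ν) ξ‖ ^ 2 := by ring
    _ ≤ C * g ξ * ‖(𝓕 f : L2 ν) ξ‖ ^ 2 := by gcongr; exact h ξ
    _ = _ := by ring

/-- The regularised weight `(1 + |ξ|²) (1 + s² |ξ|²)⁻¹`. -/
def weightR (s : ℝ) (ξ : X ν) : ℝ := (1 + ‖ξ‖ ^ 2) * mollR s ξ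

theorem one_le_weightR {s : ℝ} (hs : s ^ 2 ≤ 1) (ξ : X ν) : 1 ≤ weightR s ξ := by
  have := mollR_pos s ξ
  calc 1 = (1 + s ^ 2 * ‖ξ‖ ^ 2) * mollR s ξ := by rw [mul_comm, mollR_mul]
    _ ≤ (1 + 1 * ‖ξ‖ ^ 2) * mollR s ξ := by gcongr
    _ = weightR s ξ := by rw [weightR, one_mul]

theorem weightR_le (s : ℝ) (ξ : X ν) : weightR s ξ ≤ 1 + ‖ξ‖ ^ 2 :=
  mul_le_of_le_one_right (by positivity) (mollR_le_one s ξ)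

theorem weight_eq {s : ℝ} (hs : s ≠ 0) :
    (fun ξ : X ν => (weightR s ξ : ℂ)) = fun ξ =>
      ((s : ℂ) ^ 2)⁻¹ + (1 - ((s : ℂ) ^ 2)⁻¹) * moll s ξ := by
  ext ξ
  have h := mollR_mul s ξ
  have h1 : weightR s ξ = (s ^ 2)⁻¹ + (1 - (s ^ 2)⁻¹) * mollR s ξ := by
    rw [weightR]
    field_simp
    linear_combination h
  rw [h1]
  push_cast
  ring

theorem hasTemperateGrowth_weight {s : ℝ} (hs : s ≠ 0) :
    (fun ξ : X ν => (weightR s ξ : ℂ)).HasTemperateGrowth := by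
  rw [weight_eq hs]
  exact (Function.HasTemperateGrowth.const _).add
    ((Function.HasTemperateGrowth.const _).mul (hasTemperateGrowth_moll s))

theorem memLp_weight {s : ℝ} (hs : s ≠ 0) :
    MemLp (fun ξ : X ν => (weightR s ξ : ℂ)) ∞ volume := by
  refine memLp_top_of_temperate (hasTemperateGrowth_weight hs)
    (C := ‖((s : ℂ) ^ 2)⁻¹‖ + ‖1 - ((s : ℂ) ^ 2)⁻¹‖ * 1) fun ξ => ?_
  rw [congrFun (weight_eq hs) ξ]
  refine (norm_add_le _ _).trans ?_
  rw [norm_mul]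
  gcongr
  exact norm_moll_le s ξ

theorem pd_weight {s : ℝ} (hs : s ≠ 0) (j : Fin ν) (ξ : X ν) :
    pd j (fun ξ => (weightR s ξ : ℂ)) ξ
      = ((2 * (1 - s ^ 2) : ℝ) : ℂ) * (coord j ξ * (moll s ξ * moll s ξ)) := by
  have hd : DifferentiableAt ℝ (moll s : X ν → ℂ) ξ :=
    (hasTemperateGrowth_moll s).1.differentiable (by simp) ξ
  have h1 : pd j (fun ξ => (weightR s ξ : ℂ)) ξ = (1 - ((s : ℂ) ^ 2)⁻¹) * pd j (moll s) ξ := by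
    rw [weight_eq hs]
    change (fderiv ℝ (fun ξ => ((s : ℂ) ^ 2)⁻¹ + (1 - ((s : ℂ) ^ 2)⁻¹) * moll s ξ) ξ) _ = _
    rw [fderiv_const_add, fderiv_const_mul hd]
    rfl
  rw [h1, pd_moll]
  have hs' : (s : ℂ) ≠ 0 := Complex.ofReal_ne_zero.2 hs
  simp only [mollA]
  push_cast
  field_simp
  ring

/-- The Poisson bracket of the regularised weight with the vector field. -/
abbrev weightD (u : X ν → X ν) (s : ℝ) : X ν → ℂ :=
  fun ξ => ∑ j, symb u j ξ * pd j (fun ξ => (weightR s ξ : ℂ)) ξ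

theorem hasTemperateGrowth_symb_mul_pd {u : X ν → X ν} (h : IsField u) {s : ℝ} (hs : s ≠ 0)
    (j : Fin ν) : (fun ξ => symb u j ξ * pd j (fun ξ => (weightR s ξ : ℂ)) ξ).HasTemperateGrowth :=
  (h.hasTemperateGrowth_symb j).mul (hasTemperateGrowth_pd (hasTemperateGrowth_weight hs) j)

/-- The gradient of the weight is at most `2 |ξ|` times the mollifier and `u` grows at most
linearly, so the product is bounded by a multiple of the weight itself, with a constant that does
not depend on `s`. -/
theorem norm_weightD_le {u : X ν → X ν} (h : IsField u) :
    ∃ C : ℝ, 0 ≤ C ∧ ∀ s : ℝ, s ≠ 0 → s ^ 2 ≤ 1 → ∀ ξ, ‖weightD u s ξ‖ ≤ C * weightR s ξ := by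
  obtain ⟨C, hC0, hC⟩ := h.norm_symb_le
  refine ⟨ν * (C * 4), by positivity, fun s hs hs1 ξ => ?_⟩
  have hm := mollR_pos s ξ
  have key : ∀ j, ‖symb u j ξ * pd j (fun ξ => (weightR s ξ : ℂ)) ξ‖ ≤ C * 4 * weightR s ξ := by
    intro j
    have e1 : ‖moll s ξ‖ = mollR s ξ := by rw [Complex.norm_real, Real.norm_of_nonneg hm.le]
    have e2 : ‖((2 * (1 - s ^ 2) : ℝ) : ℂ)‖ = 2 * (1 - s ^ 2) := by
      rw [Complex.norm_real, Real.norm_of_nonneg (by linarith)]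
    rw [pd_weight hs, norm_mul, norm_mul, norm_mul, norm_mul, e1, e2]
    calc ‖symb u j ξ‖ * (2 * (1 - s ^ 2) * (‖coord j ξ‖ * (mollR s ξ * mollR s ξ)))
        ≤ C * (1 + ‖ξ‖) * (2 * 1 * (‖ξ‖ * (mollR s ξ * 1))) := by
          have h1 : 0 ≤ 1 - s ^ 2 := by linarith
          have h2 : 1 - s ^ 2 ≤ 1 := by nlinarith [sq_nonneg s]
          have h3 := hC j ξ
          have h4 := norm_coord_le j ξ
          have h5 := mollR_le_one s ξ
          gcongr
      _ = C * (2 * ((1 + ‖ξ‖) * ‖ξ‖)) * mollR s ξ := by ring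
      _ ≤ C * (4 * (1 + ‖ξ‖ ^ 2)) * mollR s ξ := by
          have : 2 * ((1 + ‖ξ‖) * ‖ξ‖) ≤ 4 * (1 + ‖ξ‖ ^ 2) := by
            nlinarith [sq_nonneg (‖ξ‖ - 1)]
          gcongr
      _ = _ := by rw [weightR]; ring
  calc ‖weightD u s ξ‖ ≤ ∑ j : Fin ν, C * 4 * weightR s ξ :=
        norm_sum_le_of_le _ fun j _ => key j
    _ = _ := by simp; ring

theorem memLp_weightD {u : X ν → X ν} (h : IsField u) {s : ℝ} (hs : s ≠ 0) (hs1 : s ^ 2 ≤ 1) :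
    MemLp (weightD u s) ∞ volume := by
  obtain ⟨C, hC0, hC⟩ := norm_weightD_le h
  refine memLp_top_of_temperate (Function.HasTemperateGrowth.sum
    fun j _ => hasTemperateGrowth_symb_mul_pd h hs j) (C := C * (s ^ 2)⁻¹) fun ξ => ?_
  refine (hC s hs hs1 ξ).trans ?_
  gcongr
  rw [weightR]
  have hs2 : 0 < s ^ 2 := by positivity
  rw [← one_div, le_div_iff₀ hs2, mul_assoc, mul_comm (mollR s ξ), ← mul_assoc]
  exact mul_mollR_le_one s ξ (by nlinarith)

theorem inner_commutator_closure {H : Type*} [NormedAddCommGroup H] [InnerProductSpace ℂ H]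
    (B D : H →L[ℂ] H) (c : ℂ) {Γ : Set (H × H)}
    (h : ∀ p ∈ Γ, Complex.I * (inner ℂ (B p.1) p.2 - inner ℂ (B p.2) p.1)
      = c * inner ℂ (D p.1) p.1) {p : H × H} (hp : p ∈ closure Γ) :
    Complex.I * (inner ℂ (B p.1) p.2 - inner ℂ (B p.2) p.1) = c * inner ℂ (D p.1) p.1 :=
  closure_minimal (t := {p : H × H | Complex.I * (inner ℂ (B p.1) p.2 - inner ℂ (B p.2) p.1)
    = c * inner ℂ (D p.1) p.1}) h (isClosed_eq (by fun_prop) (by fun_prop)) hp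

theorem hasDerivAt_inner_commutator {H : Type*} [NormedAddCommGroup H] [InnerProductSpace ℂ H]
    (B : H →L[ℂ] H) {γ : ℝ → H} {h : H} {t : ℝ} (hγ : HasDerivAt γ (Complex.I • h) t) :
    HasDerivAt (fun t => (inner ℂ (B (γ t)) (γ t)).re)
      (Complex.I * (inner ℂ (B (γ t)) h - inner ℂ (B h) (γ t))).re t := by
  have h2 : HasDerivAt (fun t => B (γ t)) (B (Complex.I • h)) t :=
    (B.restrictScalars ℝ).hasFDerivAt.comp_hasDerivAt t hγ
  have h3 := Complex.reCLM.hasFDerivAt.comp_hasDerivAt t (h2.inner ℂ hγ)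
  refine h3.congr_deriv ?_
  rw [Complex.reCLM_apply, map_smul, inner_smul_left, inner_smul_right, Complex.conj_I]
  congr 1
  ring

/-- The commutator of `A_u` with the weight is computed on test functions. Both sides are continuous
in the graph norm, hence it holds on the whole domain of the closure and in particular along orbits
of the group. -/
theorem inner_commutator {u : X ν → X ν} (h : IsField u) {s : ℝ} (hs : s ≠ 0) (hs1 : s ^ 2 ≤ 1)
    {p : L2 ν × L2 ν} (hp : p ∈ closure (conjGraph u)) :
    Complex.I * (inner ℂ (fmulL2 (fun ξ => (weightR s ξ : ℂ)) p.1) p.2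
      - inner ℂ (fmulL2 (fun ξ => (weightR s ξ : ℂ)) p.2) p.1)
      = (1 / (2 * Real.pi) : ℂ) * inner ℂ (fmulL2 (weightD u s) p.1) p.1 := by
  refine inner_commutator_closure _ _ _ ?_ hp
  rintro _ ⟨φ, -, rfl⟩
  change Complex.I * (inner ℂ (fmulL2 _ (embL2 φ)) (embL2 (conjOp u φ))
      - inner ℂ (fmulL2 _ (embL2 (conjOp u φ))) (embL2 φ))
      = (1 / (2 * Real.pi) : ℂ) * inner ℂ (fmulL2 _ (embL2 φ)) (embL2 φ)
  have hT : (weightD u s).HasTemperateGrowth := Function.HasTemperateGrowth.sum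
    fun j _ => hasTemperateGrowth_symb_mul_pd h hs j
  rw [fmulL2_embL2 (memLp_weight hs) (hasTemperateGrowth_weight hs),
    fmulL2_embL2 (memLp_weight hs) (hasTemperateGrowth_weight hs),
    fmulL2_embL2 (memLp_weightD h hs hs1) hT, ← inner_conjOp_left h,
    conjOp_mulF h (hasTemperateGrowth_weight hs), embL2_add, inner_add_left, add_sub_cancel_left,
    embL2_smul, inner_smul_left,
    mulF_sum (m := fun j ξ => symb u j ξ * pd j (fun ξ => (weightR s ξ : ℂ)) ξ)
      (fun j => hasTemperateGrowth_symb_mul_pd h hs j)]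
  have h1 : ∀ j : Fin ν, mulF (symb u j) (mulF (pd j fun ξ => (weightR s ξ : ℂ)) φ)
      = mulF (fun ξ => symb u j ξ * pd j (fun ξ => (weightR s ξ : ℂ)) ξ) φ := fun j =>
    mulF_mulF (h.hasTemperateGrowth_symb j) (hasTemperateGrowth_pd (hasTemperateGrowth_weight hs) j) φ
  rw [Finset.sum_congr rfl fun j _ => h1 j, ← mul_assoc]
  congr 1
  simp only [cpi, map_div₀, map_mul, Complex.conj_I, Complex.conj_ofReal, map_ofNat]
  have : (Real.pi : ℂ) ≠ 0 := Complex.ofReal_ne_zero.2 Real.pi_ne_zero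
  field_simp
  rw [Complex.I_sq]
  ring

theorem continuous_energy {g : X ν → ℝ} (hg : MemLp (fun ξ => (g ξ : ℂ)) ∞ volume) :
    Continuous (energy g) := by
  have h : Continuous fun f : L2 ν => (inner ℂ (fmulL2 (fun ξ => (g ξ : ℂ)) f) f).re := by fun_prop
  refine h.congr fun f => ?_
  rw [inner_fmulL2_self hg, Complex.ofReal_re]

theorem energy_nonneg {g : X ν → ℝ} (hg : ∀ ξ, 0 ≤ g ξ) (f : L2 ν) : 0 ≤ energy g f :=
  integral_nonneg fun ξ => mul_nonneg (hg ξ) (by positivity)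

/-- Gronwall's inequality, applied for negative times to the reflected function. -/
theorem exp_bound_of_deriv {E E' : ℝ → ℝ} (hE : ∀ t, HasDerivAt E (E' t) t) (h0 : ∀ t, 0 ≤ E t)
    {C : ℝ} (hC : ∀ t, |E' t| ≤ C * E t) (t : ℝ) : E t ≤ Real.exp (C * |t|) * E 0 := by
  have key : ∀ E E' : ℝ → ℝ, (∀ t, HasDerivAt E (E' t) t) → (∀ t, 0 ≤ E t) →
      (∀ t, |E' t| ≤ C * E t) → ∀ t, 0 ≤ t → E t ≤ Real.exp (C * t) * E 0 := by
    intro E E' hE h0 hC t ht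
    have := norm_le_gronwallBound_of_norm_deriv_right_le (f := E) (f' := E') (δ := E 0) (K := C)
      (ε := 0) (a := 0) (b := t) (fun x _ => (hE x).continuousAt.continuousWithinAt)
      (fun x _ => (hE x).hasDerivWithinAt) (by rw [Real.norm_of_nonneg (h0 0)])
      (fun x _ => by rw [Real.norm_of_nonneg (h0 x), add_zero]; exact hC x) t ⟨ht, le_rfl⟩
    rw [gronwallBound_ε0, sub_zero, Real.norm_of_nonneg (h0 t)] at this
    linarith
  rcases le_total 0 t with ht | ht
  · rw [abs_of_nonneg ht]; exact key E E' hE h0 hC t ht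
  · rw [abs_of_nonpos ht]
    have := key (fun t => E (-t)) (fun t => -E' (-t)) (fun t => by
      simpa [Function.comp_def] using HasDerivAt.scomp t (hE (-t)) (hasDerivAt_neg t)) (fun t => h0 _)
      (fun t => by rw [abs_neg]; exact hC _) (-t) (by linarith)
    simpa using this

/-- Along an orbit starting at a Schwartz function the derivative of the regularised energy is the
commutator form, which is bounded by the energy; density then gives all of `L²`. The constant
depends neither on `s` nor on the group. -/
theorem IsConjGroup.energy_le {u : X ν → X ν} (h : IsField u) :
    ∃ C : ℝ, 0 ≤ C ∧ ∀ U : ℝ → L2 ν →L[ℂ] L2 ν, IsConjGroup u U → ∀ s : ℝ, s ≠ 0 → s ^ 2 ≤ 1 →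
      ∀ (t : ℝ) (f : L2 ν), energy (weightR s) (U t f) ≤ Real.exp (C * |t|) * energy (weightR s) f := by
  obtain ⟨C, hC0, hC⟩ := norm_weightD_le h
  refine ⟨1 / (2 * Real.pi) * C, by positivity, fun U hU s hs hs1 t f => ?_⟩
  have hw := memLp_weight (ν := ν) hs
  have hcl : IsClosed {f : L2 ν | energy (weightR s) (U t f)
      ≤ Real.exp (1 / (2 * Real.pi) * C * |t|) * energy (weightR s) f} :=
    isClosed_le ((continuous_energy hw).comp (U t).continuous)
      (continuous_const.mul (continuous_energy hw))
  refine (denseRange_embL2.induction_on (p := fun f => energy (weightR s) (U t f)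
      ≤ Real.exp (1 / (2 * Real.pi) * C * |t|) * energy (weightR s) f) f hcl ?_)
  intro φ
  have hφ := mem_closure_conjGraph u φ
  set E' : ℝ → ℝ := fun t => ((1 / (2 * Real.pi) : ℂ) *
    inner ℂ (fmulL2 (weightD u s) (U t (embL2 φ))) (U t (embL2 φ))).re
  have hd : ∀ t, HasDerivAt (fun t => energy (weightR s) (U t (embL2 φ))) (E' t) t := by
    intro t
    have h1 := hU.hasDerivAt hφ t
    have h7 : (fun t => energy (weightR s) (U t (embL2 φ))) = fun t =>
        (inner ℂ (fmulL2 (fun ξ : X ν => (weightR s ξ : ℂ)) (U t (embL2 φ))) (U t (embL2 φ))).re :=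
      funext fun t => by rw [inner_fmulL2_self hw, Complex.ofReal_re]
    rw [h7]
    have h3 := hasDerivAt_inner_commutator (fmulL2 (fun ξ : X ν => (weightR s ξ : ℂ))) h1
    rw [inner_commutator h hs hs1 (hU.mem_closure hφ t)] at h3
    exact h3
  have h6 := exp_bound_of_deriv hd (fun t => energy_nonneg (fun ξ =>
    zero_le_one.trans (one_le_weightR hs1 ξ)) _) (C := 1 / (2 * Real.pi) * C) (fun t => by
      refine (Complex.abs_re_le_norm _).trans ?_
      rw [norm_mul, mul_assoc]
      refine mul_le_mul (le_of_eq ?_) (norm_inner_fmulL2_le (memLp_weightD h hs hs1) hw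
        (hC s hs hs1) _) (norm_nonneg _) (by positivity)
      rw [show (1 / (2 * Real.pi) : ℂ) = ((1 / (2 * Real.pi) : ℝ) : ℂ) by push_cast; rfl,
        Complex.norm_real, Real.norm_of_nonneg (by positivity)]) t
  simpa [hU.map_zero] using h6

end

section

variable {ν : ℕ}

/-! ### The group on `H¹` -/

theorem integrable_norm_sq (f : L2 ν) : Integrable (fun x => ‖f x‖ ^ 2) :=
  (memLp_two_iff_integrable_sq_norm (Lp.aestronglyMeasurable f)).1 (Lp.memLp f)

theorem norm_sq_eq_integral (f : L2 ν) : ‖f‖ ^ 2 = ∫ x, ‖f x‖ ^ 2 := by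
  have h := inner_self_eq_norm_sq_to_K (𝕜 := ℂ) f
  have h2 : (inner ℂ f f : ℂ) = ((∫ x, ‖f x‖ ^ 2 : ℝ) : ℂ) := by
    rw [L2.inner_def, ← integral_complex_ofReal]
    refine integral_congr_ae (Eventually.of_forall fun x => ?_)
    simp
  rw [h2] at h
  have h3 := congrArg Complex.re h
  rw [Complex.ofReal_re] at h3
  rw [h3]
  exact congrArg Complex.re (Complex.ofReal_pow _ _)

theorem norm_fourier_L2 (f : L2 ν) : ‖(𝓕 f : L2 ν)‖ = ‖f‖ := Lp.norm_fourier_eq f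

theorem norm_tpi : ‖tpi‖ = 2 * Real.pi := by
  simp [tpi, abs_of_pos Real.pi_pos]

namespace H1

theorem energy_weightR_le (F : H1 ν) {s : ℝ} (hs : s ≠ 0) :
    energy (weightR s) (toL2 F) ≤ ‖F‖ ^ 2 := by
  have h1 : ‖F‖ ^ 2 = ∫ ξ, (‖(𝓕 (toL2 F) : L2 ν) ξ‖ ^ 2 + ∑ j, ‖(𝓕 (d F j) : L2 ν) ξ‖ ^ 2) := by
    rw [integral_add (integrable_norm_sq _) (integrable_finsetSum _ fun j _ => integrable_norm_sq _),
      integral_finsetSum _ fun j _ => integrable_norm_sq _, norm_sq_eq]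
    simp only [← norm_sq_eq_integral, norm_fourier_L2]
  rw [h1, energy]
  refine integral_mono_ae (integrable_energy (memLp_weight hs) _)
    ((integrable_norm_sq _).add (integrable_finsetSum _ fun j _ => integrable_norm_sq _)) ?_
  filter_upwards [ae_all_iff.2 fun j => fourier_d F j] with ξ hξ
  have h2 : ∑ j, ‖(𝓕 (d F j) : L2 ν) ξ‖ ^ 2
      = (2 * Real.pi) ^ 2 * (‖ξ‖ ^ 2 * ‖(𝓕 (toL2 F) : L2 ν) ξ‖ ^ 2) := by
    rw [EuclideanSpace.norm_sq_eq, Finset.sum_mul, Finset.mul_sum]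
    refine Finset.sum_congr rfl fun j _ => ?_
    rw [hξ j, norm_mul tpi, norm_mul (coord j ξ), norm_tpi, Complex.norm_real]
    ring
  rw [h2]
  -- The weight is `1 + |ξ|²` in the Fourier variable while `H¹` carries `1 + 4π²|ξ|²`.
  have h3 : 1 ≤ (2 * Real.pi) ^ 2 := by nlinarith [Real.pi_gt_three]
  calc weightR s ξ * ‖(𝓕 (toL2 F) : L2 ν) ξ‖ ^ 2
      ≤ (1 + ‖ξ‖ ^ 2) * ‖(𝓕 (toL2 F) : L2 ν) ξ‖ ^ 2 := by
        gcongr; exact weightR_le s ξ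
    _ = ‖(𝓕 (toL2 F) : L2 ν) ξ‖ ^ 2 + 1 * (‖ξ‖ ^ 2 * ‖(𝓕 (toL2 F) : L2 ν) ξ‖ ^ 2) := by ring
    _ ≤ _ := by gcongr

theorem exists_of_memLp_fourier {f : L2 ν} {M : ℝ} (hM : 0 ≤ M) (hf : ‖f‖ ≤ M)
    (h : ∀ j, eLpNorm (fun ξ => coord j ξ * (𝓕 f : L2 ν) ξ) 2 volume ≤ ENNReal.ofReal M) :
    ∃ F : H1 ν, toL2 F = f ∧ ‖F‖ ≤ Real.sqrt (1 + ν * (2 * Real.pi) ^ 2) * M := by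
  have hm : ∀ j, MemLp (fun ξ => coord j ξ * (𝓕 f : L2 ν) ξ) 2 volume := fun j =>
    ⟨(hasTemperateGrowth_coord j).1.continuous.aestronglyMeasurable.mul
      (Lp.aestronglyMeasurable _), (h j).trans_lt ENNReal.ofReal_lt_top⟩
  let k : Fin ν → L2 ν := fun j => 𝓕⁻ (tpi • (hm j).toLp : L2 ν)
  have hk : ∀ j, 𝓕 (k j) = tpi • (hm j).toLp := fun j =>
    FourierTransform.fourier_fourierInv_eq _
  have hk' : ∀ j, (𝓕 (k j) : L2 ν) =ᵐ[volume] fun ξ => tpi * (coord j ξ * (𝓕 f : L2 ν) ξ) := by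
    intro j
    rw [hk]
    filter_upwards [Lp.coeFn_smul tpi (hm j).toLp, (hm j).coeFn_toLp] with ξ a b
    rw [a, Pi.smul_apply, b, smul_eq_mul]
  have hkn : ∀ j, ‖k j‖ ≤ 2 * Real.pi * M := by
    intro j
    rw [← norm_fourier_L2, hk, norm_smul, norm_tpi]
    gcongr
    rw [Lp.norm_toLp]
    exact ENNReal.toReal_le_of_le_ofReal hM (h j)
  refine ⟨mk f k fun j φ => inner_lineDeriv_of_fourier (hk' j) φ, rfl, ?_⟩
  refine le_of_sq_le_sq ?_ (by positivity)
  rw [norm_sq_eq, mul_pow, Real.sq_sqrt (by positivity)]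
  calc ‖f‖ ^ 2 + ∑ j, ‖k j‖ ^ 2 ≤ M ^ 2 + ∑ j : Fin ν, (2 * Real.pi * M) ^ 2 := by
        gcongr with j
        exact hkn j
    _ = _ := by simp; ring

/-- The bounded weights increase to `1 + |ξ|²` as `s → 0`; Fatou's lemma for `ξ_j (1 + s²|ξ|²)⁻¹ 𝓕f`
shows that `ξ_j 𝓕f` is square integrable. -/
theorem exists_of_energy_le {f : L2 ν} {M : ℝ} (hM : 0 ≤ M)
    (h : ∀ n : ℕ, energy (weightR (1 / ((n : ℝ) + 1))) f ≤ M ^ 2) :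
    ∃ F : H1 ν, toL2 F = f ∧ ‖F‖ ≤ Real.sqrt (1 + ν * (2 * Real.pi) ^ 2) * M := by
  set s : ℕ → ℝ := fun n => 1 / ((n : ℝ) + 1) with hs
  have hs0 : ∀ n, 0 < s n := fun n => by positivity
  have hs1 : ∀ n, s n ^ 2 ≤ 1 := fun n => by
    have : s n ≤ 1 := (div_le_one (by positivity)).2 (by linarith [(Nat.cast_nonneg n : (0 : ℝ) ≤ n)])
    nlinarith [hs0 n]
  refine exists_of_memLp_fourier hM ?_ fun j => ?_
  · refine le_of_sq_le_sq ((le_trans ?_ (h 0))) hM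
    rw [← norm_fourier_L2, norm_sq_eq_integral, energy]
    refine integral_mono (integrable_norm_sq _) (integrable_energy (memLp_weight (hs0 0).ne') f)
      fun ξ => ?_
    exact le_mul_of_one_le_left (by positivity) (one_le_weightR (hs1 0) ξ)
  · have hlim : ∀ᵐ ξ, Tendsto (fun n => (mulL2 (coordMoll (s n) j) (𝓕 f)) ξ) atTop
        (𝓝 (coord j ξ * (𝓕 f : L2 ν) ξ)) := by
      filter_upwards [ae_all_iff.2 fun n => coeFn_mulL2 (memLp_coordMoll (hs0 n) j) (𝓕 f)] with ξ hξ
      simp only [hξ]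
      have := ((tendsto_moll tendsto_one_div_add_atTop_nhds_zero_nat ξ).const_mul
        (coord j ξ)).mul_const ((𝓕 f : L2 ν) ξ)
      rwa [mul_one] at this
    refine (Lp.eLpNorm_lim_le_liminf_eLpNorm (fun n => Lp.aestronglyMeasurable _) _ hlim).trans ?_
    refine liminf_le_of_le (by isBoundedDefault) fun b hb => ?_
    obtain ⟨n, hn⟩ := hb.exists
    refine hn.trans ?_
    rw [← Lp.enorm_def, ← ofReal_norm]
    refine ENNReal.ofReal_le_ofReal (le_of_sq_le_sq (le_trans ?_ (h n)) hM)
    rw [norm_sq_eq_integral, energy]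
    refine integral_mono_ae (integrable_norm_sq _)
      (integrable_energy (memLp_weight (hs0 n).ne') f) ?_
    filter_upwards [coeFn_mulL2 (memLp_coordMoll (hs0 n) j) (𝓕 f)] with ξ hξ
    rw [hξ, norm_mul, mul_pow]
    gcongr
    have h1 := mollR_pos (s n) ξ
    have h2 := mollR_le_one (s n) ξ
    rw [norm_mul, Complex.norm_real (mollR (s n) ξ), Real.norm_of_nonneg h1.le, mul_pow, weightR]
    calc ‖coord j ξ‖ ^ 2 * mollR (s n) ξ ^ 2 ≤ ‖ξ‖ ^ 2 * (mollR (s n) ξ * 1) := by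
          rw [pow_two (mollR (s n) ξ)]
          have := norm_coord_le j ξ
          gcongr
      _ ≤ (1 + ‖ξ‖ ^ 2) * mollR (s n) ξ := by nlinarith

end H1

theorem IsConjGroup.exists_H1 {u : X ν → X ν} (h : IsField u) :
    ∃ K C : ℝ, ∀ U : ℝ → L2 ν →L[ℂ] L2 ν, IsConjGroup u U → ∃ W : ℝ → H1 ν →L[ℂ] H1 ν,
      (∀ t F, H1.toL2 (W t F) = U t (H1.toL2 F)) ∧ ∀ t, ‖W t‖ ≤ K * Real.exp (C * |t|) := by
  obtain ⟨C, hC0, hC⟩ := IsConjGroup.energy_le h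
  -- The first constant compares the two normalisations of the `H¹` norm; the rate is halved because
  -- the energy is quadratic.
  refine ⟨Real.sqrt (1 + ν * (2 * Real.pi) ^ 2), C / 2, fun U hU => ?_⟩
  have hex : ∀ t F, ∃ G : H1 ν, H1.toL2 G = U t (H1.toL2 F) ∧
      ‖G‖ ≤ Real.sqrt (1 + ν * (2 * Real.pi) ^ 2) * Real.exp (C / 2 * |t|) * ‖F‖ := by
    intro t F
    obtain ⟨G, hG, hG'⟩ := H1.exists_of_energy_le (f := U t (H1.toL2 F))
      (M := Real.exp (C / 2 * |t|) * ‖F‖) (by positivity) (fun n => by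
        have hn : (0 : ℝ) < 1 / ((n : ℝ) + 1) := by positivity
        have hn1 : 1 / ((n : ℝ) + 1) ≤ 1 :=
          (div_le_one (by positivity)).2 (by linarith [(Nat.cast_nonneg n : (0 : ℝ) ≤ n)])
        refine (hC U hU _ hn.ne' (by nlinarith) t _).trans ?_
        rw [mul_pow, ← Real.exp_nat_mul]
        have : ((2 : ℕ) : ℝ) * (C / 2 * |t|) = C * |t| := by push_cast; ring
        rw [this]
        gcongr
        exact H1.energy_weightR_le F hn.ne')
    exact ⟨G, hG, by rwa [mul_assoc]⟩
  choose W hW hWn using hex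
  refine ⟨fun t => LinearMap.mkContinuous ⟨⟨W t, fun F G => H1.toL2_injective ?_⟩,
    fun c F => H1.toL2_injective ?_⟩ _ (hWn t), hW, fun t =>
      LinearMap.mkContinuous_norm_le _ (by positivity) _⟩
  · rw [hW]
    change _ = H1.toL2 (W t F) + H1.toL2 (W t G)
    rw [hW, hW]
    exact (U t).map_add _ _
  · rw [hW]
    change _ = c • H1.toL2 (W t F)
    rw [hW]
    exact (U t).map_smul _ _

theorem exists_isConjGroupH1 {u : X ν → X ν} (h : IsField u) :
    ∃ W : ℝ → H1 ν →L[ℂ] H1 ν, IsConjGroupH1 u W := by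
  obtain ⟨K, C, hKC⟩ := IsConjGroup.exists_H1 h
  obtain ⟨U, hU⟩ := exists_isConjGroup h
  obtain ⟨W, hW, -⟩ := hKC U hU
  exact ⟨W, U, hU, hW⟩

/-- Every realisation on `H¹` is determined by its group on `L²`, as the inclusion is injective, so
it inherits the bound of the constructed one. -/
theorem IsConjGroupH1.norm_le {u : X ν → X ν} (h : IsField u) :
    ∃ K C : ℝ, ∀ W : ℝ → H1 ν →L[ℂ] H1 ν, IsConjGroupH1 u W → ∀ t,
      ‖W t‖ ≤ K * Real.exp (C * |t|) := by
  obtain ⟨K, C, hKC⟩ := IsConjGroup.exists_H1 h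
  refine ⟨K, C, ?_⟩
  rintro W ⟨U, hU, hW⟩ t
  obtain ⟨W', hW', hn⟩ := hKC U hU
  have : W t = W' t := by
    ext1 F
    exact H1.toL2_injective (by rw [hW, hW'])
  rw [this]
  exact hn t

end

section

variable {ν : ℕ}

/-! ### Weak smoothness implies smoothness -/

section WeakSmoothness

variable {E : Type*} [NormedAddCommGroup E] [NormedSpace ℝ E] [CompleteSpace E] {ι : Type*}
  {lam : ι → E →L[ℝ] ℂ} {w : ι → ℝ}

theorem norm_sub_sub_smul_le {f f' f'' : ℝ → ℂ} (h : ∀ t, HasDerivAt f (f' t) t)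
    (h' : ∀ t, HasDerivAt f' (f'' t) t) {t s M : ℝ} (hs : |s| ≤ 1)
    (hM : ∀ r, |r| ≤ |t| + 1 → ‖f'' r‖ ≤ M) :
    ‖f (t + s) - f t - s • f' t‖ ≤ M * |s| * |s| := by
  have hball : ∀ r ∈ Metric.closedBall t |s|, |r| ≤ |t| + 1 := by
    intro r hr
    rw [Metric.mem_closedBall, Real.dist_eq] at hr
    have := abs_sub_abs_le_abs_sub r t
    linarith
  have hts : t + s ∈ Metric.closedBall t |s| := by simp
  have htt : t ∈ Metric.closedBall t |s| := by simp
  have h1 : ∀ r ∈ Metric.closedBall t |s|, ‖f' r - f' t‖ ≤ M * |s| := by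
    intro r hr
    have h2 := (convex_closedBall t |s|).norm_image_sub_le_of_norm_hasDerivWithin_le (f := f')
      (f' := f'') (fun x _ => (h' x).hasDerivWithinAt) (fun x hx => hM x (hball x hx)) htt hr
    refine h2.trans ?_
    have hM0 : 0 ≤ M := (norm_nonneg _).trans (hM t (by linarith))
    gcongr
    rwa [Metric.mem_closedBall, Real.dist_eq] at hr
  have h3 := (convex_closedBall t |s|).norm_image_sub_le_of_norm_hasDerivWithin_le
    (f := fun r => f r - (r - t) • f' t) (f' := fun r => f' r - f' t)
    (fun x _ => by
      have h4 := ((h x).sub (((hasDerivAt_id x).sub_const t).smul_const (f' t))).hasDerivWithinAt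
        (s := Metric.closedBall t |s|)
      rwa [one_smul] at h4) h1 htt hts
  simpa [sub_right_comm] using h3

/-- By Taylor's formula, the bound on second derivatives makes the weak difference quotients
converge at rate `O(|s|)` uniformly over the norming family; hence the quotients of `γ` are Cauchy
in norm. -/
theorem exists_hasDerivAt_of_weak
    (hnorm : ∀ (x : E) (M : ℝ), 0 ≤ M → (∀ i, ‖lam i x‖ ≤ M * w i) → ‖x‖ ≤ M)
    {γ : ℝ → E} {l : ℕ → ι → ℝ → ℂ} (h0 : ∀ i t, l 0 i t = lam i (γ t))
    (hd : ∀ n i t, HasDerivAt (l n i) (l (n + 1) i t) t)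
    (hb : ∀ (n : ℕ) (R : ℝ), ∃ M, 0 ≤ M ∧ ∀ i t, |t| ≤ R → ‖l n i t‖ ≤ M * w i) :
    ∃ γ' : ℝ → E, (∀ t, HasDerivAt γ (γ' t) t) ∧ ∀ i t, l 1 i t = lam i (γ' t) := by
  have key : ∀ t, ∃ y, HasDerivAt γ y t := by
    intro t
    obtain ⟨M, hM0, hM⟩ := hb 2 (|t| + 1)
    have hq : ∀ s : ℝ, s ≠ 0 → |s| ≤ 1 → ∀ i,
        ‖lam i (s⁻¹ • (γ (t + s) - γ t)) - l 1 i t‖ ≤ M * |s| * w i := by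
      intro s hs hs1 i
      have h1 := norm_sub_sub_smul_le (hd 0 i) (hd 1 i) hs1 (fun r hr => hM i r hr)
      have h2 : lam i (s⁻¹ • (γ (t + s) - γ t)) - l 1 i t
          = s⁻¹ • (l 0 i (t + s) - l 0 i t - s • l 1 i t) := by
        rw [h0, h0, map_smul, map_sub, smul_sub _ _ (s • l 1 i t), smul_smul, inv_mul_cancel₀ hs,
          one_smul]
      rw [h2, norm_smul, norm_inv, Real.norm_eq_abs, inv_mul_le_iff₀ (abs_pos.2 hs)]
      refine h1.trans (le_of_eq ?_)
      ring
    have hc : Cauchy (map (fun s : ℝ => s⁻¹ • (γ (t + s) - γ t)) (𝓝[≠] 0)) := by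
      rw [Metric.cauchy_iff]
      refine ⟨inferInstance, fun ε hε => ?_⟩
      set δ := min 1 (ε / (2 * (M + 1))) with hδ
      have hδ0 : 0 < δ := lt_min one_pos (by positivity)
      refine ⟨_, image_mem_map (s := {s : ℝ | s ≠ 0 ∧ |s| < δ}) ?_, ?_⟩
      · rw [mem_nhdsWithin_iff_exists_mem_nhds_inter]
        refine ⟨Metric.ball 0 δ, Metric.ball_mem_nhds _ hδ0, ?_⟩
        rintro s ⟨hs, hs'⟩
        exact ⟨hs', by simpa using hs⟩
      · rintro _ ⟨s, ⟨hs, hsδ⟩, rfl⟩ _ ⟨r, ⟨hr, hrδ⟩, rfl⟩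
        rw [dist_eq_norm]
        have h1 : ‖s⁻¹ • (γ (t + s) - γ t) - r⁻¹ • (γ (t + r) - γ t)‖ ≤ M * |s| + M * |r| := by
          refine hnorm _ _ (by positivity) fun i => ?_
          have e1 := hq s hs (hsδ.le.trans (min_le_left _ _)) i
          have e2 := hq r hr (hrδ.le.trans (min_le_left _ _)) i
          rw [map_sub, ← sub_sub_sub_cancel_right _ _ (l 1 i t), add_mul]
          exact (norm_sub_le _ _).trans (add_le_add e1 e2)
        have h3 : δ ≤ ε / (2 * (M + 1)) := min_le_right _ _
        rw [le_div_iff₀ (by positivity)] at h3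
        nlinarith [abs_nonneg s, abs_nonneg r]
    obtain ⟨y, hy⟩ := CompleteSpace.complete hc
    exact ⟨y, hasDerivAt_iff_tendsto_slope_zero.2 hy⟩
  choose γ' hγ' using key
  refine ⟨γ', hγ', fun i t => ?_⟩
  have h1 := (lam i).hasFDerivAt.comp_hasDerivAt t (hγ' t)
  have h2 : l 0 i = lam i ∘ γ := funext fun t => h0 i t
  have h3 := hd 0 i t
  rw [h2] at h3
  exact h3.unique h1

/-- If a curve is smooth when tested against a norming family of functionals, with locally uniform
bounds, then it is smooth. -/
theorem contDiff_of_weak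
    (hnorm : ∀ (x : E) (M : ℝ), 0 ≤ M → (∀ i, ‖lam i x‖ ≤ M * w i) → ‖x‖ ≤ M)
    {γ : ℝ → E} {l : ℕ → ι → ℝ → ℂ} (h0 : ∀ i t, l 0 i t = lam i (γ t))
    (hd : ∀ n i t, HasDerivAt (l n i) (l (n + 1) i t) t)
    (hb : ∀ (n : ℕ) (R : ℝ), ∃ M, 0 ≤ M ∧ ∀ i t, |t| ≤ R → ‖l n i t‖ ≤ M * w i) :
    ContDiff ℝ ∞ γ := by
  rw [contDiff_infty]
  intro m
  induction m generalizing γ l with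
  | zero =>
    obtain ⟨γ', h, -⟩ := exists_hasDerivAt_of_weak hnorm h0 hd hb
    exact contDiff_zero.2 (continuous_iff_continuousAt.2 fun t => (h t).continuousAt)
  | succ m ih =>
    obtain ⟨γ', h, h'⟩ := exists_hasDerivAt_of_weak hnorm h0 hd hb
    have h1 : deriv γ = γ' := funext fun t => (h t).deriv
    -- The derivative satisfies the same hypotheses with the family of weak derivatives shifted by
    -- one.
    have h2 := ih (γ := γ') (l := fun n => l (n + 1)) h' (fun n => hd (n + 1)) fun n => hb (n + 1)
    push_cast
    rw [contDiff_succ_iff_deriv]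
    exact ⟨fun t => (h t).differentiableAt, by simp, by rwa [h1]⟩

end WeakSmoothness

/-! ### Bounded symbols and weighted norms -/

/-- Smooth functions that are bounded with all their derivatives. -/
structure IsBddSymbol (c : X ν → ℂ) : Prop where
  smooth : ContDiff ℝ ∞ c
  bounded : ∀ n : ℕ, ∃ C : ℝ, ∀ x, ‖iteratedFDeriv ℝ n c x‖ ≤ C

namespace IsBddSymbol

theorem hasTemperateGrowth {c : X ν → ℂ} (hc : IsBddSymbol c) : c.HasTemperateGrowth :=
  ⟨hc.smooth, fun n => by
    obtain ⟨C, hC⟩ := hc.bounded n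
    exact ⟨0, C, fun x => by simpa using hC x⟩⟩

theorem pd {c : X ν → ℂ} (hc : IsBddSymbol c) (j : Fin ν) : IsBddSymbol (pd j c) where
  smooth := (hasTemperateGrowth_pd hc.hasTemperateGrowth j).1
  bounded := by
    intro n
    obtain ⟨C, hC⟩ := hc.bounded (n + 1)
    refine ⟨‖ContinuousLinearMap.apply ℝ ℂ (stdVec j)‖ * C, fun x => ?_⟩
    have h1 : ContDiff ℝ n (fderiv ℝ c) :=
      hc.smooth.fderiv_right (by exact_mod_cast le_top)
    have h2 := (ContinuousLinearMap.apply ℝ ℂ (stdVec j)).norm_iteratedFDeriv_comp_left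
      (f := fderiv ℝ c) (x := x) (n := n) h1.contDiffAt le_rfl
    refine h2.trans ?_
    rw [norm_iteratedFDeriv_fderiv]
    gcongr
    exact hC x

theorem norm_le {c : X ν → ℂ} (hc : IsBddSymbol c) : ∃ C : ℝ, 0 ≤ C ∧ ∀ x, ‖c x‖ ≤ C := by
  obtain ⟨C, hC⟩ := hc.bounded 0
  refine ⟨C, (norm_nonneg _).trans (hC 0), fun x => ?_⟩
  simpa using hC x

theorem norm_mulF_le {c : X ν → ℂ} (hc : IsBddSymbol c) :
    ∃ C : ℝ, 0 ≤ C ∧ ∀ φ : 𝓢(X ν, ℂ), ‖embL2 (mulF c φ)‖ ≤ C * ‖embL2 φ‖ := by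
  obtain ⟨C, hC0, hC⟩ := hc.norm_le
  refine ⟨C, hC0, fun φ => ?_⟩
  have hm := memLp_top_of_temperate hc.hasTemperateGrowth hC
  rw [← fmulL2_embL2 hm hc.hasTemperateGrowth]
  exact norm_fmulL2_apply_le hm hC _

end IsBddSymbol

theorem IsAdmissible.isBddSymbol {u : X ν → X ν} (h : IsAdmissible u) (j : Fin ν) :
    IsBddSymbol (symb u j) where
  smooth := (h.isField.hasTemperateGrowth_symb j).1
  bounded := by
    intro n
    obtain ⟨C, hC⟩ := h.bounded n
    refine ⟨‖coordC (ν := ν) j‖ * (|2 * Real.pi| ^ n * C), fun x => ?_⟩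
    have hs : ContDiff ℝ n u := h.smooth.of_le (by exact_mod_cast le_top)
    have h2 := (coordC j).norm_iteratedFDeriv_comp_left
      (f := fun ξ => u ((2 * Real.pi) • ξ)) (x := x) (n := n)
      (hs.comp (contDiff_const_smul _)).contDiffAt le_rfl
    refine h2.trans ?_
    gcongr
    rw [congrFun (iteratedFDeriv_comp_const_smul (i := n) (2 * Real.pi) hs) x, norm_smul, norm_pow,
      Real.norm_eq_abs]
    gcongr
    exact hC _

/-- The norm `∑ ‖x^α φ‖` over `|α| ≤ k` (with multiplicities). -/
def wnorm : ℕ → 𝓢(X ν, ℂ) → ℝ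
  | 0, φ => ‖embL2 φ‖
  | k + 1, φ => wnorm k φ + ∑ j, wnorm k (mulS (coord j) φ)

theorem wnorm_nonneg (k : ℕ) (φ : 𝓢(X ν, ℂ)) : 0 ≤ wnorm k φ := by
  induction k generalizing φ with
  | zero => exact norm_nonneg _
  | succ k ih => exact add_nonneg (ih φ) (Finset.sum_nonneg fun j _ => ih _)

theorem wnorm_add_le (k : ℕ) (φ ψ : 𝓢(X ν, ℂ)) : wnorm k (φ + ψ) ≤ wnorm k φ + wnorm k ψ := by
  induction k generalizing φ ψ with
  | zero => rw [wnorm, embL2_add]; exact norm_add_le _ _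
  | succ k ih =>
    have h1 : ∑ j, wnorm k (mulS (coord j) (φ + ψ))
        ≤ ∑ j, wnorm k (mulS (coord j) φ) + ∑ j, wnorm k (mulS (coord j) ψ) := by
      rw [← Finset.sum_add_distrib]
      refine Finset.sum_le_sum fun j _ => ?_
      rw [map_add]
      exact ih _ _
    have h2 := ih φ ψ
    simp only [wnorm]
    linarith

theorem wnorm_smul (k : ℕ) (c : ℂ) (φ : 𝓢(X ν, ℂ)) : wnorm k (c • φ) = ‖c‖ * wnorm k φ := by
  induction k generalizing φ with
  | zero => rw [wnorm, embL2_smul, norm_smul]; rfl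
  | succ k ih =>
    simp only [wnorm, map_smul, ih]
    rw [mul_add, Finset.mul_sum]

theorem wnorm_zero (k : ℕ) : wnorm k (0 : 𝓢(X ν, ℂ)) = 0 := by
  have := wnorm_smul k 0 (0 : 𝓢(X ν, ℂ))
  simpa using this

theorem wnorm_sum_le (k : ℕ) (s : Finset (Fin ν)) (φ : Fin ν → 𝓢(X ν, ℂ)) :
    wnorm k (∑ j ∈ s, φ j) ≤ ∑ j ∈ s, wnorm k (φ j) := by
  classical
  induction s using Finset.induction_on with
  | empty => simp [wnorm_zero]
  | insert a s ha ih =>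
    rw [Finset.sum_insert ha, Finset.sum_insert ha]
    exact (wnorm_add_le _ _ _).trans (by linarith)

theorem wnorm_le_succ (k : ℕ) (φ : 𝓢(X ν, ℂ)) : wnorm k φ ≤ wnorm (k + 1) φ :=
  le_add_of_nonneg_right (Finset.sum_nonneg fun _ _ => wnorm_nonneg _ _)

theorem wnorm_coord_le (k : ℕ) (j : Fin ν) (φ : 𝓢(X ν, ℂ)) :
    wnorm k (mulS (coord j) φ) ≤ wnorm (k + 1) φ :=
  (Finset.single_le_sum (f := fun j => wnorm k (mulS (coord j) φ)) (fun _ _ => wnorm_nonneg _ _)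
    (Finset.mem_univ j)).trans (le_add_of_nonneg_left (wnorm_nonneg _ _))

/-- Each coordinate is commuted through the multiplier; the commutator is again a bounded symbol and
carries one weight less, which suits the induction. -/
theorem wnorm_mulF_le (k : ℕ) {c : X ν → ℂ} (hc : IsBddSymbol c) :
    ∃ C : ℝ, 0 ≤ C ∧ ∀ φ : 𝓢(X ν, ℂ), wnorm k (mulF c φ) ≤ C * wnorm k φ := by
  induction k generalizing c with
  | zero => exact hc.norm_mulF_le
  | succ k ih =>
    obtain ⟨C, hC0, hC⟩ := ih hc
    choose D hD0 hD using fun j => ih (hc.pd j)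
    refine ⟨C + ∑ j, ‖cpi‖ * D j,
      add_nonneg hC0 (Finset.sum_nonneg fun j _ => mul_nonneg (norm_nonneg _) (hD0 j)), fun φ => ?_⟩
    have h1 : ∀ j, wnorm k (mulS (coord j) (mulF c φ))
        ≤ C * wnorm k (mulS (coord j) φ) + ‖cpi‖ * D j * wnorm k φ := by
      intro j
      rw [mulS_coord_mulF hc.hasTemperateGrowth, mul_assoc]
      refine (wnorm_add_le _ _ _).trans (add_le_add (hC _) ?_)
      rw [wnorm_smul]
      gcongr
      exact hD j φ
    have h2 := Finset.sum_le_sum fun j (_ : j ∈ Finset.univ) => h1 j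
    rw [Finset.sum_add_distrib, ← Finset.mul_sum, ← Finset.sum_mul] at h2
    have h3 := hC φ
    have h4 : 0 ≤ (∑ j, ‖cpi‖ * D j) * ∑ j, wnorm k (mulS (coord j) φ) :=
      mul_nonneg (Finset.sum_nonneg fun j _ => mul_nonneg (norm_nonneg _) (hD0 j))
        (Finset.sum_nonneg fun _ _ => wnorm_nonneg _ _)
    simp only [wnorm]
    nlinarith

/-- Here boundedness of `u` itself matters: `A_u` costs one power of `x` and no derivative. For
dilations it would cost a derivative as well. -/
theorem wnorm_conjOp_le {u : X ν → X ν} (h : IsAdmissible u) (k : ℕ) :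
    ∃ C : ℝ, 0 ≤ C ∧ ∀ φ : 𝓢(X ν, ℂ), wnorm k (conjOp u φ) ≤ C * wnorm (k + 1) φ := by
  choose C hC0 hC using fun j => wnorm_mulF_le k (h.isBddSymbol j)
  choose D hD0 hD using fun j => wnorm_mulF_le k ((h.isBddSymbol j).pd j)
  refine ⟨∑ j, (C j + ‖cpi / 2‖ * D j), Finset.sum_nonneg fun j _ =>
    add_nonneg (hC0 j) (mul_nonneg (norm_nonneg _) (hD0 j)), fun φ => ?_⟩
  rw [conjOp_eq_left h.isField, Finset.sum_mul]
  refine (wnorm_sum_le _ _ _).trans (Finset.sum_le_sum fun j _ => (wnorm_add_le _ _ _).trans ?_)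
  rw [wnorm_smul, add_mul, mul_assoc]
  have h1 := wnorm_coord_le k j φ
  have h2 := wnorm_le_succ k φ
  refine add_le_add ((hC j _).trans ?_) ?_
  · have := hC0 j; gcongr
  · refine mul_le_mul_of_nonneg_left ((hD j _).trans ?_) (norm_nonneg _)
    have := hD0 j; gcongr

theorem wnorm_iterate_conjOp_le {u : X ν → X ν} (h : IsAdmissible u) (n k : ℕ) :
    ∃ C : ℝ, 0 ≤ C ∧ ∀ φ : 𝓢(X ν, ℂ), wnorm k ((conjOp u)^[n] φ) ≤ C * wnorm (k + n) φ := by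
  induction n with
  | zero => exact ⟨1, zero_le_one, fun φ => by simp⟩
  | succ n ih =>
    obtain ⟨C, hC0, hC⟩ := ih
    obtain ⟨D, hD0, hD⟩ := wnorm_conjOp_le h (k + n)
    refine ⟨C * D, by positivity, fun φ => ?_⟩
    rw [Function.iterate_succ_apply, mul_assoc]
    exact (hC _).trans (by gcongr; exact hD φ)

end

section

variable {ν : ℕ}

/-! ### Multiplication by decaying functions along the flow -/

/-- Smooth real functions that decay faster than any power (no condition on the derivatives). -/
structure IsDecaying (g : X ν → ℝ) : Prop where
  smooth : ContDiff ℝ ∞ g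
  decay : ∀ k : ℕ, ∃ C : ℝ, ∀ x, ‖x‖ ^ k * |g x| ≤ C

namespace IsDecaying

theorem coord_mul {g : X ν → ℝ} (hg : IsDecaying g) (j : Fin ν) :
    IsDecaying (fun x => x j * g x) where
  smooth := (EuclideanSpace.proj j : X ν →L[ℝ] ℝ).contDiff.mul hg.smooth
  decay := by
    intro k
    obtain ⟨C, hC⟩ := hg.decay (k + 1)
    refine ⟨C, fun x => le_trans ?_ (hC x)⟩
    have h1 : |x j| ≤ ‖x‖ := by simpa using PiLp.norm_apply_le x j
    rw [abs_mul, pow_succ, mul_assoc]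
    gcongr

theorem norm_le {g : X ν → ℝ} (hg : IsDecaying g) :
    ∃ C : ℝ, 0 ≤ C ∧ ∀ x, ‖(g x : ℂ)‖ ≤ C := by
  obtain ⟨C, hC⟩ := hg.decay 0
  have h : ∀ x, ‖(g x : ℂ)‖ ≤ C := fun x => by simpa using hC x
  exact ⟨C, (norm_nonneg _).trans (h 0), h⟩

theorem memLp {g : X ν → ℝ} (hg : IsDecaying g) :
    MemLp (fun x => (g x : ℂ)) ∞ (volume : Measure (X ν)) := by
  obtain ⟨C, -, hC⟩ := hg.norm_le
  exact memLp_top_of_continuous (Complex.continuous_ofReal.comp hg.smooth.continuous) hC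

end IsDecaying

/-- The product of a smooth function and a test function. -/
def testMul (g : X ν → ℝ) (hg : ContDiff ℝ ∞ g) (φ : 𝓢(X ν, ℂ))
    (hφ : HasCompactSupport (φ : X ν → ℂ)) : 𝓢(X ν, ℂ) :=
  HasCompactSupport.toSchwartzMap (f := fun x => (g x : ℂ) * φ x) hφ.mul_left
    ((Complex.ofRealCLM.contDiff.comp hg).mul (φ.smooth _))

@[simp]
theorem testMul_apply (g : X ν → ℝ) (hg : ContDiff ℝ ∞ g) (φ : 𝓢(X ν, ℂ))
    (hφ : HasCompactSupport (φ : X ν → ℂ)) (x : X ν) : testMul g hg φ hφ x = (g x : ℂ) * φ x := rfl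

theorem hasCompactSupport_testMul {g : X ν → ℝ} (hg : ContDiff ℝ ∞ g) {φ : 𝓢(X ν, ℂ)}
    (hφ : HasCompactSupport (φ : X ν → ℂ)) : HasCompactSupport (testMul g hg φ hφ : X ν → ℂ) :=
  hφ.mul_left (f := fun x => (g x : ℂ))

theorem embL2_testMul {g : X ν → ℝ} (hg : ContDiff ℝ ∞ g)
    (hm : MemLp (fun x => (g x : ℂ)) ∞ (volume : Measure (X ν))) {φ : 𝓢(X ν, ℂ)}
    (hφ : HasCompactSupport (φ : X ν → ℂ)) :
    embL2 (testMul g hg φ hφ) = mulL2 (fun x => (g x : ℂ)) (embL2 φ) := by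
  apply Lp.ext
  filter_upwards [coeFn_mulL2 hm (embL2 φ), coeFn_embL2 φ, coeFn_embL2 (testMul g hg φ hφ)]
    with x a b c
  rw [a, b, c, testMul_apply]

/-- Coordinates act on the product merely by multiplying `g`, and `x_j g` decays as `g` does. No
derivative of `g` enters, which is what makes the rapidly oscillating coefficients harmless. -/
theorem IsDecaying.wnorm_testMul_le (k : ℕ) {g : X ν → ℝ} (hg : IsDecaying g) :
    ∃ C : ℝ, 0 ≤ C ∧ ∀ (φ : 𝓢(X ν, ℂ)) (hφ : HasCompactSupport (φ : X ν → ℂ)),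
      wnorm k (testMul g hg.smooth φ hφ) ≤ C * ‖embL2 φ‖ := by
  induction k generalizing g with
  | zero =>
    obtain ⟨C, hC0, hC⟩ := hg.norm_le
    refine ⟨C, hC0, fun φ hφ => ?_⟩
    rw [wnorm, embL2_testMul hg.smooth hg.memLp]
    exact norm_mulL2_apply_le hg.memLp hC _
  | succ k ih =>
    obtain ⟨C, hC0, hC⟩ := ih hg
    choose D hD0 hD using fun j => ih (hg.coord_mul j)
    refine ⟨C + ∑ j, D j, add_nonneg hC0 (Finset.sum_nonneg fun j _ => hD0 j), fun φ hφ => ?_⟩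
    rw [wnorm, add_mul, Finset.sum_mul]
    refine add_le_add (hC φ hφ) (Finset.sum_le_sum fun j _ => ?_)
    have h1 : mulS (coord j) (testMul g hg.smooth φ hφ)
        = testMul (fun x => x j * g x) (hg.coord_mul j).smooth φ hφ := by
      ext x
      rw [SchwartzMap.smulLeftCLM_apply_apply (hasTemperateGrowth_coord j), testMul_apply,
        testMul_apply, smul_eq_mul]
      push_cast
      ring
    rw [h1]
    exact hD j φ hφ

theorem norm_le_of_test {x : L2 ν} {M : ℝ} (hM : 0 ≤ M)
    (h : ∀ φ : 𝓢(X ν, ℂ), HasCompactSupport (φ : X ν → ℂ) → ‖inner ℂ (embL2 φ) x‖ ≤ M * ‖embL2 φ‖) :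
    ‖x‖ ≤ M := by
  have h1 : ∀ φ : 𝓢(X ν, ℂ), ‖inner ℂ (embL2 φ) x‖ ≤ M * ‖embL2 φ‖ := fun φ => by
    refine schwartz_induction (p := fun φ => ‖inner ℂ (embL2 φ) x‖ ≤ M * ‖embL2 φ‖) ?_ h φ
    have hc : IsClosed {f : L2 ν | ‖inner ℂ f x‖ ≤ M * ‖f‖} :=
      isClosed_le (by fun_prop) (by fun_prop)
    exact hc.preimage continuous_embL2
  have h2 : ‖inner ℂ x x‖ ≤ M * ‖x‖ := by
    refine denseRange_embL2.induction_on (p := fun f => ‖inner ℂ f x‖ ≤ M * ‖f‖) x ?_ h1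
    exact isClosed_le (by fun_prop) (by fun_prop)
  rw [inner_self_eq_norm_sq_to_K, norm_pow, RCLike.norm_ofReal, abs_norm] at h2
  rcases (norm_nonneg x).eq_or_lt with h0 | h0
  · rwa [← h0]
  · nlinarith

/-- The vector `f` need not be in the domain: unitarity moves the group to the Schwartz function
`ψ`, where it is differentiable. -/
theorem IsConjGroup.hasDerivAt_inner {u : X ν → X ν} {U : ℝ → L2 ν →L[ℂ] L2 ν}
    (hU : IsConjGroup u U) (ψ : 𝓢(X ν, ℂ)) (f : L2 ν) (t : ℝ) :
    HasDerivAt (fun t => inner ℂ (embL2 ψ) (U t f))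
      (Complex.I * inner ℂ (embL2 (conjOp u ψ)) (U t f)) t := by
  have hflip : ∀ (k : L2 ν) (t : ℝ), inner ℂ k (U t f) = inner ℂ (U (-t) k) f := fun k t => by
    have h := hU.inner_map_map (-t) k (U t f)
    rw [hU.apply_neg_apply] at h
    exact h.symm
  simp only [hflip]
  have h1 := (hU.hasDerivAt (mem_closure_conjGraph u ψ) (-t)).scomp t (hasDerivAt_neg t)
  have h2 := h1.inner ℂ (hasDerivAt_const t f)
  refine h2.congr_deriv ?_
  rw [inner_zero_right, zero_add, neg_smul, one_smul, inner_neg_left, inner_smul_left,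
    Complex.conj_I]
  ring

theorem hasDerivAt_inner_iterate {u : X ν → X ν} {U : ℝ → L2 ν →L[ℂ] L2 ν}
    (hU : IsConjGroup u U) (ψ : 𝓢(X ν, ℂ)) (f : L2 ν) (n : ℕ) (t : ℝ) :
    HasDerivAt (fun t => Complex.I ^ n * inner ℂ (embL2 ((conjOp u)^[n] ψ)) (U t f))
      (Complex.I ^ (n + 1) * inner ℂ (embL2 ((conjOp u)^[n + 1] ψ)) (U t f)) t := by
  refine ((hU.hasDerivAt_inner ((conjOp u)^[n] ψ) f t).const_mul _).congr_deriv ?_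
  rw [Function.iterate_succ_apply']
  ring

/-! ### Products `B* A` and their smoothness along a group -/

section PairOperators

variable {V H D : Type*} [NormedAddCommGroup V] [NormedSpace ℂ V] [NormedAddCommGroup H]
  [InnerProductSpace ℂ H] {e : D → H}

/-- The operator `B* A : V → V*` for `A, B : V → H`. -/
def pairOp (B A : V →L[ℂ] H) : V →L[ℂ] (V →L⋆[ℂ] ℂ) :=
  LinearMap.mkContinuous
    ⟨⟨fun F => ((innerSL ℂ).flip (A F)).comp B, fun F G => by ext; simp⟩, fun c F => by ext; simp⟩
    (‖B‖ * ‖A‖) fun F => by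
    refine ContinuousLinearMap.opNorm_le_bound _ (by positivity) fun G => ?_
    change ‖inner ℂ (B G) (A F)‖ ≤ _
    calc ‖inner ℂ (B G) (A F)‖ ≤ ‖B G‖ * ‖A F‖ := norm_inner_le_norm _ _
      _ ≤ (‖B‖ * ‖G‖) * (‖A‖ * ‖F‖) := by
          gcongr
          · exact B.le_opNorm G
          · exact A.le_opNorm F
      _ = _ := by ring

@[simp]
theorem pairOp_apply (B A : V →L[ℂ] H) (F G : V) : pairOp B A F G = inner ℂ (B G) (A F) := rfl

theorem isBoundedBilinearMap_pair : IsBoundedBilinearMap ℝ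
    fun p : (V →L[ℂ] H) × H => (((innerSL ℂ).flip p.2).comp p.1 : V →L⋆[ℂ] ℂ) where
  add_left B B' f := by ext; simp
  smul_left c B f := by
    ext G
    change inner ℂ (c • B G) f = c • inner ℂ (B G) f
    rw [← Complex.coe_smul, inner_smul_left, Complex.conj_ofReal]
    rfl
  add_right B f f' := by ext; simp
  smul_right c B f := by
    ext G
    change inner ℂ (B G) (c • f) = c • inner ℂ (B G) f
    rw [← Complex.coe_smul, inner_smul_right]
    rfl
  bound := ⟨1, one_pos, fun B f => by
    refine ContinuousLinearMap.opNorm_le_bound _ (by positivity) fun G => ?_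
    change ‖inner ℂ (B G) f‖ ≤ _
    calc ‖inner ℂ (B G) f‖ ≤ ‖B G‖ * ‖f‖ := norm_inner_le_norm _ _
      _ ≤ (‖B‖ * ‖G‖) * ‖f‖ := by gcongr; exact B.le_opNorm G
      _ = _ := by ring⟩

/-- The functional `Γ ↦ ⟪φ, Γ F⟫` on operators `V → H`. -/
def testFunctional (e : D → H) (i : V × D) : (V →L[ℂ] H) →L[ℝ] ℂ :=
  ((innerSL ℂ (e i.2)).comp (ContinuousLinearMap.apply ℂ H i.1)).restrictScalars ℝ

theorem testFunctional_apply (i : V × D) (Γ : V →L[ℂ] H) :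
    testFunctional e i Γ = inner ℂ (e i.2) (Γ i.1) := rfl

/-- The functions `e φ` detect the norm of `H`. -/
def IsNorming (e : D → H) : Prop :=
  ∀ (x : H) (M : ℝ), 0 ≤ M → (∀ φ, ‖inner ℂ (e φ) x‖ ≤ M * ‖e φ‖) → ‖x‖ ≤ M

theorem IsNorming.norm_le (he : IsNorming e) (Γ : V →L[ℂ] H) (M : ℝ) (hM : 0 ≤ M)
    (h : ∀ i : V × D, ‖testFunctional e i Γ‖ ≤ M * (‖i.1‖ * ‖e i.2‖)) : ‖Γ‖ ≤ M := by
  refine ContinuousLinearMap.opNorm_le_bound _ hM fun F => ?_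
  refine he _ _ (by positivity) fun φ => ?_
  rw [mul_assoc]
  exact h (F, φ)

/-- All matrix elements of `Γ` are smooth, with locally uniform bounds. -/
def IsWeaklySmooth (e : D → H) (Γ : ℝ → V →L[ℂ] H) : Prop :=
  ∃ l : ℕ → V × D → ℝ → ℂ, (∀ i t, l 0 i t = inner ℂ (e i.2) (Γ t i.1)) ∧
    (∀ n i t, HasDerivAt (l n i) (l (n + 1) i t) t) ∧
    ∀ (n : ℕ) (R : ℝ), ∃ M, 0 ≤ M ∧ ∀ i t, |t| ≤ R → ‖l n i t‖ ≤ M * (‖i.1‖ * ‖e i.2‖)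

theorem IsWeaklySmooth.contDiff [CompleteSpace H] (he : IsNorming e) {Γ : ℝ → V →L[ℂ] H}
    (h : IsWeaklySmooth e Γ) : ContDiff ℝ ∞ Γ := by
  obtain ⟨l, h0, hd, hb⟩ := h
  exact contDiff_of_weak (lam := testFunctional e) (w := fun i => ‖i.1‖ * ‖e i.2‖) he.norm_le h0 hd hb

/-- The conjugated form is `⟪B W(-t) G, A W(-t) F⟫`, a bounded real bilinear expression in the
curves `B W(-t)` and `A W(-t) F`, both smooth in norm. -/
theorem contDiff_pairOp [CompleteSpace H] (he : IsNorming e) {B A : V →L[ℂ] H}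
    {W : ℝ → V →L[ℂ] V} (hB : IsWeaklySmooth e fun t => B.comp (W t))
    (hA : IsWeaklySmooth e fun t => A.comp (W t)) (F : V) :
    ContDiff ℝ ∞ fun t : ℝ => ((pairOp B A (W (-t) F)).comp (W (-t)) : V →L⋆[ℂ] ℂ) := by
  have hA' : ContDiff ℝ ∞ fun t => A (W (-t) F) :=
    ContDiff.comp (g := (ContinuousLinearMap.apply ℂ H F).restrictScalars ℝ)
      (f := fun t => A.comp (W (-t))) (ContinuousLinearMap.contDiff _)
      ((hA.contDiff he).comp contDiff_neg)
  exact isBoundedBilinearMap_pair.contDiff.comp (((hB.contDiff he).comp contDiff_neg).prodMk hA')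

end PairOperators

/-- Test functions as elements of `L²`. -/
def testL2 (φ : {φ : 𝓢(X ν, ℂ) // HasCompactSupport (φ : X ν → ℂ)}) : L2 ν := embL2 φ.1

theorem isNorming_testL2 : IsNorming (testL2 (ν := ν)) :=
  fun _ _ hM h => norm_le_of_test hM fun φ hφ => h ⟨φ, hφ⟩

theorem H1.norm_inner_toL2_le {u : X ν → X ν} {U : ℝ → L2 ν →L[ℂ] L2 ν} (hU : IsConjGroup u U)
    (ψ : 𝓢(X ν, ℂ)) (F : H1 ν) (t : ℝ) :
    ‖inner ℂ (embL2 ψ) (U t (H1.toL2 F))‖ ≤ ‖embL2 ψ‖ * ‖F‖ := by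
  refine (norm_inner_le_norm _ _).trans ?_
  rw [hU.norm_map]
  gcongr
  exact norm_toL2_le F

/-- The `n`-th derivative of `⟪φ, g U_t f⟫` is `i^n ⟪A_u^n (g φ), U_t f⟫`. The `n` powers of `x`
produced by `A_u^n` are absorbed by `g`, so the bound involves only `‖φ‖` in `L²`. -/
theorem isWeaklySmooth_mulL2_toL2 {u : X ν → X ν} (h : IsAdmissible u) {W : ℝ → H1 ν →L[ℂ] H1 ν}
    (hW : IsConjGroupH1 u W) {g : X ν → ℝ} (hg : IsDecaying g) :
    IsWeaklySmooth testL2 fun t => ((mulL2 fun x => (g x : ℂ)).comp H1.toL2CLM).comp (W t) := by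
  obtain ⟨U, hU, hWU⟩ := hW
  refine ⟨fun n i t => Complex.I ^ n *
      inner ℂ (embL2 ((conjOp u)^[n] (testMul g hg.smooth i.2.1 i.2.2))) (U t (H1.toL2 i.1)),
    fun i t => ?_, fun n i t => hasDerivAt_inner_iterate hU _ _ n t, fun n R => ?_⟩
  · simp only [testL2]
    rw [pow_zero, one_mul, Function.iterate_zero_apply,
      embL2_testMul hg.smooth hg.memLp, inner_mulL2_left_of_real hg.memLp]
    change _ = inner ℂ _ (mulL2 _ (H1.toL2 (W t i.1)))
    rw [hWU]
  · obtain ⟨C, hC0, hC⟩ := wnorm_iterate_conjOp_le h n 0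
    obtain ⟨D, hD0, hD⟩ := hg.wnorm_testMul_le (0 + n)
    refine ⟨C * D, by positivity, fun i t _ => ?_⟩
    rw [norm_mul, norm_pow, Complex.norm_I, one_pow, one_mul]
    refine (H1.norm_inner_toL2_le hU _ _ t).trans ?_
    rw [mul_comm ‖i.1‖, ← mul_assoc]
    gcongr
    refine (hC _).trans ?_
    rw [mul_assoc]
    gcongr
    exact hD _ _

/-- Only the derivative of the symbol `ξ_j` contributes to the commutator, and `2πi · i/2π = -1`. -/
theorem conjOp_lineDeriv {u : X ν → X ν} (h : IsField u) (j : Fin ν) (φ : 𝓢(X ν, ℂ)) :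
    conjOp u (∂_{stdVec j} φ) = ∂_{stdVec j} (conjOp u φ) - mulF (symb u j) φ := by
  have hpd : ∀ k : Fin ν, pd k (coord j : X ν → ℂ) = fun _ => if k = j then 1 else 0 := by
    intro k
    ext ξ
    have h1 : HasFDerivAt (coord j : X ν → ℂ) (coordC j) ξ := (coordC j).hasFDerivAt
    rw [pd, h1.fderiv]
    simp [coordC, stdVec, eq_comm, apply_ite]
  rw [lineDeriv_eq_mulF, lineDeriv_eq_mulF, ← conjCLM_apply, map_smul, conjCLM_apply,
    conjOp_mulF h (hasTemperateGrowth_coord j), smul_add, sub_eq_add_neg, smul_smul]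
  congr 1
  have h2 : ∀ k : Fin ν, mulF (symb u k) (mulF (pd k (coord j)) φ)
      = if k = j then mulF (symb u j) φ else 0 := by
    intro k
    rw [hpd k]
    split_ifs with hk
    · rw [mulF_one, hk]
    · have h3 : mulF (fun _ : X ν => (0 : ℂ)) φ = 0 := by simp
      rw [h3, map_zero]
  rw [Finset.sum_congr rfl fun k _ => h2 k, Finset.sum_ite_eq' Finset.univ j, if_pos (Finset.mem_univ j)]
  have h4 : tpi * cpi = -1 := by
    have : (Real.pi : ℂ) ≠ 0 := Complex.ofReal_ne_zero.2 Real.pi_ne_zero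
    simp only [tpi, cpi]
    field_simp
    exact Complex.I_sq
  rw [h4, neg_smul, one_smul]

/-- Moving `∂_j` through `A_u^n` produces only the bounded multiplier `u_j(p)`, so the error
contains no derivative of `φ`. -/
theorem norm_iterate_conjOp_lineDeriv_sub_le {u : X ν → X ν} (h : IsAdmissible u) (j : Fin ν)
    (n : ℕ) : ∃ C : ℝ, 0 ≤ C ∧ ∀ φ : 𝓢(X ν, ℂ), ‖embL2 ((conjOp u)^[n] (∂_{stdVec j} φ))
      - embL2 (∂_{stdVec j} ((conjOp u)^[n] φ))‖ ≤ C * wnorm n φ := by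
  induction n with
  | zero => exact ⟨0, le_rfl, fun φ => by simp⟩
  | succ n ih =>
    obtain ⟨C, hC0, hC⟩ := ih
    obtain ⟨D, hD0, hD⟩ := wnorm_conjOp_le h n
    obtain ⟨B, hB0, hB⟩ := wnorm_iterate_conjOp_le h n 0
    obtain ⟨S, hS0, hS⟩ := wnorm_mulF_le n (h.isBddSymbol j)
    refine ⟨C * D + B * S, by positivity, fun φ => ?_⟩
    have hlin : ∀ φ ψ : 𝓢(X ν, ℂ), (conjOp u)^[n] (φ - ψ) = (conjOp u)^[n] φ - (conjOp u)^[n] ψ := by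
      intro φ ψ
      have : conjOp u = conjCLM u := funext fun φ => (conjCLM_apply u φ).symm
      rw [this]
      exact iterate_map_sub (conjCLM u) n φ ψ
    rw [Function.iterate_succ_apply, Function.iterate_succ_apply, conjOp_lineDeriv h.isField, hlin,
      embL2_sub, sub_right_comm]
    refine (norm_sub_le _ _).trans ?_
    have h1 := hC (conjOp u φ)
    have h2 : ‖embL2 ((conjOp u)^[n] (mulF (symb u j) φ))‖ ≤ B * wnorm (0 + n) (mulF (symb u j) φ) :=
      hB _
    rw [zero_add] at h2
    have h3 := mul_le_mul_of_nonneg_left (hD φ) hC0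
    have h4 := mul_le_mul_of_nonneg_left ((hS φ).trans
      (mul_le_mul_of_nonneg_left (wnorm_le_succ n φ) hS0)) hB0
    calc _ ≤ C * (D * wnorm (n + 1) φ) + B * (S * wnorm (n + 1) φ) :=
          add_le_add (h1.trans h3) (h2.trans h4)
      _ = _ := by ring

theorem isWeaklySmooth_mulL2_d {u : X ν → X ν} (h : IsAdmissible u) {W : ℝ → H1 ν →L[ℂ] H1 ν}
    (hW : IsConjGroupH1 u W) {g : X ν → ℝ} (hg : IsDecaying g) (j : Fin ν) :
    IsWeaklySmooth testL2 fun t => ((mulL2 fun x => (g x : ℂ)).comp (H1.dCLM j)).comp (W t) := by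
  obtain ⟨K, E, hKE⟩ := IsConjGroupH1.norm_le h.isField
  have hWn := hKE W hW
  obtain ⟨U, hU, hWU⟩ := hW
  refine ⟨fun n i t => -(Complex.I ^ n *
      inner ℂ (embL2 ((conjOp u)^[n] (∂_{stdVec j} (testMul g hg.smooth i.2.1 i.2.2))))
        (U t (H1.toL2 i.1))),
    fun i t => ?_, fun n i t => (hasDerivAt_inner_iterate hU _ _ n t).neg, fun n R => ?_⟩
  · simp only [testL2]
    rw [pow_zero, one_mul, Function.iterate_zero_apply, ← hWU,
      H1.inner_lineDeriv, neg_neg, embL2_testMul hg.smooth hg.memLp,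
      inner_mulL2_left_of_real hg.memLp]
    rfl
  · obtain ⟨C, hC0, hC⟩ := wnorm_iterate_conjOp_le h n 0
    obtain ⟨B, hB0, hB⟩ := norm_iterate_conjOp_lineDeriv_sub_le h j n
    obtain ⟨D, hD0, hD⟩ := hg.wnorm_testMul_le n
    refine ⟨B * D + C * D * (|K| * Real.exp (|E| * R)), by positivity, fun i t ht => ?_⟩
    set ψ := testMul g hg.smooth i.2.1 i.2.2 with hψ
    rw [norm_neg, norm_mul, norm_pow, Complex.norm_I, one_pow, one_mul]
    -- A derivative left on `ψ` would hit the oscillating coefficient. After commuting it to the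
    -- outside of `A_u^n`, it is transferred to `W t F`, at the price of the `H¹` bound for the
    -- group.
    have h1 : inner ℂ (embL2 ((conjOp u)^[n] (∂_{stdVec j} ψ))) (U t (H1.toL2 i.1))
        = inner ℂ (embL2 ((conjOp u)^[n] (∂_{stdVec j} ψ))
          - embL2 (∂_{stdVec j} ((conjOp u)^[n] ψ))) (U t (H1.toL2 i.1))
          - inner ℂ (embL2 ((conjOp u)^[n] ψ)) (H1.d (W t i.1) j) := by
      rw [inner_sub_left, ← hWU, H1.inner_lineDeriv (W t i.1) j ((conjOp u)^[n] ψ)]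
      ring
    have hψn : wnorm n ψ ≤ D * ‖embL2 i.2.1‖ := hD _ _
    have h2 : ‖inner ℂ (embL2 ((conjOp u)^[n] (∂_{stdVec j} ψ))
          - embL2 (∂_{stdVec j} ((conjOp u)^[n] ψ))) (U t (H1.toL2 i.1))‖
          ≤ B * (D * ‖embL2 i.2.1‖) * ‖i.1‖ := by
      refine (norm_inner_le_norm _ _).trans ?_
      rw [hU.norm_map]
      gcongr
      · exact (hB ψ).trans (by gcongr)
      · exact H1.norm_toL2_le _
    have h3 : ‖H1.d (W t i.1) j‖ ≤ |K| * Real.exp (|E| * R) * ‖i.1‖ := by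
      refine (H1.norm_d_le _ j).trans (((W t).le_opNorm _).trans ?_)
      gcongr
      refine (hWn t).trans ?_
      gcongr
      · exact le_abs_self K
      · exact le_abs_self E
    have h4 : ‖inner ℂ (embL2 ((conjOp u)^[n] ψ)) (H1.d (W t i.1) j)‖
        ≤ C * (D * ‖embL2 i.2.1‖) * (|K| * Real.exp (|E| * R) * ‖i.1‖) := by
      refine (norm_inner_le_norm _ _).trans ?_
      gcongr
      have h5 : ‖embL2 ((conjOp u)^[n] ψ)‖ ≤ C * wnorm (0 + n) ψ := hC ψ
      rw [zero_add] at h5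
      exact h5.trans (by gcongr)
    rw [h1]
    refine (norm_sub_le _ _).trans ((add_le_add h2 h4).trans (le_of_eq ?_))
    rw [testL2]
    ring

end

section

variable {ν : ℕ}

/-! ### The potential -/

/-- The hypotheses on the cutoff `κ`. -/
structure IsCutoff (κ : ℝ → ℝ) : Prop where
  smooth : ContDiff ℝ ∞ κ
  supp : HasCompactSupport κ
  one : ∀ t ∈ Set.Icc (-1 : ℝ) 1, κ t = 1
  range : ∀ t, 0 ≤ κ t ∧ κ t ≤ 1

theorem hasFDerivAt_norm {x : X ν} (hx : x ≠ 0) :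
    HasFDerivAt (fun y : X ν => ‖y‖) (‖x‖⁻¹ • innerSL ℝ x) x := by
  have h1 := (hasStrictFDerivAt_norm_sq x).hasFDerivAt.sqrt (by simpa using hx)
  have h2 : (fun y : X ν => Real.sqrt (‖y‖ ^ 2)) = fun y => ‖y‖ :=
    funext fun y => Real.sqrt_sq (norm_nonneg y)
  rw [h2, Real.sqrt_sq (norm_nonneg x)] at h1
  refine h1.congr_fderiv ?_
  ext v
  change (1 / (2 * ‖x‖)) • (2 • inner ℝ x v) = ‖x‖⁻¹ • inner ℝ x v
  rw [smul_eq_mul, smul_eq_mul, nsmul_eq_mul]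
  field_simp
  simp

/-- The norm is smooth away from the origin, and near the origin the composition vanishes. -/
theorem contDiff_radial {E : Type*} [NormedAddCommGroup E] [NormedSpace ℝ E] {h : ℝ → E}
    (hs : ContDiff ℝ ∞ h) (h0 : ∀ r, |r| < 1 → h r = 0) : ContDiff ℝ ∞ fun x : X ν => h ‖x‖ := by
  rw [contDiff_iff_contDiffAt]
  intro x
  by_cases hx : x = 0
  · have h1 : (fun x : X ν => h ‖x‖) =ᶠ[𝓝 x] fun _ => 0 := by
      filter_upwards [Metric.ball_mem_nhds x one_pos] with y hy
      rw [hx, mem_ball_zero_iff] at hy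
      exact h0 _ (by simpa using hy)
    exact contDiffAt_const.congr_of_eventuallyEq h1
  · exact hs.contDiffAt.comp x (contDiffAt_norm ℝ hx)

theorem pow_mul_exp_le (k : ℕ) {r : ℝ} (hr : 0 ≤ r) :
    r ^ k * Real.exp (-r / 8) ≤ k.factorial * 8 ^ k := by
  have h1 := Real.pow_div_factorial_le_exp (r / 8) (by positivity) k
  rw [div_pow, div_div, div_le_iff₀ (by positivity)] at h1
  rw [neg_div, Real.exp_neg, ← div_eq_mul_inv, div_le_iff₀ (Real.exp_pos _)]
  linarith

theorem isDecaying_of_exp {g : X ν → ℝ} (hg : ContDiff ℝ ∞ g) {C : ℝ}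
    (hC : ∀ x, |g x| ≤ C * Real.exp (-‖x‖ / 8)) : IsDecaying g where
  smooth := hg
  decay := by
    intro k
    have hC0 : 0 ≤ C := by
      have := (abs_nonneg _).trans (hC 0)
      exact nonneg_of_mul_nonneg_left this (Real.exp_pos _)
    refine ⟨C * (k.factorial * 8 ^ k), fun x => ?_⟩
    calc ‖x‖ ^ k * |g x| ≤ ‖x‖ ^ k * (C * Real.exp (-‖x‖ / 8)) := by gcongr; exact hC x
      _ = C * (‖x‖ ^ k * Real.exp (-‖x‖ / 8)) := by ring
      _ ≤ _ := mul_le_mul_of_nonneg_left (pow_mul_exp_le k (norm_nonneg x)) hC0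

/-- The regularised length `√(1 + |x|²)`. -/
def japanese (x : X ν) : ℝ := Real.sqrt (1 + ‖x‖ ^ 2)

theorem contDiff_japanese : ContDiff ℝ ∞ (japanese : X ν → ℝ) :=
  (contDiff_const.add (contDiff_norm_sq ℝ)).sqrt fun x => by positivity

theorem norm_le_japanese (x : X ν) : ‖x‖ ≤ japanese x :=
  Real.le_sqrt_of_sq_le (by linarith)

theorem japanese_le (x : X ν) : japanese x ≤ 1 + ‖x‖ :=
  Real.sqrt_le_iff.2 ⟨by positivity, by nlinarith [norm_nonneg x]⟩

/-- The exponential weight `exp(-√(1 + |x|²) / 8)`. -/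
def expWeight (x : X ν) : ℝ := Real.exp (-japanese x / 8)

/-- The inverse `exp(√(1 + |x|²) / 8)` of the exponential weight. -/
def expWeightInv (x : X ν) : ℝ := Real.exp (japanese x / 8)

theorem expWeight_mul_inv (x : X ν) : expWeight x * expWeightInv x = 1 := by
  rw [expWeight, expWeightInv, ← Real.exp_add]
  simp [neg_div]

theorem contDiff_expWeight : ContDiff ℝ ∞ (expWeight : X ν → ℝ) :=
  Real.contDiff_exp.comp (contDiff_japanese.neg.div_const 8)

theorem contDiff_expWeightInv : ContDiff ℝ ∞ (expWeightInv : X ν → ℝ) :=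
  Real.contDiff_exp.comp (contDiff_japanese.div_const 8)

theorem isDecaying_expWeight : IsDecaying (expWeight : X ν → ℝ) :=
  isDecaying_of_exp contDiff_expWeight (C := 1) fun x => by
    rw [expWeight, abs_of_pos (Real.exp_pos _), one_mul, Real.exp_le_exp]
    linarith [norm_le_japanese x]

/-- Of the decay `e^{-|x|/4}` only half is given up to the inverse weight, which leaves
`e^{-|x|/8}`. -/
theorem isDecaying_mul_expWeightInv {g : X ν → ℝ} (hg : ContDiff ℝ ∞ g) {C : ℝ}
    (hC : ∀ x, |g x| ≤ C * Real.exp (-‖x‖ / 4)) : IsDecaying fun x => g x * expWeightInv x := by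
  refine isDecaying_of_exp (hg.mul contDiff_expWeightInv) (C := C * Real.exp (1 / 8)) fun x => ?_
  have hC0 : 0 ≤ C := nonneg_of_mul_nonneg_left ((abs_nonneg _).trans (hC x)) (Real.exp_pos _)
  rw [abs_mul, expWeightInv, abs_of_pos (Real.exp_pos _)]
  calc |g x| * Real.exp (japanese x / 8)
      ≤ C * Real.exp (-‖x‖ / 4) * Real.exp ((1 + ‖x‖) / 8) := by
        gcongr
        · exact hC x
        · exact japanese_le x
    _ = _ := by
        rw [mul_assoc, mul_assoc, ← Real.exp_add, ← Real.exp_add]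
        ring_nf

/-! ### Radial profiles in the decomposition `V = div F + H` -/

section Profile

variable {κ : ℝ → ℝ}

/-- The profile `a(r) = (1 - κ(r)) e^{-r/4} / r`. -/
def profA (κ : ℝ → ℝ) (r : ℝ) : ℝ := (1 - κ r) * Real.exp (-r / 4) / r

/-- The profile of the field `F(x) = x m(|x|)`. -/
def profM (κ : ℝ → ℝ) (r : ℝ) : ℝ := -(profA κ r * Real.cos (Real.exp r))

/-- The profile of the remainder `V - div F`. -/
def profH (ν : ℕ) (κ : ℝ → ℝ) (r : ℝ) : ℝ :=
  (((ν : ℝ) - 1) * profA κ r + (-deriv κ r - (1 - κ r) / 4) * Real.exp (-r / 4)) *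
    Real.cos (Real.exp r)

namespace IsCutoff

theorem eq_one (hκ : IsCutoff κ) {r : ℝ} (hr : |r| < 1) : κ r = 1 := hκ.one r ⟨(abs_lt.1 hr).1.le, (abs_lt.1 hr).2.le⟩

theorem eventually_eq_one (hκ : IsCutoff κ) {r : ℝ} (hr : |r| < 1) : κ =ᶠ[𝓝 r] fun _ => 1 := by
  filter_upwards [continuous_abs.continuousAt.eventually_lt_const hr] with y hy
  exact hκ.eq_one hy

theorem deriv_eq_zero (hκ : IsCutoff κ) {r : ℝ} (hr : |r| < 1) : deriv κ r = 0 := by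
  rw [(hκ.eventually_eq_one hr).deriv_eq, deriv_const]

theorem profA_eq_zero (hκ : IsCutoff κ) {r : ℝ} (hr : |r| < 1) : profA κ r = 0 := by
  simp [profA, hκ.eq_one hr]

theorem profM_eq_zero (hκ : IsCutoff κ) {r : ℝ} (hr : |r| < 1) : profM κ r = 0 := by
  simp [profM, hκ.profA_eq_zero hr]

theorem profH_eq_zero (hκ : IsCutoff κ) {r : ℝ} (hr : |r| < 1) : profH ν κ r = 0 := by
  simp [profH, hκ.profA_eq_zero hr, hκ.eq_one hr, hκ.deriv_eq_zero hr]

theorem contDiff_deriv (hκ : IsCutoff κ) : ContDiff ℝ ∞ (deriv κ) := (contDiff_infty_iff_deriv.1 hκ.smooth).2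

theorem contDiff_profA (hκ : IsCutoff κ) : ContDiff ℝ ∞ (profA κ) := by
  rw [contDiff_iff_contDiffAt]
  intro r
  by_cases hr : |r| < 1
  · have h1 : profA κ =ᶠ[𝓝 r] fun _ => 0 := by
      filter_upwards [continuous_abs.continuousAt.eventually_lt_const hr] with y hy
      exact hκ.profA_eq_zero hy
    exact contDiffAt_const.congr_of_eventuallyEq h1
  · have hr0 : r ≠ 0 := by rintro rfl; simp at hr
    refine ContDiffAt.div ?_ contDiffAt_id hr0
    exact ((contDiff_const.sub hκ.smooth).mul
      (Real.contDiff_exp.comp (contDiff_id.neg.div_const 4))).contDiffAt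

theorem contDiff_profM (hκ : IsCutoff κ) : ContDiff ℝ ∞ (profM κ) :=
  (hκ.contDiff_profA.mul (Real.contDiff_cos.comp Real.contDiff_exp)).neg

theorem contDiff_profH (hκ : IsCutoff κ) : ContDiff ℝ ∞ (profH ν κ) :=
  ((contDiff_const.mul hκ.contDiff_profA).add ((hκ.contDiff_deriv.neg.sub
    ((contDiff_const.sub hκ.smooth).div_const 4)).mul
    (Real.contDiff_exp.comp (contDiff_id.neg.div_const 4)))).mul
    (Real.contDiff_cos.comp Real.contDiff_exp)

theorem abs_mul_profA_le (hκ : IsCutoff κ) {r : ℝ} (hr : 0 ≤ r) : r * |profA κ r| ≤ Real.exp (-r / 4) := by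
  rcases hr.eq_or_lt with rfl | hr
  · simp
  · have h := hκ.range r
    rw [profA, abs_div, abs_mul, abs_of_pos hr, abs_of_pos (Real.exp_pos _),
      abs_of_nonneg (by linarith : 0 ≤ 1 - κ r), mul_div_cancel₀ _ hr.ne']
    exact mul_le_of_le_one_left (Real.exp_pos _).le (by linarith)

theorem abs_profA_le (hκ : IsCutoff κ) {r : ℝ} (hr : 0 ≤ r) : |profA κ r| ≤ Real.exp (-r / 4) := by
  by_cases hr1 : |r| < 1
  · rw [hκ.profA_eq_zero hr1, abs_zero]; exact (Real.exp_pos _).le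
  · rw [abs_of_nonneg hr, not_lt] at hr1
    refine le_trans ?_ (hκ.abs_mul_profA_le hr)
    exact le_mul_of_one_le_left (abs_nonneg _) hr1

theorem _root_.Oscillating.abs_profM_le {r : ℝ} : |profM κ r| ≤ |profA κ r| := by
  rw [profM, abs_neg, abs_mul]
  exact mul_le_of_le_one_right (abs_nonneg _) (Real.abs_cos_le_one _)

theorem exists_abs_deriv_le (hκ : IsCutoff κ) : ∃ C : ℝ, 0 ≤ C ∧ ∀ r, |deriv κ r| ≤ C := by
  obtain ⟨C, hC⟩ := hκ.contDiff_deriv.continuous.bounded_above_of_compact_support hκ.supp.deriv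
  exact ⟨C, (norm_nonneg _).trans (hC 0), hC⟩

theorem exists_abs_profH_le (hκ : IsCutoff κ) (ν : ℕ) :
    ∃ C : ℝ, ∀ r, 0 ≤ r → |profH ν κ r| ≤ C * Real.exp (-r / 4) := by
  obtain ⟨D, hD0, hD⟩ := hκ.exists_abs_deriv_le
  refine ⟨|(ν : ℝ) - 1| + (D + 1), fun r hr => ?_⟩
  rw [profH, abs_mul]
  refine (mul_le_of_le_one_right (abs_nonneg _) (Real.abs_cos_le_one _)).trans ?_
  refine (abs_add_le _ _).trans ?_
  rw [abs_mul, abs_mul, abs_of_pos (Real.exp_pos _), add_mul]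
  have h := hκ.range r
  have h1 : |-deriv κ r - (1 - κ r) / 4| ≤ D + 1 := by
    have := abs_le.1 (hD r)
    rw [abs_le]
    constructor <;> linarith
  have h2 := hκ.abs_profA_le hr
  gcongr

theorem hasDerivAt_profA (hκ : IsCutoff κ) {r : ℝ} (hr : r ≠ 0) : HasDerivAt (profA κ)
    (((-deriv κ r - (1 - κ r) / 4) * Real.exp (-r / 4) - profA κ r) / r) r := by
  have h1 : HasDerivAt κ (deriv κ r) r :=
    (hκ.smooth.differentiable (by simp) r).hasDerivAt
  have h2 : HasDerivAt (fun r => Real.exp (-r / 4)) (Real.exp (-r / 4) * (-1 / 4)) r :=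
    ((hasDerivAt_id r).neg.div_const 4).exp
  have h3 := ((h1.const_sub 1).mul h2).div (hasDerivAt_id r) hr
  refine h3.congr_deriv ?_
  simp only [profA, id, Pi.mul_apply]
  field_simp
  ring

/-- `ν m + r m' = V - H` for the radial profiles. -/
theorem radial_divergence (hκ : IsCutoff κ) {r : ℝ} (hr : r ≠ 0) : ∃ m' : ℝ, HasDerivAt (profM κ) m' r ∧
    (ν : ℝ) * profM κ r + r * m' + profH ν κ r
      = (1 - κ r) * Real.exp (3 * r / 4) * Real.sin (Real.exp r) := by
  have h1 := ((hκ.hasDerivAt_profA hr).mul (Real.hasDerivAt_exp r).cos).neg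
  refine ⟨_, h1, ?_⟩
  -- The decisive cancellation: the factor `e^r` from differentiating `cos(e^r)` turns `e^{-r/4}`
  -- into the amplitude `e^{3r/4}` of the potential.
  have h3 : Real.exp (3 * r / 4) = Real.exp (-r / 4) * Real.exp r := by
    rw [← Real.exp_add]; ring_nf
  rw [h3]
  simp only [profM, profH, profA]
  field_simp
  ring

end IsCutoff

end Profile

end

section

variable {ν : ℕ}

/-! ### The operator of multiplication by the potential -/

section PotentialOperator

variable {κ : ℝ → ℝ}

/-- The components of the field `F(x) = x m(|x|)`. -/
def fieldF (κ : ℝ → ℝ) (j : Fin ν) (x : X ν) : ℝ := x j * profM κ ‖x‖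

/-- The remainder `V - div F`. -/
def remH (κ : ℝ → ℝ) (x : X ν) : ℝ := profH ν κ ‖x‖

theorem contDiff_apply_coord (j : Fin ν) : ContDiff ℝ ∞ fun x : X ν => x j :=
  (EuclideanSpace.proj j : X ν →L[ℝ] ℝ).contDiff

namespace IsCutoff

theorem contDiff_fieldF (hκ : IsCutoff κ) (j : Fin ν) : ContDiff ℝ ∞ (fieldF κ j) :=
  (contDiff_apply_coord j).mul (contDiff_radial hκ.contDiff_profM fun _ => hκ.profM_eq_zero)

theorem contDiff_remH (hκ : IsCutoff κ) : ContDiff ℝ ∞ (remH κ : X ν → ℝ) :=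
  contDiff_radial hκ.contDiff_profH fun _ => hκ.profH_eq_zero

theorem abs_fieldF_le (hκ : IsCutoff κ) (j : Fin ν) (x : X ν) :
    |fieldF κ j x| ≤ 1 * Real.exp (-‖x‖ / 4) := by
  have h1 : |x j| ≤ ‖x‖ := by simpa using PiLp.norm_apply_le x j
  rw [fieldF, abs_mul, one_mul]
  refine le_trans ?_ (hκ.abs_mul_profA_le (norm_nonneg x))
  have h2 := abs_profM_le (κ := κ) (r := ‖x‖)
  gcongr

theorem isDecaying_fieldF (hκ : IsCutoff κ) (j : Fin ν) :
    IsDecaying fun x : X ν => fieldF κ j x * expWeightInv x :=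
  isDecaying_mul_expWeightInv (hκ.contDiff_fieldF j) (hκ.abs_fieldF_le j)

theorem isDecaying_remH (hκ : IsCutoff κ) : IsDecaying fun x : X ν => remH κ x * expWeightInv x := by
  obtain ⟨C, hC⟩ := hκ.exists_abs_profH_le ν
  exact isDecaying_mul_expWeightInv hκ.contDiff_remH fun x => hC _ (norm_nonneg x)

theorem sum_fderiv_fieldF (hκ : IsCutoff κ) (x : X ν) :
    ∑ j, fderiv ℝ (fieldF κ j) x (stdVec j) + remH κ x = potential κ x := by
  by_cases hx : x = 0
  · subst hx
    have h1 : ∀ j : Fin ν, fderiv ℝ (fieldF κ j) (0 : X ν) = 0 := by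
      intro j
      have h2 : fieldF κ j =ᶠ[𝓝 (0 : X ν)] fun _ => 0 := by
        filter_upwards [Metric.ball_mem_nhds (0 : X ν) one_pos] with y hy
        rw [mem_ball_zero_iff] at hy
        rw [fieldF, hκ.profM_eq_zero (by simpa using hy), mul_zero]
      rw [h2.fderiv_eq, fderiv_fun_const]
      rfl
    simp [h1, remH, potential, hκ.profH_eq_zero, hκ.one 0 (by norm_num)]
  · have hr : ‖x‖ ≠ 0 := norm_ne_zero_iff.2 hx
    obtain ⟨m', hm, hdiv⟩ := hκ.radial_divergence (ν := ν) hr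
    have h1 : ∀ j : Fin ν, fderiv ℝ (fieldF κ j) x (stdVec j)
        = profM κ ‖x‖ + m' * ‖x‖⁻¹ * (x j) ^ 2 := by
      intro j
      have e1 : HasFDerivAt (fun y : X ν => y j) (EuclideanSpace.proj j : X ν →L[ℝ] ℝ) x :=
        (EuclideanSpace.proj j : X ν →L[ℝ] ℝ).hasFDerivAt
      have e2 := e1.mul (hm.comp_hasFDerivAt x (hasFDerivAt_norm hx))
      have e3 : fderiv ℝ (fieldF κ j) x = _ := e2.fderiv
      rw [e3]
      change x j * (m' * (‖x‖⁻¹ * inner ℝ x (stdVec j))) + profM κ ‖x‖ * (stdVec j : X ν) j = _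
      rw [inner_stdVec]
      simp [stdVec]
      ring
    rw [Finset.sum_congr rfl fun j _ => h1 j, Finset.sum_add_distrib, ← Finset.mul_sum]
    have h2 : ∑ j, (x j) ^ 2 = ‖x‖ ^ 2 := by
      rw [EuclideanSpace.norm_sq_eq]
      exact Finset.sum_congr rfl fun j _ => by rw [Real.norm_eq_abs, sq_abs]
    rw [h2, Finset.sum_const, Finset.card_univ, Fintype.card_fin, nsmul_eq_mul, potential, ← hdiv,
      remH]
    field_simp

end IsCutoff

/-- Multiplication by `g` as an operator `H¹ → L²`. -/
abbrev mulOp (g : X ν → ℝ) : H1 ν →L[ℂ] L2 ν := (mulL2 fun x => (g x : ℂ)).comp H1.toL2CLM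

/-- The operator `f ↦ g ∂_j f` from `H¹` to `L²`. -/
abbrev mulD (g : X ν → ℝ) (j : Fin ν) : H1 ν →L[ℂ] L2 ν :=
  (mulL2 fun x => (g x : ℂ)).comp (H1.dCLM j)

/-- The operator `V : H¹ → H⁻¹`. -/
def potentialOp (κ : ℝ → ℝ) : H1 ν →L[ℂ] Hneg1 ν :=
  pairOp (mulOp expWeight) (mulOp fun x => remH κ x * expWeightInv x) -
    ∑ j, (pairOp (mulOp expWeight) (mulD (fun x => fieldF κ j x * expWeightInv x) j)
      + pairOp (mulD expWeight j) (mulOp fun x => fieldF κ j x * expWeightInv x))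

theorem inner_mulL2_expWeight {g : X ν → ℝ} (hg : IsDecaying fun x => g x * expWeightInv x)
    (hs : ContDiff ℝ ∞ g) {φ ψ : 𝓢(X ν, ℂ)} (hφ : HasCompactSupport (φ : X ν → ℂ)) :
    inner ℂ (mulL2 (fun x => (expWeight x : ℂ)) (embL2 ψ))
      (mulL2 (fun x => ((g x * expWeightInv x : ℝ) : ℂ)) (embL2 φ))
      = inner ℂ (embL2 ψ) (embL2 (testMul g hs φ hφ)) := by
  rw [inner_mulL2_left_of_real isDecaying_expWeight.memLp, ← embL2_testMul hg.smooth hg.memLp hφ,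
    ← embL2_testMul contDiff_expWeight isDecaying_expWeight.memLp
      (hasCompactSupport_testMul hg.smooth hφ)]
  congr 2
  ext x
  rw [testMul_apply, testMul_apply, testMul_apply, ← mul_assoc, ← Complex.ofReal_mul,
    mul_left_comm, expWeight_mul_inv, mul_one]

theorem lineDeriv_testMul {g : X ν → ℝ} (hg : ContDiff ℝ ∞ g) (j : Fin ν) {φ : 𝓢(X ν, ℂ)}
    (hφ : HasCompactSupport (φ : X ν → ℂ)) (x : X ν) :
    (∂_{stdVec j} (testMul g hg φ hφ)) x
      = (fderiv ℝ g x (stdVec j) : ℂ) * φ x + (g x : ℂ) * (∂_{stdVec j} φ) x := by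
  rw [SchwartzMap.lineDerivOp_apply_eq_fderiv, SchwartzMap.lineDerivOp_apply_eq_fderiv]
  have h1 : HasFDerivAt (fun x => (g x : ℂ)) (Complex.ofRealCLM.comp (fderiv ℝ g x)) x :=
    Complex.ofRealCLM.hasFDerivAt.comp x (hg.differentiable (by simp) x).hasFDerivAt
  have h2 : HasFDerivAt (testMul g hg φ hφ) _ x := h1.mul φ.differentiableAt.hasFDerivAt
  rw [h2.fderiv]
  change (g x : ℂ) * fderiv ℝ φ x (stdVec j) + φ x * (fderiv ℝ g x (stdVec j) : ℂ) = _
  ring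

theorem hasCompactSupport_lineDeriv {φ : 𝓢(X ν, ℂ)} (hφ : HasCompactSupport (φ : X ν → ℂ))
    (j : Fin ν) : HasCompactSupport ((∂_{stdVec j} φ : 𝓢(X ν, ℂ)) : X ν → ℂ) := by
  have h : ((∂_{stdVec j} φ : 𝓢(X ν, ℂ)) : X ν → ℂ) = fun x => fderiv ℝ φ x (stdVec j) :=
    funext fun x => SchwartzMap.lineDerivOp_apply_eq_fderiv _ _ _
  rw [h]
  exact hφ.fderiv_apply ℝ _

theorem IsCutoff.potentialOp_ofSchwartz (hκ : IsCutoff κ) {φ ψ : 𝓢(X ν, ℂ)}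
    (hφ : HasCompactSupport (φ : X ν → ℂ)) :
    potentialOp κ (H1.ofSchwartz φ) (H1.ofSchwartz ψ)
      = ∫ x, (potential κ x : ℂ) * φ x * starRingEnd ℂ (ψ x) := by
  have hd := fun j => hasCompactSupport_lineDeriv hφ j
  have h1 : potentialOp κ (H1.ofSchwartz φ) (H1.ofSchwartz ψ)
      = inner ℂ (embL2 ψ) (embL2 (testMul (remH κ) hκ.contDiff_remH φ hφ))
        - ∑ j, (inner ℂ (embL2 ψ) (embL2 (testMul (fieldF κ j) (hκ.contDiff_fieldF j) _ (hd j)))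
          + inner ℂ (embL2 (∂_{stdVec j} ψ))
            (embL2 (testMul (fieldF κ j) (hκ.contDiff_fieldF j) φ hφ))) := by
    rw [← inner_mulL2_expWeight hκ.isDecaying_remH]
    simp only [← inner_mulL2_expWeight (hκ.isDecaying_fieldF _)]
    simp only [potentialOp, sub_apply, sum_apply, add_apply, pairOp_apply]
    rfl
  have h2 : ∀ j, inner ℂ (embL2 (∂_{stdVec j} ψ))
      (embL2 (testMul (fieldF κ j) (hκ.contDiff_fieldF j) φ hφ))
      = - inner ℂ (embL2 ψ) (embL2 (∂_{stdVec j} (testMul (fieldF κ j) (hκ.contDiff_fieldF j) φ hφ))) :=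
    fun j => H1.inner_lineDeriv (H1.ofSchwartz (testMul (fieldF κ j) (hκ.contDiff_fieldF j) φ hφ)) j ψ
  rw [h1]
  simp only [h2]
  rw [← sub_eq_zero]
  simp only [← sub_eq_add_neg, ← inner_sub_right]
  rw [← inner_sum, ← inner_sub_right]
  have h3 : ∀ j, embL2 (testMul (fieldF κ j) (hκ.contDiff_fieldF j) _ (hd j))
      - embL2 (∂_{stdVec j} (testMul (fieldF κ j) (hκ.contDiff_fieldF j) φ hφ))
      = embL2 (testMul (fieldF κ j) (hκ.contDiff_fieldF j) _ (hd j)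
        - ∂_{stdVec j} (testMul (fieldF κ j) (hκ.contDiff_fieldF j) φ hφ)) :=
    fun j => (embL2_sub _ _).symm
  simp only [h3]
  rw [← embL2_sum, ← embL2_sub, inner_embL2, sub_eq_zero]
  congr 1
  ext x
  congr 1
  rw [sub_apply, sum_apply, testMul_apply]
  simp only [sub_apply, testMul_apply, lineDeriv_testMul]
  rw [← hκ.sum_fderiv_fieldF x]
  push_cast
  rw [add_mul, Finset.sum_mul]
  simp [add_comm]

theorem IsCutoff.isMultiplicationBy (hκ : IsCutoff κ) :
    IsMultiplicationBy (potential κ) (potentialOp (ν := ν) κ) :=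
  fun _ _ hφ _ => hκ.potentialOp_ofSchwartz hφ

theorem IsMultiplicationBy.unique {V : X ν → ℝ} {S T : H1 ν →L[ℂ] Hneg1 ν}
    (hS : IsMultiplicationBy V S) (hT : IsMultiplicationBy V T) : S = T := by
  ext F G
  refine H1.dense_of_isClosed (s := {F | S F G = T F G})
    (isClosed_eq (by fun_prop) (by fun_prop)) (fun φ hφ => ?_) F
  refine H1.dense_of_isClosed (s := {G | S (H1.ofSchwartz φ) G = T (H1.ofSchwartz φ) G})
    (isClosed_eq (by fun_prop) (by fun_prop)) (fun ψ hψ => ?_) G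
  exact (hS φ ψ hφ hψ).trans (hT φ ψ hφ hψ).symm

theorem IsCutoff.isOfClass (hκ : IsCutoff κ) {u : X ν → X ν} (h : IsAdmissible u) :
    IsOfClass ⊤ u (potentialOp κ) := by
  obtain ⟨W, hW⟩ := exists_isConjGroupH1 h.isField
  refine ⟨W, hW, fun F => ?_⟩
  have hG := isWeaklySmooth_mulL2_toL2 h hW isDecaying_expWeight
  have hGd := isWeaklySmooth_mulL2_d h hW isDecaying_expWeight
  have hK := fun j => isWeaklySmooth_mulL2_toL2 h hW (hκ.isDecaying_fieldF j)
  have hKd := fun j => isWeaklySmooth_mulL2_d h hW (hκ.isDecaying_fieldF j) j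
  have hH := isWeaklySmooth_mulL2_toL2 h hW hκ.isDecaying_remH
  have h1 := (contDiff_pairOp isNorming_testL2 hG hH F).sub (ContDiff.sum (s := Finset.univ)
    fun j _ => (contDiff_pairOp isNorming_testL2 hG (hKd j) F).add
      (contDiff_pairOp isNorming_testL2 (hGd j) (hK j) F))
  refine Eq.subst (motive := fun f => ContDiff ℝ ∞ f) (funext fun t => ?_) h1
  ext G
  simp only [potentialOp, sub_apply, sum_apply, add_apply, ContinuousLinearMap.comp_apply]

end PotentialOperator

end

section

variable {ν : ℕ}

/-! ### Hilbert–Schmidt operators with a vector-valued kernel -/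

section HilbertSchmidt

variable {α H : Type*} [MeasurableSpace α] {μ : Measure α} [NormedAddCommGroup H]
  [InnerProductSpace ℂ H]

/-- The operator `f ↦ ⟪K(·), f⟫` for a square integrable function `K` with values in `H`. -/
def hsOp (K : Lp H 2 μ) : H →L[ℂ] Lp ℂ 2 μ :=
  LinearMap.mkContinuous
    ⟨⟨fun f => ((Lp.memLp K).inner_const (𝕜 := ℂ) f).toLp, fun f g => by
      rw [← MemLp.toLp_add]
      exact MemLp.toLp_congr _ _ (Eventually.of_forall fun x => inner_add_right _ _ _)⟩,
      fun c f => by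
      refine Eq.trans ?_ (MemLp.toLp_const_smul c ((Lp.memLp K).inner_const (𝕜 := ℂ) f))
      exact MemLp.toLp_congr ((Lp.memLp K).inner_const (𝕜 := ℂ) (c • f)) _
        (Eventually.of_forall fun x => inner_smul_right _ _ _)⟩
    ‖K‖ fun f => by
    change ‖((Lp.memLp K).inner_const (𝕜 := ℂ) f).toLp‖ ≤ _
    rw [mul_comm]
    apply Lp.norm_le_mul_norm_of_ae_le_mul
    filter_upwards [((Lp.memLp K).inner_const (𝕜 := ℂ) f).coeFn_toLp] with x hx
    rw [hx, mul_comm]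
    exact norm_inner_le_norm _ _

theorem coeFn_hsOp (K : Lp H 2 μ) (f : H) : hsOp K f =ᵐ[μ] fun x => inner ℂ (K x) f :=
  ((Lp.memLp K).inner_const (𝕜 := ℂ) f).coeFn_toLp

theorem norm_hsOp_le (K : Lp H 2 μ) : ‖hsOp K‖ ≤ ‖K‖ :=
  LinearMap.mkContinuous_norm_le _ (norm_nonneg _) _

theorem hsOp_add (K L : Lp H 2 μ) : hsOp (K + L) = hsOp K + hsOp L := by
  ext f
  filter_upwards [coeFn_hsOp (K + L) f, coeFn_hsOp K f, coeFn_hsOp L f, Lp.coeFn_add K L,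
    Lp.coeFn_add (hsOp K f) (hsOp L f)] with x h1 h2 h3 h4 h5
  rw [h1, h4, add_apply, h5, Pi.add_apply, Pi.add_apply, inner_add_left, h2, h3]

theorem continuous_hsOp : Continuous (hsOp : Lp H 2 μ → H →L[ℂ] Lp ℂ 2 μ) :=
  AddMonoidHomClass.continuous_of_bound (AddMonoidHom.mk' hsOp hsOp_add) 1 fun K => by
    rw [one_mul]
    exact norm_hsOp_le K

theorem isCompactOperator_hsOp (K : Lp H 2 μ) : IsCompactOperator (hsOp K) := by
  refine Lp.induction (by norm_num) (fun K : Lp H 2 μ => IsCompactOperator (hsOp K)) ?_ ?_ ?_ K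
  · intro c s hs hμ
    have h1 : hsOp (indicatorConstLp 2 hs hμ.ne c : Lp H 2 μ)
        = (ContinuousLinearMap.toSpanSingleton ℂ (indicatorConstLp 2 hs hμ.ne (1 : ℂ))).comp
          (innerSL ℂ c) := by
      ext f
      filter_upwards [coeFn_hsOp (indicatorConstLp 2 hs hμ.ne c) f,
        indicatorConstLp_coeFn (p := 2) (hs := hs) (hμs := hμ.ne) (c := c),
        indicatorConstLp_coeFn (p := 2) (hs := hs) (hμs := hμ.ne) (c := (1 : ℂ)),
        Lp.coeFn_smul (inner ℂ c f) (indicatorConstLp 2 hs hμ.ne (1 : ℂ))] with x h1 h2 h3 h4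
      rw [h1, h2]
      change _ = (inner ℂ c f • indicatorConstLp 2 hs hμ.ne (1 : ℂ) : Lp ℂ 2 μ) x
      rw [h4, Pi.smul_apply, h3]
      by_cases hx : x ∈ s <;> simp [hx]
    change IsCompactOperator (hsOp (indicatorConstLp 2 hs hμ.ne c : Lp H 2 μ))
    rw [h1]
    have h2 : IsCompactOperator
        (ContinuousLinearMap.toSpanSingleton ℂ (indicatorConstLp 2 hs hμ.ne (1 : ℂ) : Lp ℂ 2 μ)) :=
      isCompactOperator_of_locallyCompactSpace_rng _
    exact h2.comp_clm _
  · intro f g hf hg _ h1 h2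
    rw [hsOp_add]
    exact h1.add h2
  · exact isClosed_setOfPred_isCompactOperator.preimage continuous_hsOp

end HilbertSchmidt

/-! ### Compactness of `g(q) m(p)` -/

theorem IsDecaying.memLp_two {g : X ν → ℝ} (hg : IsDecaying g) :
    MemLp (fun x => (g x : ℂ)) 2 (volume : Measure (X ν)) := by
  have hc : Continuous fun x => (g x : ℂ) := Complex.continuous_ofReal.comp hg.smooth.continuous
  rw [memLp_two_iff_integrable_sq_norm hc.aestronglyMeasurable]
  obtain ⟨C, hC⟩ := hg.decay 0
  obtain ⟨D, hD⟩ := hg.decay (0 + (volume : Measure (X ν)).integrablePower)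
  have h1 := integrable_of_le_of_pow_mul_le (μ := (volume : Measure (X ν)))
    (f := fun x => ‖(g x : ℂ)‖ ^ 2) (C₁ := C ^ 2) (C₂ := D * C) (k := 0)
    (fun x => ?_) (fun x => ?_) (hc.norm.pow 2).aestronglyMeasurable
  · simpa using h1
  · have h2 := hC x
    rw [pow_zero, one_mul] at h2
    rw [Real.norm_of_nonneg (by positivity), Complex.norm_real, Real.norm_eq_abs]
    gcongr
  · have h2 := hC x
    rw [pow_zero, one_mul] at h2
    rw [Real.norm_of_nonneg (by positivity), Complex.norm_real, Real.norm_eq_abs, sq, ← mul_assoc]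
    exact mul_le_mul (hD x) h2 (abs_nonneg _)
      ((mul_nonneg (by positivity) (abs_nonneg _)).trans (hD x))

/-- The character `ξ ↦ exp(-2πi x·ξ)`. -/
def charConj (x ξ : X ν) : ℂ := Complex.exp (((-2 * Real.pi * inner ℝ ξ x : ℝ) : ℂ) * Complex.I)

theorem norm_charConj (x ξ : X ν) : ‖charConj x ξ‖ = 1 := Complex.norm_exp_ofReal_mul_I _

theorem continuous_charConj : Continuous fun p : X ν × X ν => charConj p.1 p.2 := by
  unfold charConj
  fun_prop

theorem memLp_charConj (x : X ν) : MemLp (charConj x) ∞ (volume : Measure (X ν)) :=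
  memLp_top_of_continuous (continuous_charConj.comp (by fun_prop : Continuous fun ξ => (x, ξ)))
    fun ξ => (norm_charConj x ξ).le

theorem continuous_mulL2_charConj (f : L2 ν) : Continuous fun x => mulL2 (charConj x) f := by
  refine continuous_iff_seqContinuous.2 fun x x₀ hx => ?_
  refine tendsto_mulL2 (fun n => memLp_charConj (x n)) (memLp_charConj x₀)
    (fun n ξ => (norm_charConj _ ξ).le) (fun ξ => (norm_charConj _ ξ).le) (fun ξ => ?_) f
  exact (continuous_charConj.comp (by fun_prop : Continuous fun y => (y, ξ))).continuousAt.tendsto.comp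
    hx

theorem fourierInv_eq_inner (m φ : 𝓢(X ν, ℂ)) (x : X ν) :
    (𝓕⁻ (mulS m φ) : 𝓢(X ν, ℂ)) x = inner ℂ (mulL2 (charConj x) (embL2 (conjS m))) (embL2 φ) := by
  rw [fourierInv_coe, Real.fourierInv_eq', L2.inner_def]
  apply integral_congr_ae
  filter_upwards [coeFn_mulL2 (memLp_charConj x) (embL2 (conjS m)), coeFn_embL2 (conjS m),
    coeFn_embL2 φ] with ξ h1 h2 h3
  rw [h1, h2, h3, RCLike.inner_apply, SchwartzMap.smulLeftCLM_apply_apply m.hasTemperateGrowth,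
    conjS_apply, map_mul, Complex.conj_conj, charConj, ← Complex.exp_conj, map_mul, Complex.conj_I,
    Complex.conj_ofReal, smul_eq_mul, smul_eq_mul]
  push_cast
  ring_nf

theorem memLp_top_schwartz (m : 𝓢(X ν, ℂ)) : MemLp m ∞ (volume : Measure (X ν)) := m.memLp ∞

theorem isCompactOperator_mulL2_fmulL2 {g : X ν → ℝ} (hg : IsDecaying g) (m : 𝓢(X ν, ℂ)) :
    IsCompactOperator ((mulL2 fun x => (g x : ℂ)).comp (fmulL2 m)) := by
  have hK : MemLp (fun x => (g x : ℂ) • mulL2 (charConj x) (embL2 (conjS m))) 2 volume := by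
    refine hg.memLp_two.of_le_mul (c := ‖embL2 (conjS m)‖)
      ((Complex.continuous_ofReal.comp hg.smooth.continuous).smul
        (continuous_mulL2_charConj _)).aestronglyMeasurable (Eventually.of_forall fun x => ?_)
    rw [norm_smul, mul_comm]
    gcongr
    simpa using norm_mulL2_apply_le (memLp_charConj x) (fun ξ => (norm_charConj x ξ).le)
      (embL2 (conjS m))
  have h1 : ∀ f : L2 ν, mulL2 (fun x => (g x : ℂ)) (𝓕⁻ (mulL2 m f)) = hsOp hK.toLp f := by
    intro f
    refine denseRange_embL2.induction_on (p := fun f : L2 ν =>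
      mulL2 (fun x => (g x : ℂ)) (𝓕⁻ (mulL2 m f)) = hsOp hK.toLp f) f (isClosed_eq ?_ ?_) fun φ => ?_
    · exact (mulL2 _).continuous.comp
        ((Lp.fourierTransformₗᵢ (X ν) ℂ).symm.continuous.comp (mulL2 m).continuous)
    · exact (hsOp _).continuous
    · rw [mulL2_embL2 (memLp_top_schwartz m) m.hasTemperateGrowth, SchwartzMap.toLp_fourierInv_eq]
      apply Lp.ext
      filter_upwards [coeFn_mulL2 hg.memLp (embL2 (𝓕⁻ (mulS m φ))), coeFn_embL2 (𝓕⁻ (mulS m φ)),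
        coeFn_hsOp hK.toLp (embL2 φ), hK.coeFn_toLp] with x h1 h2 h3 h4
      rw [h1, h2, h3, h4, inner_smul_left, Complex.conj_ofReal, fourierInv_eq_inner]
  have h2 : ((mulL2 fun x => (g x : ℂ)).comp (fmulL2 m) : L2 ν →L[ℂ] L2 ν)
      = (hsOp hK.toLp).comp
        ((Lp.fourierTransformₗᵢ (X ν) ℂ).toContinuousLinearEquiv : L2 ν →L[ℂ] L2 ν) := by
    ext1 f
    exact h1 _
  rw [h2]
  have h3 : IsCompactOperator (hsOp hK.toLp) := isCompactOperator_hsOp _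
  exact h3.comp_clm _

namespace H1

theorem norm_fmulL2_cutoff_sub_le (F : H1 ν) {c : ℝ} (hc : 0 ≤ c) :
    ‖fmulL2 (cutoff c) (toL2 F) - toL2 F‖ ≤ c * ‖F‖ := by
  have hm : MemLp (cutoff c : X ν → ℂ) ∞ volume :=
    memLp_top_of_continuous (contDiff_cutoff c).continuous (C := 1) fun x => by
      rw [Complex.norm_real, Real.norm_of_nonneg (cutoffR_nonneg _ _)]
      exact cutoffR_le_one _ _
  have h0 : ‖fmulL2 (cutoff c) (toL2 F) - toL2 F‖
      = ‖mulL2 (cutoff c) (𝓕 (toL2 F)) - 𝓕 (toL2 F)‖ := by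
    rw [← fourier_fmulL2, ← norm_fourier_L2]
    exact congrArg norm (map_sub (Lp.fourierTransformₗᵢ (X ν) ℂ) _ _)
  rw [h0]
  refine abs_le_of_sq_le_sq' ?_ (by positivity) |>.2
  rw [norm_sq_eq_integral, mul_pow]
  have h1 : ∑ j, ‖d F j‖ ^ 2 ≤ ‖F‖ ^ 2 := by
    rw [norm_sq_eq]
    exact le_add_of_nonneg_left (sq_nonneg _)
  have h2 : ∑ j, ‖d F j‖ ^ 2 = ∫ ξ, ∑ j, ‖(𝓕 (d F j) : L2 ν) ξ‖ ^ 2 := by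
    rw [integral_finsetSum _ fun j _ => integrable_norm_sq _]
    simp only [← norm_sq_eq_integral, norm_fourier_L2]
  refine le_trans ?_ (mul_le_mul_of_nonneg_left (h2.symm.le.trans h1) (sq_nonneg c))
  rw [← integral_const_mul]
  refine integral_mono_ae (integrable_norm_sq _)
    ((integrable_finsetSum _ fun j _ => integrable_norm_sq _).const_mul _) ?_
  filter_upwards [ae_all_iff.2 fun j => fourier_d F j, coeFn_mulL2 hm (𝓕 (toL2 F)),
    Lp.coeFn_sub (mulL2 (cutoff c) (𝓕 (toL2 F))) (𝓕 (toL2 F))] with ξ hξ h3 h4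
  have h5 : ∑ j, ‖(𝓕 (d F j) : L2 ν) ξ‖ ^ 2
      = (2 * Real.pi) ^ 2 * (‖ξ‖ ^ 2 * ‖(𝓕 (toL2 F) : L2 ν) ξ‖ ^ 2) := by
    rw [EuclideanSpace.norm_sq_eq, Finset.sum_mul, Finset.mul_sum]
    refine Finset.sum_congr rfl fun j _ => ?_
    rw [hξ j, norm_mul tpi, norm_mul (coord j ξ), norm_tpi, Complex.norm_real]
    ring
  have h6 : |cutoffR c ξ - 1| ≤ c * ‖ξ‖ := by
    by_cases hx : c * ‖ξ‖ ≤ 2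
    · rw [cutoffR_eq_one hc hx, sub_self, abs_zero]
      positivity
    · rw [abs_le]
      constructor <;> linarith [cutoffR_nonneg c ξ, cutoffR_le_one c ξ]
  rw [h5, h4, Pi.sub_apply, h3, ← sub_one_mul, norm_mul, ← Complex.ofReal_one, ← Complex.ofReal_sub,
    Complex.norm_real, Real.norm_eq_abs]
  have h7 : 1 ≤ (2 * Real.pi) ^ 2 := by nlinarith [Real.pi_gt_three]
  calc (|cutoffR c ξ - 1| * ‖(𝓕 (toL2 F) : L2 ν) ξ‖) ^ 2
      ≤ (c * ‖ξ‖ * ‖(𝓕 (toL2 F) : L2 ν) ξ‖) ^ 2 := by gcongr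
    _ = c ^ 2 * (1 * (‖ξ‖ ^ 2 * ‖(𝓕 (toL2 F) : L2 ν) ξ‖ ^ 2)) := by ring
    _ ≤ _ := by gcongr

end H1

theorem isCompactOperator_mulOp {g : X ν → ℝ} (hg : IsDecaying g) :
    IsCompactOperator (mulOp g) := by
  set c : ℕ → ℝ := fun n => 1 / ((n : ℝ) + 1) with hc
  have hc0 : ∀ n, 0 < c n := fun n => by positivity
  obtain ⟨C, hC0, hC⟩ := hg.norm_le
  have h1 : Tendsto (fun n => ((mulL2 fun x => (g x : ℂ)).comp (fmulL2 (cutoff (c n)))).comp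
      (H1.toL2CLM (ν := ν))) atTop (𝓝 (mulOp g)) := by
    refine (tendsto_iff_norm_sub_tendsto_zero (E := H1 ν →L[ℂ] L2 ν)).2 ?_
    have h2 : Tendsto (fun n => C * c n) atTop (𝓝 0) := by
      simpa [hc] using (tendsto_one_div_add_atTop_nhds_zero_nat (𝕜 := ℝ)).const_mul C
    refine squeeze_zero (fun n => norm_nonneg (E := H1 ν →L[ℂ] L2 ν) _) (fun n => ?_) h2
    refine ContinuousLinearMap.opNorm_le_bound _ (mul_nonneg hC0 (hc0 n).le) fun F => ?_
    change ‖mulL2 (fun x => (g x : ℂ)) (fmulL2 (cutoff (c n)) (H1.toL2 F))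
      - mulL2 (fun x => (g x : ℂ)) (H1.toL2 F)‖ ≤ _
    rw [← map_sub, mul_assoc]
    exact (norm_mulL2_apply_le hg.memLp hC _).trans
      (mul_le_mul_of_nonneg_left (H1.norm_fmulL2_cutoff_sub_le F (hc0 n).le) hC0)
  refine isCompactOperator_of_tendsto h1 (Eventually.of_forall fun n => ?_)
  have h3 : IsCompactOperator ((mulL2 fun x => (g x : ℂ)).comp (fmulL2 (cutoff (c n)))) :=
    isCompactOperator_mulL2_fmulL2 hg
    ((hasCompactSupport_cutoff (hc0 n).ne').toSchwartzMap (contDiff_cutoff (c n)))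
  exact h3.comp_clm H1.toL2CLM

section Pair

variable {V H : Type*} [NormedAddCommGroup V] [InnerProductSpace ℂ V] [CompleteSpace V]
  [NormedAddCommGroup H] [InnerProductSpace ℂ H] [CompleteSpace H]

/-- Schauder's theorem in Hilbert spaces. -/
theorem isCompactOperator_adjoint {B : V →L[ℂ] H} (hB : IsCompactOperator B) :
    IsCompactOperator (ContinuousLinearMap.adjoint B) := by
  have h1 : IsCompactOperator (B.comp (ContinuousLinearMap.adjoint B)) := hB.comp_clm _
  have h2 : TotallyBounded ((B.comp (ContinuousLinearMap.adjoint B)) '' Metric.closedBall 0 1) :=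
    (IsCompactOperator.isCompact_closure_image_closedBall
      (f := (B.comp (ContinuousLinearMap.adjoint B)).toLinearMap) h1 1).totallyBounded.subset
      subset_closure
  change IsCompactOperator (ContinuousLinearMap.adjoint B).toLinearMap
  rw [isCompactOperator_iff_isCompact_closure_image_closedBall _ zero_lt_one]
  refine TotallyBounded.isCompact_of_isClosed (TotallyBounded.closure ?_) isClosed_closure
  rw [Metric.totallyBounded_iff]
  intro ε hε
  obtain ⟨t, ht, htf, hcov⟩ := totallyBounded_iff_subset.1 h2 _
    (Metric.dist_mem_uniformity (show 0 < ε ^ 2 / 2 by positivity))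
  have ht' : ∀ y ∈ t, ∃ x ∈ Metric.closedBall (0 : H) 1,
      B.comp (ContinuousLinearMap.adjoint B) x = y := fun y hy => ht hy
  choose! p hp using ht'
  refine ⟨(fun y => ContinuousLinearMap.adjoint B (p y)) '' t, htf.image _, ?_⟩
  rintro _ ⟨x, hx, rfl⟩
  obtain ⟨y, hy, hxy⟩ := Set.mem_iUnion₂.1 (hcov ⟨x, hx, rfl⟩)
  obtain ⟨hpy, hpy'⟩ := hp y hy
  refine Set.mem_iUnion₂.2 ⟨_, ⟨y, hy, rfl⟩, ?_⟩
  change dist (B (ContinuousLinearMap.adjoint B x)) y < ε ^ 2 / 2 at hxy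
  change B (ContinuousLinearMap.adjoint B (p y)) = y at hpy'
  rw [← hpy', dist_eq_norm, ← map_sub, ← map_sub] at hxy
  rw [Metric.mem_ball, dist_eq_norm]
  change ‖ContinuousLinearMap.adjoint B x - ContinuousLinearMap.adjoint B (p y)‖ < ε
  rw [← map_sub]
  have h3 : ‖x - p y‖ ≤ 2 := by
    rw [mem_closedBall_zero_iff] at hx hpy
    linarith [norm_sub_le x (p y)]
  refine lt_of_pow_lt_pow_left₀ 2 hε.le ?_
  calc ‖ContinuousLinearMap.adjoint B (x - p y)‖ ^ 2
      = RCLike.re (inner ℂ (B (ContinuousLinearMap.adjoint B (x - p y))) (x - p y)) := by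
        rw [← ContinuousLinearMap.adjoint_inner_right, inner_self_eq_norm_sq]
    _ ≤ ‖B (ContinuousLinearMap.adjoint B (x - p y))‖ * ‖x - p y‖ :=
        (RCLike.re_le_norm _).trans (norm_inner_le_norm _ _)
    _ ≤ ‖B (ContinuousLinearMap.adjoint B (x - p y))‖ * 2 := by gcongr
    _ < ε ^ 2 := by linarith

variable (V) in
/-- The Riesz map onto the antilinear functionals. -/
def rieszMap : V →L[ℂ] (V →L⋆[ℂ] ℂ) := (innerSL ℂ).flip

theorem pairOp_eq_comp (B A : V →L[ℂ] H) :
    pairOp B A = (rieszMap V).comp ((ContinuousLinearMap.adjoint B).comp A) := by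
  ext F G
  change inner ℂ (B G) (A F) = inner ℂ G (ContinuousLinearMap.adjoint B (A F))
  rw [ContinuousLinearMap.adjoint_inner_right]

theorem isCompactOperator_pairOp_left {B A : V →L[ℂ] H} (hB : IsCompactOperator B) :
    IsCompactOperator (pairOp B A) := by
  have h2 : IsCompactOperator ((ContinuousLinearMap.adjoint B).comp A) :=
    (isCompactOperator_adjoint hB).comp_clm A
  rw [pairOp_eq_comp]
  exact h2.continuous_comp (rieszMap V).continuous

theorem isCompactOperator_pairOp_right {B A : V →L[ℂ] H} (hA : IsCompactOperator A) :
    IsCompactOperator (pairOp B A) := by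
  have h2 : IsCompactOperator ((ContinuousLinearMap.adjoint B).comp A) :=
    hA.continuous_comp (ContinuousLinearMap.adjoint B).continuous
  rw [pairOp_eq_comp]
  exact h2.continuous_comp (rieszMap V).continuous

theorem isCompactOperator_pairOp_sub_sum {ι : Type*} (s : Finset ι) {B A : V →L[ℂ] H}
    {Bd Ad Af : ι → V →L[ℂ] H} (hB : IsCompactOperator B) (hAf : ∀ i, IsCompactOperator (Af i)) :
    IsCompactOperator (pairOp B A - ∑ i ∈ s, (pairOp B (Ad i) + pairOp (Bd i) (Af i)) :
      V →L[ℂ] V →L⋆[ℂ] ℂ) := by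
  have h : IsCompactOperator
      (∑ i ∈ s, (pairOp B (Ad i) + pairOp (Bd i) (Af i)) : V →L[ℂ] V →L⋆[ℂ] ℂ) := by
    classical
    induction s using Finset.induction_on with
    | empty => exact isCompactOperator_zero
    | insert i s hi ih =>
      rw [Finset.sum_insert hi]
      have h2 : IsCompactOperator (pairOp B (Ad i) + pairOp (Bd i) (Af i)) :=
        (isCompactOperator_pairOp_left hB).add (isCompactOperator_pairOp_right (hAf i))
      exact h2.add ih
  exact (isCompactOperator_pairOp_left hB).sub h

end Pair

theorem IsCutoff.isCompactOperator_potentialOp {κ : ℝ → ℝ} (hκ : IsCutoff κ) :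
    IsCompactOperator (potentialOp (ν := ν) κ) := by
  have h1 : IsCompactOperator (mulOp (ν := ν) expWeight) := isCompactOperator_mulOp isDecaying_expWeight
  have h2 := fun j => isCompactOperator_mulOp (hκ.isDecaying_fieldF (ν := ν) j)
  have h3 := isCompactOperator_pairOp_sub_sum (V := H1 ν) (H := L2 ν)
    (A := mulOp fun x => remH κ x * expWeightInv x)
    (Ad := fun j => mulD (fun x => fieldF κ j x * expWeightInv x) j) (Bd := mulD expWeight)
    (Finset.univ : Finset (Fin ν)) h1 h2
  exact h3

end

section

variable {ν : ℕ}

/-! ### Lower bounds for oscillating integrals over shells -/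

section Shell

theorem integral_sin_exp_sq_ge {a : ℝ} (ha : 3 ≤ a) :
    1 / 4 ≤ ∫ y in (a - 1)..a, Real.sin (Real.exp y) ^ 2 := by
  set G : ℝ → ℝ := fun y => y / 2 - Real.sin (2 * Real.exp y) * Real.exp (-y) / 4 with hG
  set G' : ℝ → ℝ := fun y =>
    Real.sin (Real.exp y) ^ 2 + Real.sin (2 * Real.exp y) * Real.exp (-y) / 4 with hG'
  have h1 : ∀ y, HasDerivAt G (G' y) y := by
    intro y
    have e1 : HasDerivAt (fun y : ℝ => Real.sin (2 * Real.exp y))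
        (Real.cos (2 * Real.exp y) * (2 * Real.exp y)) y :=
      ((Real.hasDerivAt_exp y).const_mul 2).sin
    have e2 : HasDerivAt (fun y : ℝ => Real.exp (-y)) (Real.exp (-y) * -1) y :=
      (hasDerivAt_neg y).exp
    have e3 := ((hasDerivAt_id y).div_const 2).sub ((e1.mul e2).div_const 4)
    refine e3.congr_deriv ?_
    have e4 : Real.exp y * Real.exp (-y) = 1 := by rw [← Real.exp_add]; simp
    have e5 := Real.cos_two_mul (Real.exp y)
    have e6 := Real.sin_sq_add_cos_sq (Real.exp y)
    simp only [hG']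
    linear_combination (-(Real.cos (2 * Real.exp y)) / 2) * e4 - (1 / 2) * e5 - e6
  have hc : Continuous G' := by fun_prop
  have h2 : ∫ y in (a - 1)..a, G' y = G a - G (a - 1) :=
    intervalIntegral.integral_eq_sub_of_hasDerivAt (fun y _ => h1 y) (hc.intervalIntegrable _ _)
  have h4 : ∀ y : ℝ, 2 ≤ y → Real.exp (-y) ≤ 1 / 4 := by
    intro y hy
    have e1 : Real.exp (-y) ≤ Real.exp (-1) ^ 2 := by
      rw [← Real.exp_nat_mul, Real.exp_le_exp]
      push_cast
      linarith
    have e2 : Real.exp (-1) ≤ 1 / 2 := by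
      rw [Real.exp_neg, one_div]
      exact inv_anti₀ (by norm_num) (by linarith [Real.add_one_le_exp (1 : ℝ)])
    have e3 := Real.exp_pos (-1)
    nlinarith
  have h5 : ∀ y : ℝ, 2 ≤ y → |Real.sin (2 * Real.exp y) * Real.exp (-y)| ≤ 1 / 4 := by
    intro y hy
    rw [abs_mul, abs_of_pos (Real.exp_pos _)]
    have := Real.abs_sin_le_one (2 * Real.exp y)
    nlinarith [h4 y hy, Real.exp_pos (-y), abs_nonneg (Real.sin (2 * Real.exp y))]
  have h6 : ∫ y in (a - 1)..a, (G' y - 1 / 16) ≤ ∫ y in (a - 1)..a, Real.sin (Real.exp y) ^ 2 := by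
    refine intervalIntegral.integral_mono_on (by linarith)
      ((hc.sub continuous_const).intervalIntegrable _ _)
      ((by fun_prop : Continuous fun y => Real.sin (Real.exp y) ^ 2).intervalIntegrable _ _)
      fun y hy => ?_
    have := (abs_le.1 (h5 y (by linarith [hy.1]))).2
    simp only [hG']
    linarith
  rw [intervalIntegral.integral_sub (hc.intervalIntegrable _ _) (by simp), h2] at h6
  have h7 := (abs_le.1 (h5 a (by linarith))).2
  have h8 := (abs_le.1 (h5 (a - 1) (by linarith))).1
  simp only [hG, intervalIntegral.integral_const, smul_eq_mul] at h6
  linarith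

/-- The function `sin(e^{|x|})²` on the shell `a - 1 ≤ |x| ≤ a`. -/
def shell (a : ℝ) (x : X ν) : ℝ :=
  (Set.Icc (a - 1) a).indicator (fun r => Real.sin (Real.exp r) ^ 2) ‖x‖

theorem exists_integral_shell_ge (hν : 1 ≤ ν) :
    ∃ s : ℝ, 0 < s ∧ ∀ a : ℝ, 3 ≤ a → s ≤ ∫ x : X ν, shell a x := by
  have : Nonempty (Fin ν) := ⟨⟨0, hν⟩⟩
  set v : ℝ := (volume : Measure (X ν)).real (Metric.ball 0 1) with hv
  have hv0 : 0 < v := 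
    ENNReal.toReal_pos (Metric.measure_ball_pos _ _ one_pos).ne' measure_ball_lt_top.ne
  refine ⟨v / 4, by positivity, fun a ha => ?_⟩
  have h1 : ∫ x : X ν, shell a x = _ := integral_fun_norm_addHaar (volume : Measure (X ν))
    ((Set.Icc (a - 1) a).indicator fun r => Real.sin (Real.exp r) ^ 2)
  rw [h1, finrank_euclideanSpace_fin, ← hv, nsmul_eq_mul, smul_eq_mul]
  have h2 : ∫ y in Set.Ioi (0 : ℝ), y ^ (ν - 1) •
      (Set.Icc (a - 1) a).indicator (fun r => Real.sin (Real.exp r) ^ 2) y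
      = ∫ y in (a - 1)..a, y ^ (ν - 1) * Real.sin (Real.exp y) ^ 2 := by
    have e1 : (fun y : ℝ => y ^ (ν - 1) •
        (Set.Icc (a - 1) a).indicator (fun r => Real.sin (Real.exp r) ^ 2) y)
        = (Set.Icc (a - 1) a).indicator fun y => y ^ (ν - 1) * Real.sin (Real.exp y) ^ 2 := by
      ext y
      by_cases hy : y ∈ Set.Icc (a - 1) a <;> simp [hy]
    rw [e1, setIntegral_indicator measurableSet_Icc, intervalIntegral.integral_of_le (by linarith),
      Set.inter_eq_right.2, integral_Icc_eq_integral_Ioc]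
    exact fun y hy => Set.mem_Ioi.2 (by linarith [hy.1])
  rw [h2]
  have h3 : (1 : ℝ) / 4 ≤ ∫ y in (a - 1)..a, y ^ (ν - 1) * Real.sin (Real.exp y) ^ 2 := by
    refine (integral_sin_exp_sq_ge ha).trans ?_
    refine intervalIntegral.integral_mono_on (by linarith)
      ((by fun_prop : Continuous fun y => Real.sin (Real.exp y) ^ 2).intervalIntegrable _ _)
      ((by fun_prop : Continuous fun y : ℝ =>
        y ^ (ν - 1) * Real.sin (Real.exp y) ^ 2).intervalIntegrable _ _) fun y hy => ?_
    exact le_mul_of_one_le_left (sq_nonneg _) (one_le_pow₀ (by linarith [hy.1]))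
  have h4 : (1 : ℝ) ≤ ν := by exact_mod_cast hν
  calc v / 4 = 1 * (v * (1 / 4)) := by ring
    _ ≤ _ := by gcongr

theorem shell_eq {a : ℝ} {x : X ν} (hx : ‖x‖ ∈ Set.Icc (a - 1) a) :
    shell a x = Real.sin (Real.exp ‖x‖) ^ 2 := Set.indicator_of_mem hx _

theorem shell_eq_zero {a : ℝ} {x : X ν} (hx : ‖x‖ ∉ Set.Icc (a - 1) a) : shell a x = 0 :=
  Set.indicator_of_notMem hx _

theorem integrable_shell (a : ℝ) : Integrable (shell a : X ν → ℝ) := by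
  have h1 : (shell a : X ν → ℝ) = (norm ⁻¹' Set.Icc (a - 1) a).indicator
      fun x => Real.sin (Real.exp ‖x‖) ^ 2 := rfl
  rw [h1, integrable_indicator_iff (measurable_norm measurableSet_Icc)]
  have h2 : IsCompact (norm ⁻¹' Set.Icc (a - 1) a : Set (X ν)) := by
    refine (isCompact_closedBall (0 : X ν) a).of_isClosed_subset
      (isClosed_Icc.preimage continuous_norm) fun x hx => ?_
    exact mem_closedBall_zero_iff.2 hx.2
  exact ContinuousOn.integrableOn_compact h2 (by fun_prop)

theorem norm_sq_embL2_le {φ : 𝓢(X ν, ℂ)} {B ρ : ℝ} (hρ : 0 ≤ ρ)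
    (hB : ∀ x, ‖φ x‖ ≤ B) (hs : ∀ x, ρ < ‖x‖ → φ x = 0) :
    ‖embL2 φ‖ ^ 2 ≤ B ^ 2 * (ρ ^ ν * (volume : Measure (X ν)).real (Metric.ball 0 1)) := by
  have h1 : ∫ x, ‖embL2 φ x‖ ^ 2 = ∫ x in Metric.closedBall (0 : X ν) ρ, ‖φ x‖ ^ 2 := by
    rw [setIntegral_eq_integral_of_forall_compl_eq_zero]
    · apply integral_congr_ae
      filter_upwards [coeFn_embL2 φ] with x hx
      rw [hx]
    · intro x hx
      rw [hs x (by simpa using hx)]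
      simp
  have h2 : ‖∫ x in Metric.closedBall (0 : X ν) ρ, ‖φ x‖ ^ 2‖
      ≤ B ^ 2 * (volume : Measure (X ν)).real (Metric.closedBall 0 ρ) := by
    refine norm_setIntegral_le_of_norm_le_const measure_closedBall_lt_top fun x _ => ?_
    rw [Real.norm_of_nonneg (by positivity)]
    have := hB x
    gcongr
  rw [Measure.addHaar_real_closedBall _ _ hρ, finrank_euclideanSpace_fin] at h2
  rw [norm_sq_eq_integral, h1]
  exact (le_abs_self _).trans h2

theorem exists_const_mul_pow_lt_exp {α : ℝ} (hα : 0 < α) (k : ℕ) (K : ℝ) :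
    ∃ n₀ : ℕ, ∀ n : ℕ, n₀ ≤ n → K * ((n : ℝ) + 1) ^ k < Real.exp (α * ((n : ℝ) + 1)) := by
  have h1 : Tendsto (fun n : ℕ => α * ((n : ℝ) + 1)) atTop atTop :=
    (tendsto_atTop_add_const_right _ _ tendsto_natCast_atTop_atTop).const_mul_atTop hα
  have h2 := ((Real.tendsto_exp_div_pow_atTop k).comp h1).eventually_gt_atTop (K / α ^ k)
  obtain ⟨n₀, hn₀⟩ := eventually_atTop.1 h2
  refine ⟨n₀, fun n hn => ?_⟩
  have h3 := hn₀ n hn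
  simp only [Function.comp_apply] at h3
  rw [lt_div_iff₀ (by positivity), mul_pow] at h3
  have h4 : α ^ k ≠ 0 := (pow_pos hα k).ne'
  calc K * ((n : ℝ) + 1) ^ k = K / α ^ k * (α ^ k * ((n : ℝ) + 1) ^ k) := by field_simp
    _ < _ := h3

end Shell

/-! ### Plateau functions -/

section Plateau

/-- The function `θ(x / (n + 1))`, equal to one for `|x| ≤ 2 (n + 1)`. -/
def plateau (n : ℕ) : 𝓢(X ν, ℂ) :=
  (hasCompactSupport_cutoff (c := 1 / ((n : ℝ) + 1)) (by positivity)).toSchwartzMap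
    (contDiff_cutoff _)

theorem plateau_apply (n : ℕ) (x : X ν) : plateau n x = cutoff (1 / ((n : ℝ) + 1)) x := rfl

theorem hasCompactSupport_plateau (n : ℕ) : HasCompactSupport (plateau n : X ν → ℂ) :=
  hasCompactSupport_cutoff (by positivity)

theorem norm_plateau_le (n : ℕ) (x : X ν) : ‖plateau n x‖ ≤ 1 := by
  rw [plateau_apply, Complex.norm_real, Real.norm_of_nonneg (cutoffR_nonneg _ _)]
  exact cutoffR_le_one _ _

theorem plateau_eq_zero {n : ℕ} {x : X ν} (hx : 3 * ((n : ℝ) + 1) ≤ ‖x‖) : plateau n x = 0 := by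
  rw [plateau_apply, cutoff, cutoffR_eq_zero (by positivity), Complex.ofReal_zero]
  rw [one_div_mul_eq_div, le_div_iff₀ (by positivity)]
  exact hx

theorem cutoffR_plateau_eq_one {n : ℕ} {x : X ν} (hx : ‖x‖ ≤ 2 * ((n : ℝ) + 1)) :
    cutoffR (1 / ((n : ℝ) + 1)) x = 1 := by
  apply cutoffR_eq_one (by positivity)
  rw [one_div_mul_eq_div, div_le_iff₀ (by positivity)]
  exact hx

/-- The homothety of ratio `1 / (n + 1)`. -/
def shrink (n : ℕ) : X ν ≃L[ℝ] X ν :=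
  ContinuousLinearEquiv.smulLeft (Units.mk0 (1 / ((n : ℝ) + 1)) (by positivity))

theorem shrink_apply (n : ℕ) (x : X ν) : shrink n x = (1 / ((n : ℝ) + 1)) • x := rfl

/-- Composition with the homothety of ratio `1 / (n + 1)`. -/
abbrev compShrink (n : ℕ) : 𝓢(X ν, ℂ) →L[ℂ] 𝓢(X ν, ℂ) :=
  SchwartzMap.compCLMOfContinuousLinearEquiv ℂ (shrink n)

theorem compShrink_apply (n : ℕ) (φ : 𝓢(X ν, ℂ)) (x : X ν) :
    compShrink n φ x = φ ((1 / ((n : ℝ) + 1)) • x) := rfl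

theorem plateau_eq (n : ℕ) : (plateau n : 𝓢(X ν, ℂ)) = compShrink n (plateau 0) := by
  ext x
  rw [compShrink_apply, plateau_apply, plateau_apply, cutoff, cutoff, cutoffR, cutoffR]
  simp

theorem lineDeriv_compShrink (n : ℕ) (φ : 𝓢(X ν, ℂ)) (m : X ν) :
    ∂_{m} (compShrink n φ) = (1 / ((n : ℝ) + 1)) • compShrink n (∂_{m} φ) := by
  rw [SchwartzMap.lineDerivOp_compCLMOfContinuousLinearEquiv, shrink_apply, lineDerivOp_left_smul]
  ext x
  rfl

theorem exists_norm_le (φ : 𝓢(X ν, ℂ)) : ∃ C : ℝ, 0 ≤ C ∧ ∀ x, ‖φ x‖ ≤ C := by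
  obtain ⟨C, hC0, hC⟩ := φ.decay 0 0
  exact ⟨C, hC0.le, fun x => by simpa using hC x⟩

theorem inv_natCast_add_one_le (n : ℕ) : 1 / ((n : ℝ) + 1) ≤ 1 := by
  rw [div_le_one (by positivity)]
  linarith [(Nat.cast_nonneg n : (0 : ℝ) ≤ n)]

theorem exists_norm_lineDeriv_plateau_le :
    ∃ C : ℝ, 0 ≤ C ∧ ∀ (n : ℕ) (j : Fin ν) (x : X ν), ‖(∂_{stdVec j} (plateau n : 𝓢(X ν, ℂ))) x‖ ≤ C := by
  choose C hC0 hC using fun j : Fin ν => exists_norm_le (∂_{stdVec j} (plateau 0 : 𝓢(X ν, ℂ)))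
  refine ⟨∑ j, C j, Finset.sum_nonneg fun j _ => hC0 j, fun n j x => ?_⟩
  rw [plateau_eq, lineDeriv_compShrink, smul_apply, norm_smul,
    Real.norm_of_nonneg (by positivity)]
  calc 1 / ((n : ℝ) + 1) * ‖compShrink n (∂_{stdVec j} (plateau 0)) x‖
      ≤ 1 * C j := mul_le_mul (inv_natCast_add_one_le n) (hC j _) (norm_nonneg _) zero_le_one
    _ ≤ _ := by
      rw [one_mul]
      exact Finset.single_le_sum (fun j _ => hC0 j) (Finset.mem_univ j)

theorem exists_norm_laplacian_plateau_le :
    ∃ C : ℝ, 0 ≤ C ∧ ∀ (n : ℕ) (x : X ν), ‖(Δ (plateau n : 𝓢(X ν, ℂ))) x‖ ≤ C := by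
  obtain ⟨C, hC0, hC⟩ := exists_norm_le (Δ (plateau 0 : 𝓢(X ν, ℂ)))
  refine ⟨C, hC0, fun n x => ?_⟩
  have h1 : Δ (plateau n : 𝓢(X ν, ℂ)) = (1 / ((n : ℝ) + 1)) ^ 2 • compShrink n (Δ (plateau 0)) := by
    rw [plateau_eq, SchwartzMap.laplacian_eq_sum (EuclideanSpace.basisFun (Fin ν) ℝ),
      SchwartzMap.laplacian_eq_sum (EuclideanSpace.basisFun (Fin ν) ℝ), map_sum, Finset.smul_sum]
    refine Finset.sum_congr rfl fun j _ => ?_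
    rw [lineDeriv_compShrink, lineDerivOp_smul, lineDeriv_compShrink, smul_smul, sq]
  rw [h1, smul_apply, norm_smul, Real.norm_of_nonneg (by positivity)]
  calc (1 / ((n : ℝ) + 1)) ^ 2 * ‖compShrink n (Δ (plateau 0)) x‖
      ≤ 1 * C := mul_le_mul (pow_le_one₀ (by positivity) (inv_natCast_add_one_le n)) (hC _)
        (norm_nonneg _) zero_le_one
    _ = C := one_mul C

theorem lineDeriv_eq_zero {φ : 𝓢(X ν, ℂ)} {ρ : ℝ} (h : ∀ x, ρ < ‖x‖ → φ x = 0) (j : Fin ν)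
    {x : X ν} (hx : ρ < ‖x‖) : (∂_{stdVec j} φ) x = 0 := by
  rw [SchwartzMap.lineDerivOp_apply_eq_fderiv]
  have h1 : (φ : X ν → ℂ) =ᶠ[𝓝 x] fun _ => 0 := by
    filter_upwards [(continuous_norm.tendsto x).eventually_const_lt hx] with y hy
    exact h y hy
  rw [h1.fderiv_eq, fderiv_fun_const]
  rfl

theorem plateau_eq_zero_of_lt (n : ℕ) (x : X ν) (hx : 3 * ((n : ℝ) + 1) < ‖x‖) :
    plateau n x = 0 := plateau_eq_zero hx.le

theorem laplacian_eq_zero {φ : 𝓢(X ν, ℂ)} {ρ : ℝ} (h : ∀ x, ρ < ‖x‖ → φ x = 0)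
    {x : X ν} (hx : ρ < ‖x‖) : (Δ φ) x = 0 := by
  rw [SchwartzMap.laplacian_eq_sum (EuclideanSpace.basisFun (Fin ν) ℝ), sum_apply]
  refine Finset.sum_eq_zero fun j _ => ?_
  rw [EuclideanSpace.basisFun_apply]
  exact lineDeriv_eq_zero (fun y hy => lineDeriv_eq_zero h j hy) j hx

end Plateau

/-! ### The potential is not bounded relative to the Laplacian -/

section NotLaplacianBounded

variable {κ : ℝ → ℝ}

theorem IsCutoff.exists_eq_zero (hκ : IsCutoff κ) : ∃ r₀ : ℝ, ∀ r, r₀ ≤ r → κ r = 0 := by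
  obtain ⟨M, hM⟩ := hκ.supp.isCompact.isBounded.exists_norm_le
  refine ⟨M + 1, fun r hr => image_eq_zero_of_notMem_tsupport fun h => ?_⟩
  have h1 := (le_abs_self r).trans (hM r h)
  linarith

theorem laplacian_embL2 (φ : 𝓢(X ν, ℂ)) :
    Δ (embL2 φ : 𝓢'(X ν, ℂ)) = (embL2 (Δ φ) : 𝓢'(X ν, ℂ)) := by
  have h1 := Lp.toTemperedDistribution_toLp_eq (μ := (volume : Measure (X ν))) (p := 2) φ
  have h2 := Lp.toTemperedDistribution_toLp_eq (μ := (volume : Measure (X ν))) (p := 2) (Δ φ)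
  exact (congrArg (fun T : 𝓢'(X ν, ℂ) => Δ T) h1).trans
    ((TemperedDistribution.laplacian_toTemperedDistributionCLM_eq φ).trans h2.symm)

theorem memSobolev_embL2 (φ : 𝓢(X ν, ℂ)) :
    TemperedDistribution.MemSobolev 2 2 (embL2 φ : 𝓢'(X ν, ℂ)) := by
  have h1 := Lp.toTemperedDistribution_toLp_eq (μ := (volume : Measure (X ν))) (p := 2) φ
  exact h1.symm ▸ SchwartzMap.memSobolev φ

theorem shell_le_sq_potential {a : ℝ} (ha : ∀ r, a - 1 ≤ r → κ r = 0)
    (x : X ν) : Real.exp (3 / 2 * (a - 1)) * shell a x ≤ potential κ x ^ 2 := by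
  by_cases hx : ‖x‖ ∈ Set.Icc (a - 1) a
  · rw [shell_eq hx, potential, ha _ hx.1, sub_zero, one_mul, mul_pow, ← Real.exp_nat_mul]
    refine mul_le_mul_of_nonneg_right (Real.exp_le_exp.2 ?_) (sq_nonneg _)
    push_cast
    linarith [hx.1]
  · rw [shell_eq_zero hx, mul_zero]
    exact sq_nonneg _

theorem IsCutoff.not_isLaplacianBounded (hκ : IsCutoff κ) (hν : 1 ≤ ν) :
    ¬ IsLaplacianBounded (potential (ν := ν) κ) := by
  rintro ⟨a, b, hab⟩
  obtain ⟨s, hs0, hs⟩ := exists_integral_shell_ge hν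
  obtain ⟨r₀, hr₀⟩ := hκ.exists_eq_zero
  obtain ⟨C, hC0, hC⟩ := exists_norm_laplacian_plateau_le (ν := ν)
  set v : ℝ := (volume : Measure (X ν)).real (Metric.ball 0 1) with hv
  set K : ℝ := (2 * a ^ 2 * C ^ 2 + 2 * b ^ 2) * 3 ^ ν * v * Real.exp (3 / 2) / s with hK
  obtain ⟨n₀, hn₀⟩ := exists_const_mul_pow_lt_exp (α := 3) (by norm_num) ν K
  obtain ⟨n₁, hn₁⟩ := exists_nat_ge r₀
  set n : ℕ := max n₀ (max n₁ 1) with hn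
  have hn1 : (1 : ℝ) ≤ n := by
    exact_mod_cast (le_max_right n₁ 1).trans (le_max_right n₀ _)
  have hnr : r₀ ≤ n := hn₁.trans (by exact_mod_cast (le_max_left n₁ 1).trans (le_max_right n₀ _))
  set R : ℝ := (n : ℝ) + 1 with hR
  obtain ⟨hV, hle⟩ := hab (embL2 (plateau n)) (embL2 (Δ (plateau n))) (memSobolev_embL2 _)
    (laplacian_embL2 _)
  have h1 : Real.exp (3 / 2 * (2 * R - 1)) * s ≤ ‖hV.toLp‖ ^ 2 := by
    rw [norm_sq_eq_integral]
    refine (mul_le_mul_of_nonneg_left (hs (2 * R) (by linarith)) (Real.exp_pos _).le).trans ?_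
    rw [← integral_const_mul]
    refine integral_mono_ae ((integrable_shell _).const_mul _) (integrable_norm_sq _) ?_
    filter_upwards [hV.coeFn_toLp, coeFn_embL2 (plateau n : 𝓢(X ν, ℂ))] with x hx hx'
    rw [hx, hx', norm_mul, Complex.norm_real, Real.norm_eq_abs, mul_pow, sq_abs]
    by_cases hx2 : ‖x‖ ∈ Set.Icc (2 * R - 1) (2 * R)
    · rw [plateau_apply, cutoff, cutoffR_plateau_eq_one hx2.2]
      simpa using shell_le_sq_potential (fun r hr => hr₀ r (by linarith)) x
    · simp only [shell_eq_zero hx2, mul_zero]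
      positivity
  have h2 : ‖embL2 (plateau n : 𝓢(X ν, ℂ))‖ ^ 2 ≤ 1 ^ 2 * ((3 * R) ^ ν * v) :=
    norm_sq_embL2_le (by positivity) (norm_plateau_le n) (plateau_eq_zero_of_lt n)
  have h3 : ‖embL2 (Δ (plateau n : 𝓢(X ν, ℂ)))‖ ^ 2 ≤ C ^ 2 * ((3 * R) ^ ν * v) :=
    norm_sq_embL2_le (by positivity) (hC n)
      (fun x hx => laplacian_eq_zero (plateau_eq_zero_of_lt n) hx)
  have h4 : ‖hV.toLp‖ ^ 2 ≤ (2 * a ^ 2 * C ^ 2 + 2 * b ^ 2) * ((3 * R) ^ ν * v) := by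
    set p := ‖embL2 (Δ (plateau n : 𝓢(X ν, ℂ)))‖
    set q := ‖embL2 (plateau n : 𝓢(X ν, ℂ))‖
    calc ‖hV.toLp‖ ^ 2 ≤ (a * p + b * q) ^ 2 := pow_le_pow_left₀ (norm_nonneg _) hle 2
      _ ≤ 2 * a ^ 2 * p ^ 2 + 2 * b ^ 2 * q ^ 2 := by nlinarith [sq_nonneg (a * p - b * q)]
      _ ≤ 2 * a ^ 2 * (C ^ 2 * ((3 * R) ^ ν * v)) + 2 * b ^ 2 * (1 ^ 2 * ((3 * R) ^ ν * v)) := by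
        gcongr
      _ = _ := by ring
  have h5 := hn₀ n (le_max_left _ _)
  have h6 : Real.exp (3 * R) = Real.exp (3 / 2 * (2 * R - 1)) * Real.exp (3 / 2) := by
    rw [← Real.exp_add]
    ring_nf
  have h7 : K * R ^ ν * s
      = (2 * a ^ 2 * C ^ 2 + 2 * b ^ 2) * ((3 * R) ^ ν * v) * Real.exp (3 / 2) := by
    rw [hK, mul_pow]
    field_simp
  have h8 := mul_lt_mul_of_pos_right h5 hs0
  rw [h7, h6] at h8
  have h9 := mul_le_mul_of_nonneg_right (h1.trans h4) (Real.exp_pos (3 / 2)).le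
  linarith

end NotLaplacianBounded

end

section

variable {ν : ℕ}

/-! ### Boundedness of the commutator for operators of class `C¹` -/

section Commutator

theorem exists_bound_of_differentiableAt {V : Type*} [NormedAddCommGroup V] [NormedSpace ℂ V]
    [CompleteSpace V] {T : V →L[ℂ] V →L⋆[ℂ] ℂ} {W : ℝ → V →L[ℂ] V}
    (h0 : W 0 = ContinuousLinearMap.id ℂ V)
    (h : ∀ f, DifferentiableAt ℝ (fun t : ℝ => ((T (W (-t) f)).comp (W (-t)) : V →L⋆[ℂ] ℂ)) 0) :
    ∃ C : ℝ, 0 ≤ C ∧ ∀ (n : ℕ) (f g : V), ‖T (W (-(1 / ((n : ℝ) + 1))) f) (W (-(1 / ((n : ℝ) + 1))) g)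
      - T f g‖ ≤ C * (1 / ((n : ℝ) + 1)) * ‖f‖ * ‖g‖ := by
  set s : ℕ → ℝ := fun n => 1 / ((n : ℝ) + 1) with hs
  have hs0 : ∀ n, 0 < s n := fun n => by positivity
  have hlim : Tendsto s atTop (𝓝 0) := tendsto_one_div_add_atTop_nhds_zero_nat
  set D : ℕ → V →L[ℂ] V →L⋆[ℂ] ℂ := fun n => (((s n)⁻¹ : ℝ) : ℂ) •
    (((ContinuousLinearMap.precomp ℂ (W (-s n))).comp (T.comp (W (-s n)))) - T) with hD
  have hDa : ∀ n f, D n f = (((s n)⁻¹ : ℝ) : ℂ) • ((T (W (-s n) f)).comp (W (-s n)) - T f) :=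
    fun n f => rfl
  obtain ⟨C, hC⟩ : ∃ C, ∀ n, ‖D n‖ ≤ C := by
    refine banach_steinhaus fun f => ?_
    have h1 := (h f).hasDerivAt.isBigO_sub.comp_tendsto hlim
    obtain ⟨C, hC⟩ := (Asymptotics.isBigO_nat_atTop_iff fun n hn => by
      simp only [Function.comp_apply, sub_zero] at hn
      exact absurd hn (hs0 n).ne').1 h1
    refine ⟨C, fun n => ?_⟩
    have h2 := hC n
    simp only [Function.comp_apply, neg_zero, h0, sub_zero] at h2
    rw [hDa, norm_smul, Complex.norm_real, norm_inv, inv_mul_le_iff₀ (norm_pos_iff.2 (hs0 n).ne'),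
      mul_comm]
    exact h2
  refine ⟨C, (norm_nonneg (D 0)).trans (hC 0), fun n f g => ?_⟩
  have h1 : T (W (-s n) f) (W (-s n) g) - T f g = ((s n : ℝ) : ℂ) * D n f g := by
    rw [hDa]
    change _ = ((s n : ℝ) : ℂ) * ((((s n)⁻¹ : ℝ) : ℂ) * (T (W (-s n) f) (W (-s n) g) - T f g))
    rw [← mul_assoc, ← Complex.ofReal_mul, mul_inv_cancel₀ (hs0 n).ne', Complex.ofReal_one, one_mul]
  have h2 : ‖D n f g‖ ≤ C * ‖f‖ * ‖g‖ :=
    ((D n f).le_opNorm g).trans (mul_le_mul_of_nonneg_right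
      (((D n).le_opNorm f).trans (mul_le_mul_of_nonneg_right (hC n) (norm_nonneg _)))
      (norm_nonneg _))
  change ‖T (W (-s n) f) (W (-s n) g) - T f g‖ ≤ C * s n * ‖f‖ * ‖g‖
  rw [h1, norm_mul, Complex.norm_real, Real.norm_of_nonneg (hs0 n).le]
  calc s n * ‖D n f g‖ ≤ s n * (C * ‖f‖ * ‖g‖) := mul_le_mul_of_nonneg_left h2 (hs0 n).le
    _ = _ := by ring

variable {V : X ν → ℝ} {T : H1 ν →L[ℂ] Hneg1 ν}

theorem IsMultiplicationBy.apply_ofSchwartz_right (hT : IsMultiplicationBy V T)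
    (hV : ContDiff ℝ ∞ V) {ψ : 𝓢(X ν, ℂ)} (hψ : HasCompactSupport (ψ : X ν → ℂ)) (F : H1 ν) :
    T F (H1.ofSchwartz ψ) = inner ℂ (embL2 (testMul V hV ψ hψ)) (H1.toL2 F) := by
  refine H1.dense_of_isClosed (s := {F | T F (H1.ofSchwartz ψ)
      = inner ℂ (embL2 (testMul V hV ψ hψ)) (H1.toL2 F)})
    (isClosed_eq (by fun_prop) (continuous_const.inner H1.toL2CLM.continuous)) (fun φ hφ => ?_) F
  change T (H1.ofSchwartz φ) (H1.ofSchwartz ψ) = inner ℂ (embL2 (testMul V hV ψ hψ)) (embL2 φ)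
  rw [hT φ ψ hφ hψ, inner_embL2]
  congr 1
  ext x
  rw [testMul_apply, map_mul, Complex.conj_ofReal]
  ring

theorem IsMultiplicationBy.apply_ofSchwartz_left (hT : IsMultiplicationBy V T)
    (hV : ContDiff ℝ ∞ V) {φ : 𝓢(X ν, ℂ)} (hφ : HasCompactSupport (φ : X ν → ℂ)) (G : H1 ν) :
    T (H1.ofSchwartz φ) G = inner ℂ (H1.toL2 G) (embL2 (testMul V hV φ hφ)) := by
  refine H1.dense_of_isClosed (s := {G | T (H1.ofSchwartz φ) G
      = inner ℂ (H1.toL2 G) (embL2 (testMul V hV φ hφ))})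
    (isClosed_eq (by fun_prop) (H1.toL2CLM.continuous.inner continuous_const)) (fun ψ hψ => ?_) G
  change T (H1.ofSchwartz φ) (H1.ofSchwartz ψ) = inner ℂ (embL2 ψ) (embL2 (testMul V hV φ hφ))
  rw [hT φ ψ hφ hψ, inner_embL2]
  rfl

theorem norm_commutator_le {u : X ν → X ν} {U : ℝ → L2 ν →L[ℂ] L2 ν} (hU : IsConjGroup u U)
    {φ ψ : 𝓢(X ν, ℂ)} {a b : L2 ν} (hab : inner ℂ a (embL2 φ) = inner ℂ (embL2 ψ) b) {M : ℝ}
    (h : ∀ n : ℕ, ‖inner ℂ a (U (-(1 / ((n : ℝ) + 1))) (embL2 φ))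
      - inner ℂ (U (1 / ((n : ℝ) + 1)) (embL2 ψ)) b‖ ≤ 1 / ((n : ℝ) + 1) * M) :
    ‖inner ℂ a (Complex.I • embL2 (conjOp u φ))
      + inner ℂ (Complex.I • embL2 (conjOp u ψ)) b‖ ≤ M := by
  set k : ℝ → ℂ := fun t => inner ℂ a (U (-t) (embL2 φ)) - inner ℂ (U t (embL2 ψ)) b with hk
  have hd1 : HasDerivAt (fun t : ℝ => U (-t) (embL2 φ)) (-(Complex.I • embL2 (conjOp u φ))) 0 := by
    have h1 : HasDerivAt (fun t => U t (embL2 φ)) (Complex.I • embL2 (conjOp u φ)) (-0) := by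
      rw [neg_zero]
      exact hU.hasDerivAt_zero φ
    have h2 := h1.scomp (0 : ℝ) (hasDerivAt_neg (0 : ℝ))
    rw [neg_one_smul] at h2
    exact h2
  have hd : HasDerivAt k (-(inner ℂ a (Complex.I • embL2 (conjOp u φ))
      + inner ℂ (Complex.I • embL2 (conjOp u ψ)) b)) 0 := by
    have h1 := (HasDerivAt.inner ℂ (hasDerivAt_const (0 : ℝ) a) hd1).sub
      (HasDerivAt.inner ℂ (hU.hasDerivAt_zero ψ) (hasDerivAt_const (0 : ℝ) b))
    refine h1.congr_deriv ?_
    rw [inner_neg_right, inner_zero_left, inner_zero_right]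
    ring
  have hlim : Tendsto (fun n : ℕ => 1 / ((n : ℝ) + 1)) atTop (𝓝[>] 0) :=
    tendsto_nhdsWithin_iff.2 ⟨tendsto_one_div_add_atTop_nhds_zero_nat,
      Eventually.of_forall fun n => Set.mem_Ioi.2 (by positivity)⟩
  have h1 := (hd.tendsto_slope_zero_right.comp hlim).norm
  rw [norm_neg] at h1
  refine le_of_tendsto h1 (Eventually.of_forall fun n => ?_)
  have hs0 : 0 < 1 / ((n : ℝ) + 1) := by positivity
  have hk0 : k 0 = 0 := by
    simp only [hk, neg_zero, hU.map_zero]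
    exact sub_eq_zero.2 hab
  simp only [Function.comp_apply, zero_add]
  rw [hk0, sub_zero, norm_smul, norm_inv, Real.norm_of_nonneg hs0.le, inv_mul_le_iff₀ hs0]
  exact h n

theorem IsConjGroupH1.map_zero {u : X ν → X ν} {W : ℝ → H1 ν →L[ℂ] H1 ν}
    (hW : IsConjGroupH1 u W) : W 0 = ContinuousLinearMap.id ℂ (H1 ν) := by
  obtain ⟨U, hU, hWU⟩ := hW
  ext1 F
  refine H1.toL2_injective ?_
  rw [hWU, hU.map_zero]
  rfl

theorem IsConjGroupH1.exists_norm_apply_le {u : X ν → X ν} (hu : IsField u)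
    {W : ℝ → H1 ν →L[ℂ] H1 ν} (hW : IsConjGroupH1 u W) :
    ∃ K : ℝ, 0 ≤ K ∧ ∀ s : ℝ, 0 ≤ s → s ≤ 1 → ∀ F, ‖W s F‖ ≤ K * ‖F‖ := by
  obtain ⟨K, c, hKc⟩ := IsConjGroupH1.norm_le hu
  have hWn := hKc W hW
  have hK0 : 0 ≤ K := by
    have h1 := (norm_nonneg (W 0)).trans (hWn 0)
    simpa using h1
  refine ⟨K * Real.exp |c|, by positivity, fun s hs0 hs1 F => ?_⟩
  refine ((W s).le_opNorm F).trans (mul_le_mul_of_nonneg_right ((hWn s).trans ?_) (norm_nonneg _))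
  refine mul_le_mul_of_nonneg_left (Real.exp_le_exp.2 ?_) hK0
  rw [abs_of_nonneg hs0]
  calc c * s ≤ |c| * s := mul_le_mul_of_nonneg_right (le_abs_self c) hs0
    _ ≤ |c| * 1 := mul_le_mul_of_nonneg_left hs1 (abs_nonneg c)
    _ = |c| := mul_one _

theorem IsOfClass.exists_difference_le {u : X ν → X ν} (h : IsOfClass 1 u T) (hu : IsField u) :
    ∃ U : ℝ → L2 ν →L[ℂ] L2 ν, IsConjGroup u U ∧ ∃ W : ℝ → H1 ν →L[ℂ] H1 ν,
      (∀ (t : ℝ) (f : H1 ν), H1.toL2 (W t f) = U t (H1.toL2 f)) ∧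
      ∃ C : ℝ, 0 ≤ C ∧ ∀ (n : ℕ) (F G : H1 ν),
        ‖T (W (-(1 / ((n : ℝ) + 1))) F) G - T F (W (1 / ((n : ℝ) + 1)) G)‖
          ≤ 1 / ((n : ℝ) + 1) * (C * ‖F‖ * ‖G‖) := by
  obtain ⟨W, hW, hdiff⟩ := h
  obtain ⟨K, hK0, hK⟩ := hW.exists_norm_apply_le hu
  obtain ⟨C, hC0, hC⟩ := exists_bound_of_differentiableAt hW.map_zero
    fun f => ((hdiff f).differentiable (by simp)).differentiableAt
  obtain ⟨U, hU, hWU⟩ := hW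
  refine ⟨U, hU, W, hWU, C * K, by positivity, fun n F G => ?_⟩
  have hs0 : 0 < 1 / ((n : ℝ) + 1) := by positivity
  have hs1 := inv_natCast_add_one_le n
  have h2 := hC n F (W (1 / ((n : ℝ) + 1)) G)
  set s : ℝ := 1 / ((n : ℝ) + 1)
  have e0 : W (-s) (W s G) = G := by
    refine H1.toL2_injective ?_
    rw [hWU, hWU, hU.apply_neg_apply]
  rw [e0] at h2
  calc ‖T (W (-s) F) G - T F (W s G)‖ ≤ C * s * ‖F‖ * ‖W s G‖ := h2
    _ ≤ C * s * ‖F‖ * (K * ‖G‖) := mul_le_mul_of_nonneg_left (hK s hs0.le hs1 G) (by positivity)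
    _ = _ := by ring

theorem IsOfClass.exists_commutator_le {u : X ν → X ν} (h : IsOfClass 1 u T) (hu : IsField u)
    (hT : IsMultiplicationBy V T) (hV : ContDiff ℝ ∞ V) :
    ∃ C : ℝ, 0 ≤ C ∧ ∀ (φ ψ : 𝓢(X ν, ℂ)) (hφ : HasCompactSupport (φ : X ν → ℂ))
      (hψ : HasCompactSupport (ψ : X ν → ℂ)),
      ‖inner ℂ (embL2 (testMul V hV ψ hψ)) (Complex.I • embL2 (conjOp u φ))
        + inner ℂ (Complex.I • embL2 (conjOp u ψ)) (embL2 (testMul V hV φ hφ))‖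
        ≤ C * ‖H1.ofSchwartz φ‖ * ‖H1.ofSchwartz ψ‖ := by
  obtain ⟨U, hU, W, hWU, C, hC0, hC⟩ := h.exists_difference_le hu
  refine ⟨C, hC0, fun φ ψ hφ hψ => norm_commutator_le hU ?_ fun n => ?_⟩
  · exact (hT.apply_ofSchwartz_right hV hψ (H1.ofSchwartz φ)).symm.trans
      (hT.apply_ofSchwartz_left hV hφ (H1.ofSchwartz ψ))
  · have h1 := hC n (H1.ofSchwartz φ) (H1.ofSchwartz ψ)
    rw [hT.apply_ofSchwartz_right hV hψ, hT.apply_ofSchwartz_left hV hφ, hWU, hWU] at h1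
    exact h1

end Commutator

/-! ### The generator of dilations -/

theorem fderiv_apply_self (φ : 𝓢(X ν, ℂ)) (x : X ν) :
    fderiv ℝ φ x x = ∑ j, coord j x * (∂_{stdVec j} φ) x := by
  have h1 : x = ∑ j, x j • (stdVec j : X ν) := by
    have h2 := (EuclideanSpace.basisFun (Fin ν) ℝ).sum_repr x
    simpa using h2.symm
  conv_lhs => rw [show fderiv ℝ φ x x = fderiv ℝ φ x (∑ j, x j • (stdVec j : X ν)) by rw [← h1]]
  rw [map_sum]
  refine Finset.sum_congr rfl fun j _ => ?_
  rw [map_smul, SchwartzMap.lineDerivOp_apply_eq_fderiv, Complex.real_smul]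

theorem pd_coord_self (j : Fin ν) : pd j (coord j) = fun _ : X ν => (1 : ℂ) := by
  ext x
  have h1 : HasFDerivAt (coord j) (Complex.ofRealCLM.comp (EuclideanSpace.proj j : X ν →L[ℝ] ℝ)) x :=
    (Complex.ofRealCLM.comp (EuclideanSpace.proj j : X ν →L[ℝ] ℝ)).hasFDerivAt
  rw [pd, h1.fderiv]
  simp [stdVec]

theorem I_smul_conjOp_dilationField_apply (φ : 𝓢(X ν, ℂ)) (x : X ν) :
    (Complex.I • conjOp (dilationField ν) φ) x = fderiv ℝ φ x x + (ν / 2 : ℂ) * φ x := by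
  have h1 : ∀ (j : Fin ν) (ψ : 𝓢(X ν, ℂ)),
      Complex.I • mulF (fun ξ : X ν => ((dilationField ν ((2 * Real.pi) • ξ) j : ℝ) : ℂ)) ψ
        = ∂_{stdVec j} ψ := by
    intro j ψ
    have hs : (fun ξ : X ν => ((dilationField ν ((2 * Real.pi) • ξ) j : ℝ) : ℂ))
        = fun ξ => (2 * Real.pi : ℂ) * coord j ξ := by
      ext ξ
      simp [dilationField]
    rw [hs, mulF_const_mul (hasTemperateGrowth_coord j), smul_smul, lineDeriv_eq_mulF, tpi]
    congr 1
    ring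
  have h2 : Complex.I • conjOp (dilationField ν) φ = (1 / 2 : ℂ) • ∑ j : Fin ν,
      (∂_{stdVec j} (mulS (coord j) φ) + mulS (coord j) (∂_{stdVec j} φ)) := by
    rw [conjOp, smul_comm, Finset.smul_sum]
    congr 1
    refine Finset.sum_congr rfl fun j _ => ?_
    rw [smul_add, h1, ← map_smul, h1]
  rw [h2, smul_apply, sum_apply, fderiv_apply_self, Finset.smul_sum]
  have h3 : ∀ j : Fin ν, (1 / 2 : ℂ) • (∂_{stdVec j} (mulS (coord j) φ)
      + mulS (coord j) (∂_{stdVec j} φ)) x = coord j x * (∂_{stdVec j} φ) x + 1 / 2 * φ x := by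
    intro j
    rw [lineDeriv_mulS (hasTemperateGrowth_coord j), pd_coord_self, add_apply, add_apply,
      SchwartzMap.smulLeftCLM_apply_apply (hasTemperateGrowth_coord j),
      SchwartzMap.smulLeftCLM_apply_apply (Function.HasTemperateGrowth.const 1)]
    simp only [smul_eq_mul]
    ring
  rw [Finset.sum_congr rfl fun j _ => h3 j, Finset.sum_add_distrib, Finset.sum_const,
    Finset.card_univ, Fintype.card_fin, nsmul_eq_mul]
  ring

/-! ### The radial part of the test functions -/

section Radial

variable {κ : ℝ → ℝ}

/-- The radial profile of the potential. -/
def profV (κ : ℝ → ℝ) (r : ℝ) : ℝ := (1 - κ r) * Real.exp (3 * r / 4) * Real.sin (Real.exp r)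

/-- The profile `(1 - κ(r)) cos(e^r)`. -/
def profQ (κ : ℝ → ℝ) (r : ℝ) : ℝ := (1 - κ r) * Real.cos (Real.exp r)

/-- The function `(1 - κ(|x|)) cos(e^{|x|})`. -/
def oscQ (κ : ℝ → ℝ) (x : X ν) : ℝ := profQ κ ‖x‖

theorem profQ_abs_le (h : ∀ t, 0 ≤ κ t ∧ κ t ≤ 1) (r : ℝ) : |profQ κ r| ≤ 1 := by
  rw [profQ, abs_mul]
  have h1 : |1 - κ r| ≤ 1 := abs_le.2 ⟨by linarith [(h r).2], by linarith [(h r).1]⟩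
  exact mul_le_one₀ h1 (abs_nonneg _) (Real.abs_cos_le_one _)

namespace IsCutoff

theorem contDiff_potential (hκ : IsCutoff κ) : ContDiff ℝ ∞ (potential κ : X ν → ℝ) := by
  have h1 : ContDiff ℝ ∞ (profV κ) :=
    ((contDiff_const.sub hκ.smooth).mul (Real.contDiff_exp.comp (by fun_prop))).mul
      (Real.contDiff_sin.comp Real.contDiff_exp)
  refine contDiff_radial h1 fun r hr => ?_
  rw [profV, hκ.eq_one hr]
  simp

theorem profQ_eq_zero (hκ : IsCutoff κ) {r : ℝ} (hr : |r| < 1) : profQ κ r = 0 := by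
  rw [profQ, hκ.eq_one hr]
  simp

theorem contDiff_oscQ (hκ : IsCutoff κ) : ContDiff ℝ ∞ (oscQ κ : X ν → ℝ) :=
  contDiff_radial ((contDiff_const.sub hκ.smooth).mul (Real.contDiff_cos.comp Real.contDiff_exp))
    fun _ hr => hκ.profQ_eq_zero hr

theorem hasDerivAt_profQ (hκ : IsCutoff κ) (r : ℝ) : HasDerivAt (profQ κ)
    (-deriv κ r * Real.cos (Real.exp r) - (1 - κ r) * (Real.sin (Real.exp r) * Real.exp r)) r := by
  have h1 : HasDerivAt κ (deriv κ r) r := (hκ.smooth.differentiable (by simp) r).hasDerivAt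
  have h2 := (h1.const_sub 1).mul ((Real.hasDerivAt_exp r).cos)
  refine h2.congr_deriv ?_
  ring

theorem fderiv_oscQ (hκ : IsCutoff κ) (x v : X ν) : fderiv ℝ (oscQ κ) x v
    = (-deriv κ ‖x‖ * Real.cos (Real.exp ‖x‖)
      - (1 - κ ‖x‖) * (Real.sin (Real.exp ‖x‖) * Real.exp ‖x‖)) * (‖x‖⁻¹ * inner ℝ x v) := by
  by_cases hx : x = 0
  · subst hx
    have h2 : oscQ κ =ᶠ[𝓝 (0 : X ν)] fun _ => 0 := by
      filter_upwards [Metric.ball_mem_nhds (0 : X ν) one_pos] with y hy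
      rw [mem_ball_zero_iff] at hy
      exact hκ.profQ_eq_zero (by simpa using hy)
    rw [h2.fderiv_eq, fderiv_fun_const]
    simp
  · have h1 : HasFDerivAt (oscQ κ) _ x :=
      (hκ.hasDerivAt_profQ ‖x‖).comp_hasFDerivAt x (hasFDerivAt_norm hx)
    rw [h1.fderiv]
    rfl

theorem fderiv_oscQ_self (hκ : IsCutoff κ) (x : X ν) : fderiv ℝ (oscQ κ) x x
    = -(‖x‖ * deriv κ ‖x‖ * Real.cos (Real.exp ‖x‖))
      - (1 - κ ‖x‖) * (Real.sin (Real.exp ‖x‖) * (‖x‖ * Real.exp ‖x‖)) := by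
  rw [hκ.fderiv_oscQ, real_inner_self_eq_norm_sq]
  by_cases hx : ‖x‖ = 0
  · simp [hx]
  · field_simp

theorem exists_abs_fderiv_oscQ_le (hκ : IsCutoff κ) : ∃ C : ℝ, 0 ≤ C ∧ ∀ (x : X ν) (j : Fin ν),
    |fderiv ℝ (oscQ κ) x (stdVec j)| ≤ C * Real.exp ‖x‖ := by
  obtain ⟨C, hC0, hC⟩ := hκ.exists_abs_deriv_le
  refine ⟨C + 1, by positivity, fun x j => ?_⟩
  rw [hκ.fderiv_oscQ, inner_stdVec, abs_mul]
  have h1 : |‖x‖⁻¹ * x j| ≤ 1 := by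
    rw [abs_mul, abs_inv, abs_norm, ← div_eq_inv_mul]
    exact div_le_one_of_le₀ (by simpa using PiLp.norm_apply_le x j) (norm_nonneg x)
  have h2 : |1 - κ ‖x‖| ≤ 1 :=
    abs_le.2 ⟨by linarith [(hκ.range ‖x‖).2], by linarith [(hκ.range ‖x‖).1]⟩
  have h3 : |-deriv κ ‖x‖ * Real.cos (Real.exp ‖x‖)
      - (1 - κ ‖x‖) * (Real.sin (Real.exp ‖x‖) * Real.exp ‖x‖)| ≤ (C + 1) * Real.exp ‖x‖ := by
    refine (abs_sub _ _).trans ?_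
    rw [abs_mul, abs_neg, abs_mul, abs_mul, abs_of_pos (Real.exp_pos _)]
    have e1 : |deriv κ ‖x‖| * |Real.cos (Real.exp ‖x‖)| ≤ C * 1 :=
      mul_le_mul (hC _) (Real.abs_cos_le_one _) (abs_nonneg _) hC0
    have e2 : |1 - κ ‖x‖| * (|Real.sin (Real.exp ‖x‖)| * Real.exp ‖x‖)
        ≤ 1 * (1 * Real.exp ‖x‖) := by
      gcongr
      exact Real.abs_sin_le_one _
    have e3 : 1 ≤ Real.exp ‖x‖ := Real.one_le_exp (norm_nonneg x)
    nlinarith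
  calc _ ≤ (C + 1) * Real.exp ‖x‖ * 1 := mul_le_mul h3 h1 (abs_nonneg _) (by positivity)
    _ = _ := mul_one _

theorem exists_abs_mul_deriv_le (hκ : IsCutoff κ) : ∃ C : ℝ, 0 ≤ C ∧ ∀ r, |r * deriv κ r| ≤ C := by
  obtain ⟨C, hC⟩ := (hκ.supp.deriv.mul_left (f := fun r => r)).exists_bound_of_continuous
    (continuous_id.mul hκ.contDiff_deriv.continuous)
  exact ⟨C, (norm_nonneg _).trans (hC 0), hC⟩

theorem abs_potential_le (hκ : IsCutoff κ) (x : X ν) :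
    |potential κ x| ≤ Real.exp (3 * ‖x‖ / 4) := by
  rw [potential, abs_mul, abs_mul, abs_of_pos (Real.exp_pos _)]
  have h2 : |1 - κ ‖x‖| ≤ 1 :=
    abs_le.2 ⟨by linarith [(hκ.range ‖x‖).2], by linarith [(hκ.range ‖x‖).1]⟩
  calc _ ≤ 1 * Real.exp (3 * ‖x‖ / 4) * 1 := by
        gcongr
        exact Real.abs_sin_le_one _
    _ = _ := by ring

end IsCutoff

end Radial

end

section

variable {ν : ℕ}

/-! ### The potential is not of class `C¹` with respect to dilations -/

section Dilation

theorem H1.norm_sq_ofSchwartz_le {φ : 𝓢(X ν, ℂ)} {B B' ρ : ℝ} (hρ : 0 ≤ ρ)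
    (hB : ∀ x, ‖φ x‖ ≤ B) (hB' : ∀ (j : Fin ν) (x : X ν), ‖(∂_{stdVec j} φ : 𝓢(X ν, ℂ)) x‖ ≤ B')
    (hs : ∀ x, ρ < ‖x‖ → φ x = 0) :
    ‖H1.ofSchwartz φ‖ ^ 2
      ≤ (B ^ 2 + ν * B' ^ 2) * (ρ ^ ν * (volume : Measure (X ν)).real (Metric.ball 0 1)) := by
  rw [H1.norm_sq_eq, H1.toL2_ofSchwartz, add_mul]
  refine add_le_add (norm_sq_embL2_le hρ hB hs) ?_
  simp only [H1.d_ofSchwartz]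
  refine (Finset.sum_le_sum fun j _ => norm_sq_embL2_le hρ (hB' j)
    fun x hx => lineDeriv_eq_zero hs j hx).trans ?_
  rw [Finset.sum_const, Finset.card_univ, Fintype.card_fin, nsmul_eq_mul, mul_assoc]

theorem fderiv_ofReal {f : X ν → ℝ} (hf : ContDiff ℝ ∞ f) (x v : X ν) :
    fderiv ℝ (fun y => (f y : ℂ)) x v = (fderiv ℝ f x v : ℂ) := by
  have h1 : HasFDerivAt (fun x => (f x : ℂ)) (Complex.ofRealCLM.comp (fderiv ℝ f x)) x :=
    Complex.ofRealCLM.hasFDerivAt.comp x (hf.differentiable (by simp) x).hasFDerivAt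
  rw [h1.fderiv]
  rfl

theorem exists_abs_fderiv_cutoffR_self_le : ∃ C : ℝ, 0 ≤ C ∧ ∀ (n : ℕ) (x : X ν),
    |fderiv ℝ (cutoffR (1 / ((n : ℝ) + 1)) : X ν → ℝ) x x| ≤ C := by
  obtain ⟨C, hC0, hC⟩ := (plateau 0 : 𝓢(X ν, ℂ)).decay 1 1
  refine ⟨C, hC0.le, fun n x => ?_⟩
  have h1 : (fderiv ℝ (cutoffR (1 / ((n : ℝ) + 1)) : X ν → ℝ) x x : ℂ)
      = fderiv ℝ (plateau 0 : 𝓢(X ν, ℂ)) (shrink n x) (shrink n x) := by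
    rw [← fderiv_ofReal (contDiff_cutoffR _)]
    change fderiv ℝ (plateau n : 𝓢(X ν, ℂ)) x x = _
    have h2 : (plateau n : X ν → ℂ) = (plateau 0 : 𝓢(X ν, ℂ)) ∘ shrink n := by
      rw [plateau_eq]
      rfl
    rw [h2, ContinuousLinearEquiv.comp_right_fderiv]
    rfl
  have h3 := hC (shrink n x)
  rw [norm_iteratedFDeriv_one, pow_one] at h3
  rw [← Real.norm_eq_abs, ← Complex.norm_real, h1]
  refine (ContinuousLinearMap.le_opNorm _ _).trans ?_
  rw [mul_comm]
  exact h3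

/-- The radial derivative `x·∇f` plus the term `ν f / 2`. -/
def dilR (f : X ν → ℝ) (x : X ν) : ℝ := fderiv ℝ f x x + ν / 2 * f x

theorem continuous_dilR {f : X ν → ℝ} (hf : ContDiff ℝ ∞ f) : Continuous (dilR f) :=
  ((hf.continuous_fderiv (by simp)).clm_apply continuous_id).add
    (continuous_const.mul hf.continuous)

theorem I_smul_conjOp_dilationField_ofReal {f : X ν → ℝ} (hf : ContDiff ℝ ∞ f) {φ : 𝓢(X ν, ℂ)}
    (hφ : ∀ x, φ x = (f x : ℂ)) (x : X ν) :
    (Complex.I • conjOp (dilationField ν) φ) x = (dilR f x : ℂ) := by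
  have h : (φ : X ν → ℂ) = fun x => (f x : ℂ) := funext hφ
  rw [I_smul_conjOp_dilationField_apply, h, fderiv_ofReal hf, dilR]
  push_cast
  rfl

theorem integrable_mul_dilR {V f g : X ν → ℝ} (hV : ContDiff ℝ ∞ V) (hf : ContDiff ℝ ∞ f)
    (hg : Continuous g) (hgc : HasCompactSupport g) :
    Integrable fun x => V x * g x * dilR f x :=
  ((hV.continuous.mul hg).mul (continuous_dilR hf)).integrable_of_hasCompactSupport
    (hgc.mul_left.mul_right)

theorem inner_commutator_eq {V f g : X ν → ℝ} (hV : ContDiff ℝ ∞ V) (hf : ContDiff ℝ ∞ f)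
    (hg : ContDiff ℝ ∞ g) (hfc : HasCompactSupport f) (hgc : HasCompactSupport g)
    {φ ψ : 𝓢(X ν, ℂ)} (hφ : ∀ x, φ x = (f x : ℂ)) (hψ : ∀ x, ψ x = (g x : ℂ))
    (hφc : HasCompactSupport (φ : X ν → ℂ)) (hψc : HasCompactSupport (ψ : X ν → ℂ)) :
    inner ℂ (embL2 (testMul V hV ψ hψc)) (Complex.I • embL2 (conjOp (dilationField ν) φ))
      + inner ℂ (Complex.I • embL2 (conjOp (dilationField ν) ψ)) (embL2 (testMul V hV φ hφc))
      = ((∫ x, (V x * g x * dilR f x + V x * f x * dilR g x) : ℝ) : ℂ) := by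
  rw [integral_add (integrable_mul_dilR hV hf hg.continuous hgc)
    (integrable_mul_dilR hV hg hf.continuous hfc), Complex.ofReal_add, ← integral_complex_ofReal,
    ← integral_complex_ofReal, ← embL2_smul, ← embL2_smul, inner_embL2, inner_embL2]
  congr 1
  · congr 1
    ext x
    rw [I_smul_conjOp_dilationField_ofReal hf hφ, testMul_apply, hψ, map_mul, Complex.conj_ofReal,
      Complex.conj_ofReal]
    push_cast
    ring
  · congr 1
    ext x
    rw [I_smul_conjOp_dilationField_ofReal hg hψ, testMul_apply, hφ, Complex.conj_ofReal]
    push_cast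
    ring

theorem integral_indicator_closedBall {ρ : ℝ} (hρ : 0 ≤ ρ) (c : ℝ) :
    Integrable ((Metric.closedBall (0 : X ν) ρ).indicator fun _ => c) ∧
    ∫ x, (Metric.closedBall (0 : X ν) ρ).indicator (fun _ => c) x
      = c * (ρ ^ ν * (volume : Measure (X ν)).real (Metric.ball 0 1)) := by
  refine ⟨(integrable_indicator_iff measurableSet_closedBall).2
    (integrableOn_const measure_closedBall_lt_top.ne), ?_⟩
  rw [integral_indicator measurableSet_closedBall, setIntegral_const,
    Measure.addHaar_real_closedBall _ _ hρ, finrank_euclideanSpace_fin, smul_eq_mul, mul_comm]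

variable {κ : ℝ → ℝ}

theorem IsCutoff.commutator_integrand_le (hκ : IsCutoff κ) {C₁ C₂ : ℝ}
    (hC₁ : ∀ r, |r * deriv κ r| ≤ C₁)
    (hC₂ : ∀ (n : ℕ) (x : X ν), |fderiv ℝ (cutoffR (1 / ((n : ℝ) + 1)) : X ν → ℝ) x x| ≤ C₂)
    {n : ℕ} (hn : ∀ r, (n : ℝ) ≤ r → κ r = 0) (hn1 : 1 ≤ n) (x : X ν) :
    Real.exp (7 / 4 * (2 * ((n : ℝ) + 1) - 1)) * shell (2 * ((n : ℝ) + 1)) x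
      - (Metric.closedBall (0 : X ν) (3 * ((n : ℝ) + 1))).indicator
        (fun _ => (C₁ + 2 * C₂ + ν) * Real.exp (9 / 4 * ((n : ℝ) + 1))) x
      ≤ -(potential κ x * (oscQ κ x * cutoffR (1 / ((n : ℝ) + 1)) x)
            * dilR (cutoffR (1 / ((n : ℝ) + 1))) x
          + potential κ x * cutoffR (1 / ((n : ℝ) + 1)) x
            * dilR (fun y => oscQ κ y * cutoffR (1 / ((n : ℝ) + 1)) y) x) := by
  set R : ℝ := (n : ℝ) + 1 with hR
  have hn1' : (1 : ℝ) ≤ n := by exact_mod_cast hn1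
  set θ : X ν → ℝ := cutoffR (1 / R) with hθ
  have hθs : ContDiff ℝ ∞ θ := contDiff_cutoffR _
  have hq : fderiv ℝ (fun y => oscQ κ y * θ y) x x
      = oscQ κ x * fderiv ℝ θ x x + θ x * fderiv ℝ (oscQ κ) x x := by
    have h1 := ((hκ.contDiff_oscQ (ν := ν)).differentiable (by simp) x).hasFDerivAt.mul
      (hθs.differentiable (by simp) x).hasFDerivAt
    have h2 : fderiv ℝ (fun y => oscQ κ y * θ y) x = _ := h1.fderiv
    rw [h2]
    rfl
  have hexpand : -(potential κ x * (oscQ κ x * θ x) * dilR θ x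
      + potential κ x * θ x * dilR (fun y => oscQ κ y * θ y) x)
      = θ x ^ 2 * (1 - κ ‖x‖) ^ 2 * (‖x‖ * (Real.exp (3 * ‖x‖ / 4) * Real.exp ‖x‖))
          * Real.sin (Real.exp ‖x‖) ^ 2
        + θ x * (potential κ x * (θ x * ((‖x‖ * deriv κ ‖x‖) * Real.cos (Real.exp ‖x‖))
          - 2 * (oscQ κ x * fderiv ℝ θ x x) - ν * (oscQ κ x * θ x))) := by
    rw [dilR, dilR, hq, hκ.fderiv_oscQ_self, potential]
    ring
  rw [hexpand]
  have hmain : Real.exp (7 / 4 * (2 * R - 1)) * shell (2 * R) x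
      ≤ θ x ^ 2 * (1 - κ ‖x‖) ^ 2 * (‖x‖ * (Real.exp (3 * ‖x‖ / 4) * Real.exp ‖x‖))
          * Real.sin (Real.exp ‖x‖) ^ 2 := by
    by_cases hx : ‖x‖ ∈ Set.Icc (2 * R - 1) (2 * R)
    · rw [shell_eq hx, hθ, cutoffR_plateau_eq_one hx.2, hn _ (by linarith [hx.1]), ← Real.exp_add]
      refine mul_le_mul_of_nonneg_right ?_ (sq_nonneg _)
      have e1 : Real.exp (7 / 4 * (2 * R - 1)) ≤ Real.exp (3 * ‖x‖ / 4 + ‖x‖) :=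
        Real.exp_le_exp.2 (by linarith [hx.1])
      have e2 : 1 ≤ ‖x‖ := by linarith [hx.1]
      have e3 := Real.exp_pos (3 * ‖x‖ / 4 + ‖x‖)
      nlinarith
    · rw [shell_eq_zero hx, mul_zero]
      positivity
  have herr : -((Metric.closedBall (0 : X ν) (3 * R)).indicator
      (fun _ => (C₁ + 2 * C₂ + ν) * Real.exp (9 / 4 * R)) x)
      ≤ θ x * (potential κ x * (θ x * ((‖x‖ * deriv κ ‖x‖) * Real.cos (Real.exp ‖x‖))
          - 2 * (oscQ κ x * fderiv ℝ θ x x) - ν * (oscQ κ x * θ x))) := by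
    by_cases hx : ‖x‖ ≤ 3 * R
    · rw [Set.indicator_of_mem (mem_closedBall_zero_iff.2 hx)]
      refine (abs_le.1 ?_).1
      have hθ1 : |θ x| ≤ 1 := by
        rw [abs_of_nonneg (cutoffR_nonneg _ _)]
        exact cutoffR_le_one _ _
      have hq1 : |oscQ κ x| ≤ 1 := profQ_abs_le hκ.range _
      have hV : |potential κ x| ≤ Real.exp (9 / 4 * R) :=
        (hκ.abs_potential_le x).trans (Real.exp_le_exp.2 (by linarith))
      have hC₂0 : 0 ≤ C₂ := (abs_nonneg _).trans (hC₂ n x)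
      have hC₁0 : 0 ≤ C₁ := (abs_nonneg _).trans (hC₁ 0)
      have e1 : |θ x * ((‖x‖ * deriv κ ‖x‖) * Real.cos (Real.exp ‖x‖))| ≤ 1 * (C₁ * 1) := by
        rw [abs_mul, abs_mul (‖x‖ * deriv κ ‖x‖)]
        exact mul_le_mul hθ1 (mul_le_mul (hC₁ _) (Real.abs_cos_le_one _) (abs_nonneg _) hC₁0)
          (by positivity) zero_le_one
      have e2 : |2 * (oscQ κ x * fderiv ℝ θ x x)| ≤ 2 * (1 * C₂) := by
        rw [abs_mul, abs_mul (oscQ κ x), abs_of_pos (two_pos : (0 : ℝ) < 2)]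
        exact mul_le_mul_of_nonneg_left (mul_le_mul hq1 (hC₂ n x) (abs_nonneg _) zero_le_one)
          zero_le_two
      have e3 : |(ν : ℝ) * (oscQ κ x * θ x)| ≤ ν * (1 * 1) := by
        rw [abs_mul, abs_mul (oscQ κ x), Nat.abs_cast]
        exact mul_le_mul_of_nonneg_left (mul_le_mul hq1 hθ1 (abs_nonneg _) zero_le_one)
          (Nat.cast_nonneg _)
      rw [abs_mul, abs_mul]
      have e4 := (abs_sub (θ x * ((‖x‖ * deriv κ ‖x‖) * Real.cos (Real.exp ‖x‖))
          - 2 * (oscQ κ x * fderiv ℝ θ x x)) (ν * (oscQ κ x * θ x))).trans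
        (add_le_add_left (abs_sub (θ x * ((‖x‖ * deriv κ ‖x‖) * Real.cos (Real.exp ‖x‖)))
          (2 * (oscQ κ x * fderiv ℝ θ x x))) _)
      have e5 := mul_le_mul hV (e4.trans (add_le_add (add_le_add e1 e2) e3)) (abs_nonneg _)
        (Real.exp_pos _).le
      refine (mul_le_mul hθ1 e5 (by positivity) zero_le_one).trans (le_of_eq ?_)
      ring
    · have h0 : θ x = 0 := by
        rw [hθ]
        refine cutoffR_eq_zero (by positivity) ?_
        rw [one_div_mul_eq_div, le_div_iff₀ (by positivity)]
        exact (not_le.1 hx).le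
      rw [Set.indicator_of_notMem (by simpa using not_le.1 hx), h0]
      simp
  linarith

theorem exists_norm_lineDeriv_testMul_oscQ_le (hκ : IsCutoff κ) : ∃ C : ℝ, 0 ≤ C ∧
    ∀ (n : ℕ) (j : Fin ν) (x : X ν),
      ‖(∂_{stdVec j} (testMul (oscQ κ) hκ.contDiff_oscQ (plateau n : 𝓢(X ν, ℂ))
        (hasCompactSupport_plateau n)) :
        𝓢(X ν, ℂ)) x‖ ≤ C * Real.exp (3 * ((n : ℝ) + 1)) := by
  obtain ⟨M, hM0, hM⟩ := exists_norm_lineDeriv_plateau_le (ν := ν)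
  obtain ⟨C, hC0, hC⟩ := hκ.exists_abs_fderiv_oscQ_le (ν := ν)
  refine ⟨M + C, by positivity, fun n j x => ?_⟩
  have hq1 : |oscQ κ x| ≤ 1 := profQ_abs_le hκ.range _
  have h1 : 1 ≤ Real.exp (3 * ((n : ℝ) + 1)) := Real.one_le_exp (by positivity)
  by_cases hx : ‖x‖ ≤ 3 * ((n : ℝ) + 1)
  · rw [lineDeriv_testMul]
    refine (norm_add_le _ _).trans ?_
    rw [norm_mul, norm_mul, Complex.norm_real, Complex.norm_real, Real.norm_eq_abs,
      Real.norm_eq_abs, add_mul, add_comm]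
    refine add_le_add ?_ ?_
    · calc _ ≤ 1 * M := mul_le_mul hq1 (hM n j x) (norm_nonneg _) zero_le_one
        _ ≤ M * Real.exp (3 * ((n : ℝ) + 1)) := by
          rw [one_mul]
          exact le_mul_of_one_le_right hM0 h1
    · calc _ ≤ C * Real.exp ‖x‖ * 1 :=
            mul_le_mul (hC x j) (norm_plateau_le n x) (norm_nonneg _) (by positivity)
        _ ≤ C * Real.exp (3 * ((n : ℝ) + 1)) := by
          rw [mul_one]
          exact mul_le_mul_of_nonneg_left (Real.exp_le_exp.2 hx) hC0
  · rw [lineDeriv_eq_zero (ρ := 3 * ((n : ℝ) + 1)) (fun y hy => by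
      rw [testMul_apply, plateau_eq_zero hy.le, mul_zero]) j (not_le.1 hx), norm_zero]
    positivity

theorem mul_le_of_sq_le {x y a b p E : ℝ} (ha : 0 ≤ a) (hb : 0 ≤ b) (hp : 0 ≤ p)
    (hE : 0 ≤ E) (hx : x ^ 2 ≤ a * p) (hy : y ^ 2 ≤ b * E ^ 2 * p) : x * y ≤ (a + b) * E * p := by
  refine (le_abs_self _).trans (abs_le_of_sq_le_sq ?_ (by positivity))
  calc (x * y) ^ 2 = x ^ 2 * y ^ 2 := mul_pow _ _ _
    _ ≤ (a * p) * (b * E ^ 2 * p) := mul_le_mul hx hy (sq_nonneg _) (by positivity)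
    _ = (a * b) * (E * p) ^ 2 := by ring
    _ ≤ (a + b) ^ 2 * (E * p) ^ 2 := by
      refine mul_le_mul_of_nonneg_right ?_ (sq_nonneg _)
      nlinarith [mul_nonneg ha hb]
    _ = _ := by ring

theorem IsCutoff.not_isOfClass_dilationField (hκ : IsCutoff κ) (hν : 1 ≤ ν) :
    ¬ IsOfClass 1 (dilationField ν) (potentialOp κ) := by
  intro h
  obtain ⟨C, hC0, hC⟩ := h.exists_commutator_le isField_dilationField hκ.isMultiplicationBy
    hκ.contDiff_potential
  obtain ⟨s, hs0, hs⟩ := exists_integral_shell_ge hν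
  obtain ⟨r₀, hr₀⟩ := hκ.exists_eq_zero
  obtain ⟨C₁, hC₁0, hC₁⟩ := hκ.exists_abs_mul_deriv_le
  obtain ⟨C₂, hC₂0, hC₂⟩ := exists_abs_fderiv_cutoffR_self_le (ν := ν)
  obtain ⟨M, hM0, hM⟩ := exists_norm_lineDeriv_plateau_le (ν := ν)
  obtain ⟨N, hN0, hN⟩ := exists_norm_lineDeriv_testMul_oscQ_le (ν := ν) hκ
  set v : ℝ := (volume : Measure (X ν)).real (Metric.ball 0 1) with hv
  set A : ℝ := (1 ^ 2 + ν * M ^ 2) + (1 + ν * N ^ 2) with hA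
  set L : ℝ := (C₁ + 2 * C₂ + ν) + C * A with hL
  set K : ℝ := L * Real.exp (7 / 4) * 3 ^ ν * v / s with hK
  obtain ⟨n₀, hn₀⟩ := exists_const_mul_pow_lt_exp (α := 1 / 2) (by norm_num) ν K
  obtain ⟨n₁, hn₁⟩ := exists_nat_ge r₀
  set n : ℕ := max n₀ (max n₁ 1) with hn
  have hn1 : 1 ≤ n := (le_max_right n₁ 1).trans (le_max_right n₀ _)
  have hn1' : (1 : ℝ) ≤ n := by exact_mod_cast hn1
  have hnr : r₀ ≤ n := hn₁.trans (by exact_mod_cast (le_max_left n₁ 1).trans (le_max_right n₀ _))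
  set R : ℝ := (n : ℝ) + 1 with hR
  set p : ℝ := (3 * R) ^ ν * v with hp
  have hp0 : 0 ≤ p := by positivity
  set φ : 𝓢(X ν, ℂ) := plateau n with hφ
  have hφc : HasCompactSupport (φ : X ν → ℂ) := hasCompactSupport_plateau n
  set ψ : 𝓢(X ν, ℂ) := testMul (oscQ κ) hκ.contDiff_oscQ φ hφc with hψ
  have hψc : HasCompactSupport (ψ : X ν → ℂ) := hasCompactSupport_testMul _ hφc
  have h1 : ‖H1.ofSchwartz φ‖ ^ 2 ≤ (1 ^ 2 + ν * M ^ 2) * p :=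
    H1.norm_sq_ofSchwartz_le (by positivity) (norm_plateau_le n) (hM n) (plateau_eq_zero_of_lt n)
  have hE1 : 1 ≤ Real.exp (3 * R) := Real.one_le_exp (by positivity)
  have h2 : ‖H1.ofSchwartz ψ‖ ^ 2 ≤ (1 + ν * N ^ 2) * Real.exp (3 * R) ^ 2 * p := by
    have e1 : ‖H1.ofSchwartz ψ‖ ^ 2 ≤ (1 ^ 2 + ν * (N * Real.exp (3 * R)) ^ 2) * p := by
      refine H1.norm_sq_ofSchwartz_le (by positivity) (fun x => ?_) (hN n) (fun x hx => ?_)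
      · rw [hψ, testMul_apply, norm_mul, Complex.norm_real, Real.norm_eq_abs]
        exact mul_le_one₀ (profQ_abs_le hκ.range _) (norm_nonneg _) (norm_plateau_le n x)
      · rw [hψ, testMul_apply, hφ, plateau_eq_zero_of_lt n x hx, mul_zero]
    refine e1.trans (mul_le_mul_of_nonneg_right ?_ hp0)
    have e2 : 1 ≤ Real.exp (3 * R) ^ 2 := one_le_pow₀ hE1
    nlinarith
  have h3 : C * ‖H1.ofSchwartz φ‖ * ‖H1.ofSchwartz ψ‖ ≤ C * (A * Real.exp (3 * R) * p) := by
    rw [mul_assoc]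
    exact mul_le_mul_of_nonneg_left (mul_le_of_sq_le (by positivity) (by positivity) hp0
      (Real.exp_pos _).le h1 h2) hC0
  have hθs : ContDiff ℝ ∞ (cutoffR (1 / R) : X ν → ℝ) := contDiff_cutoffR _
  have hθc : HasCompactSupport (cutoffR (1 / R) : X ν → ℝ) :=
    hasCompactSupport_cutoffR (by positivity)
  have h4 := inner_commutator_eq hκ.contDiff_potential hθs (hκ.contDiff_oscQ.mul hθs) hθc
    hθc.mul_left (φ := φ) (ψ := ψ) (fun x => rfl)
    (fun x => by
      rw [hψ, testMul_apply, hφ, plateau_apply, cutoff]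
      exact (Complex.ofReal_mul _ _).symm) hφc hψc
  have h5 := (hC φ ψ hφc hψc).trans h3
  rw [h4, Complex.norm_real, Real.norm_eq_abs] at h5
  have h6 := (neg_le_abs _).trans h5
  rw [← integral_neg] at h6
  obtain ⟨hi, hi'⟩ := integral_indicator_closedBall (ν := ν) (ρ := 3 * R) (by positivity)
    ((C₁ + 2 * C₂ + ν) * Real.exp (9 / 4 * R))
  have h7 := integral_mono (((integrable_shell (ν := ν) (2 * R)).const_mul
      (Real.exp (7 / 4 * (2 * R - 1)))).sub hi)
    ((integrable_mul_dilR hκ.contDiff_potential hθs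
      (hκ.contDiff_oscQ.mul hθs).continuous hθc.mul_left).add
      (integrable_mul_dilR hκ.contDiff_potential (hκ.contDiff_oscQ.mul hθs)
        hθs.continuous hθc)).neg
    (hκ.commutator_integrand_le hC₁ hC₂ (fun r hr => hr₀ r (hnr.trans hr)) hn1)
  have h8 := h7.trans h6
  rw [integral_sub' ((integrable_shell (ν := ν) (2 * R)).const_mul _) hi, hi', integral_const_mul]
    at h8
  have h9 := mul_le_mul_of_nonneg_left (hs (2 * R) (by linarith))
    (Real.exp_pos (7 / 4 * (2 * R - 1))).le
  have h10 : Real.exp (7 / 4 * (2 * R - 1)) * s ≤ L * Real.exp (3 * R) * p := by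
    have e1 : (C₁ + 2 * C₂ + ν) * Real.exp (9 / 4 * R) * p
        ≤ (C₁ + 2 * C₂ + ν) * Real.exp (3 * R) * p := by
      gcongr
      norm_num
    calc _ ≤ (C₁ + 2 * C₂ + ν) * Real.exp (3 * R) * p + C * (A * Real.exp (3 * R) * p) := by
          linarith
      _ = _ := by rw [hL]; ring
  have h11 := mul_lt_mul_of_pos_right (hn₀ n (le_max_left _ _)) hs0
  have h12 : K * R ^ ν * s = L * p * Real.exp (7 / 4) := by
    rw [hK, hp, mul_pow]
    field_simp
  have h13 : Real.exp (7 / 4 * (2 * R - 1)) * Real.exp (7 / 4)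
      = Real.exp (1 / 2 * R) * Real.exp (3 * R) := by
    rw [← Real.exp_add, ← Real.exp_add]
    ring_nf
  rw [h12] at h11
  have h14 := mul_lt_mul_of_pos_right h11 (Real.exp_pos (3 * R))
  have h15 := mul_le_mul_of_nonneg_right h10 (Real.exp_pos (7 / 4)).le
  have h16 : Real.exp (7 / 4 * (2 * R - 1)) * s * Real.exp (7 / 4)
      = Real.exp (1 / 2 * R) * s * Real.exp (3 * R) := by
    linear_combination s * h13
  rw [h16] at h15
  linarith

end Dilation

end

end Oscillating

end

theorem lemmal (ν : ℕ) (hν : 1 ≤ ν) (κ : ℝ → ℝ)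
    (hκ_smooth : ContDiff ℝ ∞ κ) (hκ_supp : HasCompactSupport κ)
    (hκ_one : ∀ t ∈ Set.Icc (-1 : ℝ) 1, κ t = 1) (hκ_range : ∀ t : ℝ, 0 ≤ κ t ∧ κ t ≤ 1) :
    -- multiplication by `V` defines a unique bounded operator `T : H¹ → H⁻¹`, and
    (∃ T : Oscillating.H1 ν →L[ℂ] Oscillating.Hneg1 ν,
      Oscillating.IsMultiplicationBy (Oscillating.potential κ) T ∧
      (∀ S : Oscillating.H1 ν →L[ℂ] Oscillating.Hneg1 ν,
        Oscillating.IsMultiplicationBy (Oscillating.potential κ) S → S = T) ∧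
      -- it is compact,
      IsCompactOperator T ∧
      -- it is of class `C^∞(A_u, H¹, H⁻¹)` for every `u ∈ 𝒰`,
      (∀ u : Oscillating.X ν → Oscillating.X ν, Oscillating.IsAdmissible u →
        Oscillating.IsOfClass ⊤ u T) ∧
      -- and it is not of class `C¹(A_D, H¹, H⁻¹)` (the group `e^{itA_D}` on `H¹` being well defined);
      (∃ W : ℝ → Oscillating.H1 ν →L[ℂ] Oscillating.H1 ν,
        Oscillating.IsConjGroupH1 (Oscillating.dilationField ν) W) ∧
      ¬ Oscillating.IsOfClass 1 (Oscillating.dilationField ν) T) ∧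
    -- and `V` is not `Δ`-bounded.
    ¬ Oscillating.IsLaplacianBounded (Oscillating.potential (ν := ν) κ) := by
  have hκ : Oscillating.IsCutoff κ := ⟨hκ_smooth, hκ_supp, hκ_one, hκ_range⟩
  refine ⟨⟨Oscillating.potentialOp κ, hκ.isMultiplicationBy, fun S hS =>
    hS.unique hκ.isMultiplicationBy, hκ.isCompactOperator_potentialOp, fun u hu => hκ.isOfClass hu,
    Oscillating.exists_isConjGroupH1 Oscillating.isField_dilationField, ?_⟩, ?_⟩
  · exact hκ.not_isOfClass_dilationField hν
  · exact hκ.not_isLaplacianBounded hν
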